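/- Let $V$ be a Hausdorff smooth manifold with a smooth vector field $R$ and let $J$ be a cylindrical almost complex structure on $\mathbb{R}\times V$ (smooth, $\mathbb{R}$-invariant, $J\partial_s=R$); for instance $R$ may be the Reeb vector field of a stable Hamiltonian structure and $J$ a compatible cylindrical almost complex structure. Let $\gamma$ be a simple closed orbit of $R$ with period $T>0$, let $n^+,n^-\ge 0$ with $n=n^++n^-\geq 3$, and let $m^\pm_1,\dots,m^\pm_{n^\pm}\ge 1$ be integers with $\sum_k m_k^+=\sum_k m_k^-$. Put $m^\pm=\prod_k m^\pm_k$, and let $M_{0,n}$ be the space of ordered $n$-tuples of distinct points of $\mathbb{CP}^1$ modulo $\mathrm{Aut}(\mathbb{CP}^1)$. A (connected, unnodal, genus-zero) orbit curve over $\gamma$ with these multiplicities consists of distinct punctures $z^\pm_k\in\mathbb{CP}^1$, asymptotic markers $\mu_k^\pm\in (T_{z_k^\pm}\mathbb{CP}^1\setminus 0)/\mathbb{R}_{+}$, and a $J$-holomorphic map $u=(a,f)$ from the punctured sphere to $\mathbb{R}\times V$ with image in $\mathbb{R}\times\gamma(\mathbb{R})$ such that, in cylindrical coordinates $(s,t)\in\mathbb{R}^\pm\times\mathbb{R}/\mathbb{Z}$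 near $z_k^\pm$ in which $\mu_k^\pm$ is the direction $t=0$, one has $a\to\pm\infty$ and $f\to\gamma(m_k^\pm T t)$ uniformly in $t$ as $s\to\pm\infty$. Let $\mathcal{M}$ be the set of orbit curves modulo $\mathrm{Aut}(\mathbb{CP}^1)$ and modulo translations of the target in the $\mathbb{R}$-direction, with the quotient of the topology of convergence of markers and punctures and locally uniform convergence of maps away from the punctures. Let $u_0:\mathbb{C}^*\to\mathbb{R}\times V$, $e^{2\pi(s+it)}\mapsto(Ts,\gamma(Tt))$, be the trivial cylinder. Then: 1. For given distinct punctures, a map $u$ underlies an orbit curve if and only if $u=u_0\circ h$ for a meromorphic function $h$ on $\mathbb{CP}^1$ whose poles are exactly the $z_k^+$, of order $m_k^+$, and whose zeros are exactly the $z_k^-$, of order $m_k^-$; this $h$ is then unique. The possible markers of $u$ at $z_k^\pm$ form one orbit under rotation by the $m_k^\pm$-th roots of unity, independently for all punctures. 2. There is a bijection $$\Phi:\ \mathcal{M}\ \cong\ S^1\times M_{0,n}\times\mathbb{Z}_{m^+}\times\mathbb{Z}_{m^-}$$ such that: the $M_{0,n}$-component of a curve is its underlying punctured sphere; replacing the meromorphic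 function $h$ of a curve by $ah$ with $a\in\mathbb{C}^*$ (with any admissible markers) multiplies the $S^1$-component by $a/|a|$; and, for suitable bijections of sets $\prod_k\mathbb{Z}_{m_k^\pm}\cong\mathbb{Z}_{m^\pm}$, rotating the markers $\mu^\pm_k$ by $e^{2\pi i j_k^\pm/m_k^\pm}$ leaves the first two components unchanged and adds $(j_k^\pm)_k$ to the last two. The map $\mathcal{M}\to S^1\times M_{0,n}$ given by the first two components is a covering map (so the quotient of $\mathcal{M}$ that forgets the markers is homeomorphic to $S^1\times M_{0,n}$). -/

import Mathlib

open scoped Manifold ContDiff Topology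
open Set Filter

/-! ### The Riemann sphere and asymptotic markers

The Riemann sphere is `OnePoint ℂ`, with its automorphism group acting through Mathlib's action
of `GL (Fin 2) ℂ` by Möbius transformations. For `g : GL (Fin 2) ℂ` the map
`w : ℂ ↦ g • (w : OnePoint ℂ)` is called the affine coordinate given by `g`; these maps form a
holomorphic atlas, and the coordinate given by `g` is centred at `g • 0`. -/

/-- The subgroup of `GL (Fin 2) ℂ` of those `h` whose Möbius transformation
`w ↦ (h₀₀ w + h₀₁) / (h₁₀ w + h₁₁)` fixes `0` and has at `0` a positive real derivative, namely
`h₀₀ / h₁₁ > 0`. -/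
def directionStabilizer : Subgroup (GL (Fin 2) ℂ) where
  carrier := {h | h 0 1 = 0 ∧ ∃ r : ℝ, 0 < r ∧ h 0 0 = r * h 1 1}
  one_mem' := ⟨by simp, 1, one_pos, by simp⟩
  mul_mem' := by
    rintro a b ⟨ha, r, hr, har⟩ ⟨hb, s, hs, hbs⟩
    refine ⟨?_, r * s, mul_pos hr hs, ?_⟩
    · simp [Matrix.mul_apply, Fin.sum_univ_two, ha, hb]
    · simp [Matrix.mul_apply, Fin.sum_univ_two, ha, hb, har, hbs]
      ring
  inv_mem' := by
    rintro a ⟨ha, r, hr, har⟩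
    refine ⟨?_, r⁻¹, inv_pos.mpr hr, ?_⟩
    · simp [Matrix.inv_def, Matrix.adjugate_fin_two, ha]
    · have hr' : (r : ℂ) ≠ 0 := by exact_mod_cast hr.ne'
      simp [Matrix.inv_def, Matrix.adjugate_fin_two, har]
      field_simp

/-- The space of pairs consisting of a point `p` of the Riemann sphere and a direction
`μ ∈ (T_p ∖ {0}) / ℝ_{>0}`. The class of `g` is the point `g • 0` with the direction of the image of
the positive real axis under the differential at `0` of the affine coordinate given by `g`; the
group of automorphisms acts transitively on these pairs, and acts here by left multiplication. The
topology is the quotient topology. -/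
abbrev SphereDirection : Type := GL (Fin 2) ℂ ⧸ directionStabilizer

namespace SphereDirection

/-- The base point of a direction. -/
noncomputable def point : SphereDirection → OnePoint ℂ :=
  Quotient.lift (fun g : GL (Fin 2) ℂ => g • ((0 : ℂ) : OnePoint ℂ)) (by
    intro a b hab
    obtain ⟨h01, r, hr, h00⟩ := QuotientGroup.leftRel_apply.mp hab
    have key : (a⁻¹ * b) • ((0 : ℂ) : OnePoint ℂ) = ((0 : ℂ) : OnePoint ℂ) := by
      have hdet := (a⁻¹ * b).det_ne_zero
      have h11 : (a⁻¹ * b) 1 1 ≠ 0 := by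
        intro h
        apply hdet
        rw [Matrix.det_fin_two, h, h01]
        ring
      rw [OnePoint.smul_some_eq_ite]
      rw [if_neg (by simpa using h11)]
      simp [h01]
    have := congrArg (fun p => a • p) key
    simpa [smul_smul] using this.symm)

theorem point_smul (A : GL (Fin 2) ℂ) (μ : SphereDirection) :
    (A • μ).point = A • μ.point := by
  induction μ using Quotient.inductionOn with
  | h g => exact mul_smul A g _

/-- The rotation `w ↦ ζ w` as an element of `GL (Fin 2) ℂ`. -/
noncomputable def rotationMatrix (ζ : Circle) : GL (Fin 2) ℂ :=
  Matrix.GeneralLinearGroup.mkOfDetNeZero !![(ζ : ℂ), 0; 0, 1] (by simp)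

/-- The direction at the same point obtained by multiplying by the unit complex number `ζ`. -/
noncomputable def rotate (ζ : Circle) : SphereDirection → SphereDirection :=
  Quotient.map' (fun g => g * rotationMatrix ζ) (by
    intro a b hab
    obtain ⟨h01, r, hr, h00⟩ := QuotientGroup.leftRel_apply.mp hab
    apply QuotientGroup.leftRel_apply.mpr
    have e : (a * rotationMatrix ζ)⁻¹ * (b * rotationMatrix ζ)
        = rotationMatrix ζ⁻¹ * (a⁻¹ * b) * rotationMatrix ζ := by
      have : (rotationMatrix ζ)⁻¹ = rotationMatrix ζ⁻¹ := by
        apply inv_eq_of_mul_eq_one_right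
        ext i j
        fin_cases i <;> fin_cases j <;>
          simp [rotationMatrix, Matrix.GeneralLinearGroup.mkOfDetNeZero]
      rw [mul_inv_rev, this]
      group
    rw [e]
    generalize a⁻¹ * b = c at *
    refine ⟨?_, r, hr, ?_⟩
    · simp [rotationMatrix, Matrix.GeneralLinearGroup.mkOfDetNeZero, Matrix.vecMul,
        Matrix.mul_apply, dotProduct, h01]
    · simp [rotationMatrix, Matrix.GeneralLinearGroup.mkOfDetNeZero, Matrix.vecMul,
        Matrix.mul_apply, dotProduct, h00]
      field_simp)

end SphereDirection

/-! ### Moduli space of punctured spheres -/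

/-- Ordered tuples of distinct points of the Riemann sphere, labelled by `ι`. -/
abbrev PuncturedSphere (ι : Type) : Type := {z : ι → OnePoint ℂ // Function.Injective z}

/-- Two punctured spheres are isomorphic if an automorphism of the Riemann sphere takes the
punctures of one to those of the other, respecting labels. -/
instance PuncturedSphere.setoid (ι : Type) : Setoid (PuncturedSphere ι) where
  r z z' := ∃ A : GL (Fin 2) ℂ, ∀ k, z'.1 k = A • z.1 k
  iseqv :=
    { refl := fun _ => ⟨1, fun _ => (one_smul _ _).symm⟩
      symm := by
        rintro z z' ⟨A, hA⟩
        exact ⟨A⁻¹, fun k => by rw [hA, inv_smul_smul]⟩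
      trans := by
        rintro z z' z'' ⟨A, hA⟩ ⟨B, hB⟩
        exact ⟨B * A, fun k => by rw [hB, hA, mul_smul]⟩ }

/-- The moduli space `M_{0,n}` of spheres with punctures labelled by a set `ι` of `n` elements, with
the quotient topology. -/
abbrev SphereModuli (ι : Type) : Type := Quotient (PuncturedSphere.setoid ι)

/-! ### The target: cylindrical almost complex structures and closed orbits -/

/-- A vector field `reeb` on the manifold `V` together with a cylindrical almost complex structure
on `ℝ × V`, i.e. an `ℝ`-invariant smooth almost complex structure `J` with `J ∂_s = reeb`. (The
hyperplane distribution `TV ∩ J TV` is determined by `J`.) -/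
structure CylindricalStructure (E : Type*) [NormedAddCommGroup E] [NormedSpace ℝ E]
    (V : Type*) [TopologicalSpace V] [ChartedSpace E V] [IsManifold 𝓘(ℝ, E) ∞ V] where
  reeb : ∀ x : V, TangentSpace 𝓘(ℝ, E) x
  reeb_smooth : ContMDiff 𝓘(ℝ, E) 𝓘(ℝ, E).tangent ∞
    (fun x => (⟨x, reeb x⟩ : TangentBundle 𝓘(ℝ, E) V))
  J : ∀ p : ℝ × V, TangentSpace (𝓘(ℝ, ℝ).prod 𝓘(ℝ, E)) p →L[ℝ]
    TangentSpace (𝓘(ℝ, ℝ).prod 𝓘(ℝ, E)) p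
  J_smooth : ContMDiff (𝓘(ℝ, ℝ).prod 𝓘(ℝ, E)).tangent (𝓘(ℝ, ℝ).prod 𝓘(ℝ, E)).tangent ∞
    (fun v : TangentBundle (𝓘(ℝ, ℝ).prod 𝓘(ℝ, E)) (ℝ × V) =>
      (⟨v.1, J v.1 v.2⟩ : TangentBundle (𝓘(ℝ, ℝ).prod 𝓘(ℝ, E)) (ℝ × V)))
  J_sq : ∀ p v, J p (J p v) = -v
  J_invariant : ∀ (a b : ℝ) (x : V) (v : ℝ × E), (J (a, x) v : ℝ × E) = J (b, x) v
  J_ds : ∀ (a : ℝ) (x : V), (J (a, x) ((1, 0) : ℝ × E) : ℝ × E) = ((0 : ℝ), (reeb x : E))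

/-- A simple closed orbit of the vector field, with its period. -/
structure SimpleClosedOrbit {E : Type*} [NormedAddCommGroup E] [NormedSpace ℝ E]
    {V : Type*} [TopologicalSpace V] [ChartedSpace E V] [IsManifold 𝓘(ℝ, E) ∞ V]
    (X : CylindricalStructure E V) where
  orbit : ℝ → V
  period : ℝ
  period_pos : 0 < period
  isIntegralCurve : IsMIntegralCurve orbit X.reeb
  periodic : Function.Periodic orbit period
  injOn : InjOn orbit (Ico 0 period)

section Curves

variable {E : Type*} [NormedAddCommGroup E] [NormedSpace ℝ E]
  {V : Type*} [TopologicalSpace V] [ChartedSpace E V] [IsManifold 𝓘(ℝ, E) ∞ V]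
  {X : CylindricalStructure E V}

/-- The trivial cylinder `(s, t) ↦ (T s, γ (T t))` over `γ`, where `T` is the period, as a map on
`ℂ ∖ {0}` (the value at `0` is irrelevant) through the identification
`ℝ × S¹ ≅ ℂ ∖ {0}`, `(s, t) ↦ exp (2 π (s + i t))`. -/
noncomputable def SimpleClosedOrbit.trivialCylinder (γ : SimpleClosedOrbit X) (ζ : ℂ) : ℝ × V :=
  (γ.period * (Real.log ‖ζ‖ / (2 * Real.pi)), γ.orbit (γ.period * (ζ.arg / (2 * Real.pi))))

/-- `u` is smooth and `J`-holomorphic on the open subset `U` of the Riemann sphere, checked in all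
affine coordinates. -/
def IsJHolomorphicOn (X : CylindricalStructure E V) (u : OnePoint ℂ → ℝ × V)
    (U : Set (OnePoint ℂ)) : Prop :=
  ∀ g : GL (Fin 2) ℂ,
    ContMDiffOn 𝓘(ℝ, ℂ) (𝓘(ℝ, ℝ).prod 𝓘(ℝ, E)) ∞ (fun w : ℂ => u (g • (w : OnePoint ℂ)))
      {w : ℂ | g • (w : OnePoint ℂ) ∈ U} ∧
    ∀ w : ℂ, g • (w : OnePoint ℂ) ∈ U → ∀ v : ℂ,
      mfderiv 𝓘(ℝ, ℂ) (𝓘(ℝ, ℝ).prod 𝓘(ℝ, E)) (fun w : ℂ => u (g • (w : OnePoint ℂ))) w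
          (Complex.I * v : ℂ) =
        X.J (u (g • (w : OnePoint ℂ)))
          (mfderiv 𝓘(ℝ, ℂ) (𝓘(ℝ, ℝ).prod 𝓘(ℝ, E)) (fun w : ℂ => u (g • (w : OnePoint ℂ))) w v)

/-- A connected unnodal genus-zero orbit curve over `γ`, with domain the Riemann sphere, with
positive punctures of multiplicities `mp` and negative punctures of multiplicities `mm`:
punctures with asymptotic markers, and a `J`-holomorphic map `u` on the punctured sphere (values of
`u` at the punctures are irrelevant) with image in the trivial cylinder `ℝ × γ` and asymptotically
cylindrical over `γ^{mp k}` at the positive and over `γ^{mm k}` at the negative punctures, the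
asymptotic markers being mapped to `γ 0`. Near a positive (negative) puncture the cylindrical
coordinates are `(s, t) ↦ g • exp (∓ 2 π (s + i t))`, `s → ±∞`, so that the marker is the direction
`t = 0`. Convergence along `atTop ×ˢ 𝓝 t₀` for all `t₀` is convergence uniform in `t ∈ S¹`. -/
structure OrbitCurve (γ : SimpleClosedOrbit X) {np nm : ℕ} (mp : Fin np → ℕ) (mm : Fin nm → ℕ) where
  marker : Fin np ⊕ Fin nm → SphereDirection
  puncture_injective : Function.Injective (fun k => (marker k).point)
  u : OnePoint ℂ → ℝ × V
  holomorphic : IsJHolomorphicOn X u (range fun k => (marker k).point)ᶜ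
  mem_cylinder : ∀ w, w ∉ range (fun k => (marker k).point) → (u w).2 ∈ range γ.orbit
  asymptotic_pos : ∀ (k : Fin np) (g : GL (Fin 2) ℂ),
    (QuotientGroup.mk g : SphereDirection) = marker (Sum.inl k) → ∀ t₀ : ℝ,
      Tendsto (fun q : ℝ × ℝ =>
          (u (g • (Complex.exp (-(2 * Real.pi * (q.1 + q.2 * Complex.I))) : OnePoint ℂ))).1)
        (atTop ×ˢ 𝓝 t₀) atTop ∧
      Tendsto (fun q : ℝ × ℝ =>
          (u (g • (Complex.exp (-(2 * Real.pi * (q.1 + q.2 * Complex.I))) : OnePoint ℂ))).2)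
        (atTop ×ˢ 𝓝 t₀) (𝓝 (γ.orbit (mp k * γ.period * t₀)))
  asymptotic_neg : ∀ (k : Fin nm) (g : GL (Fin 2) ℂ),
    (QuotientGroup.mk g : SphereDirection) = marker (Sum.inr k) → ∀ t₀ : ℝ,
      Tendsto (fun q : ℝ × ℝ =>
          (u (g • (Complex.exp (2 * Real.pi * (q.1 + q.2 * Complex.I)) : OnePoint ℂ))).1)
        (atBot ×ˢ 𝓝 t₀) atBot ∧
      Tendsto (fun q : ℝ × ℝ =>
          (u (g • (Complex.exp (2 * Real.pi * (q.1 + q.2 * Complex.I)) : OnePoint ℂ))).2)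
        (atBot ×ˢ 𝓝 t₀) (𝓝 (γ.orbit (mm k * γ.period * t₀)))

namespace OrbitCurve

variable {γ : SimpleClosedOrbit X} {np nm : ℕ} {mp : Fin np → ℕ} {mm : Fin nm → ℕ}

/-- The punctured sphere underlying an orbit curve. -/
noncomputable def domain (C : OrbitCurve γ mp mm) : PuncturedSphere (Fin np ⊕ Fin nm) :=
  ⟨fun k => (C.marker k).point, C.puncture_injective⟩

/-- Orbit curves up to automorphisms of the Riemann sphere and up to translation in the
`ℝ`-direction of the target. -/
noncomputable instance setoid (γ : SimpleClosedOrbit X) {np nm : ℕ} (mp : Fin np → ℕ) (mm : Fin nm → ℕ) :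
    Setoid (OrbitCurve γ mp mm) where
  r C C' := ∃ (A : GL (Fin 2) ℂ) (c : ℝ), (∀ k, C'.marker k = A • C.marker k) ∧
    ∀ w, w ∉ range C.domain.1 → C'.u (A • w) = ((C.u w).1 + c, (C.u w).2)
  iseqv :=
    { refl := fun _ => ⟨1, 0, fun _ => (one_smul _ _).symm, fun w _ => by simp⟩
      symm := by
        rintro C C' ⟨A, c, hA, hc⟩
        refine ⟨A⁻¹, -c, fun k => by rw [hA, inv_smul_smul], fun w hw => ?_⟩
        have h := hc (A⁻¹ • w) (by
          rintro ⟨k, hk⟩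
          refine hw ⟨k, ?_⟩
          have hk' : (C.marker k).point = A⁻¹ • w := hk
          change (C'.marker k).point = w
          rw [hA, SphereDirection.point_smul, hk', smul_inv_smul])
        rw [smul_inv_smul] at h
        rw [h]
        simp
      trans := by
        rintro C C' C'' ⟨A, c, hA, hc⟩ ⟨B, d, hB, hd⟩
        refine ⟨B * A, c + d, fun k => by rw [hB, hA, mul_smul], fun w hw => ?_⟩
        rw [mul_smul, hd (A • w), hc w hw]
        · simp [add_assoc]
        · rintro ⟨k, hk⟩
          refine hw ⟨k, ?_⟩
          have hk' : (C'.marker k).point = A • w := hk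
          rw [hA, SphereDirection.point_smul] at hk'
          exact smul_left_cancel A hk' }

/-- The topology on orbit curves: convergence of the markers (in particular of the punctures) and
locally uniform convergence of the maps away from the punctures. -/
noncomputable instance topology (γ : SimpleClosedOrbit X) {np nm : ℕ} (mp : Fin np → ℕ) (mm : Fin nm → ℕ) :
    TopologicalSpace (OrbitCurve γ mp mm) :=
  TopologicalSpace.induced marker inferInstance ⊓
    TopologicalSpace.generateFrom {S | ∃ (K : Set (OnePoint ℂ)) (W : Set (ℝ × V)),
      IsCompact K ∧ IsOpen W ∧ S = {C | ∀ w ∈ K, w ∉ range C.domain.1 ∧ C.u w ∈ W}}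

end OrbitCurve

/-- The moduli space of orbit curves over `γ` with the given multiplicities modulo the
`ℝ`-translations of the target, with the quotient topology. -/
abbrev OrbitModuli (γ : SimpleClosedOrbit X) {np nm : ℕ} (mp : Fin np → ℕ) (mm : Fin nm → ℕ) :=
  Quotient (OrbitCurve.setoid γ mp mm)

end Curves

/-! ### Meromorphic functions on the sphere -/

open Classical in
/-- The multiplicity at `p` of the divisor with a pole of order `mp k` at each `z (inl k)` and a
zero of order `mm k` at each `z (inr k)`. -/
noncomputable def divisorAt {np nm : ℕ} (mp : Fin np → ℕ) (mm : Fin nm → ℕ)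
    (z : Fin np ⊕ Fin nm → OnePoint ℂ) (p : OnePoint ℂ) : ℤ :=
  (∑ k, if z (Sum.inl k) = p then -(mp k : ℤ) else 0) +
    ∑ k, if z (Sum.inr k) = p then (mm k : ℤ) else 0

/-- `h` is a meromorphic function on the Riemann sphere (with the conventional value `0` at its
poles) whose poles are exactly the `z (inl k)`, of order `mp k`, and whose zeros are exactly the
`z (inr k)`, of order `mm k`. -/
def IsMeromorphicWithDivisor {np nm : ℕ} (mp : Fin np → ℕ) (mm : Fin nm → ℕ)
    (z : Fin np ⊕ Fin nm → OnePoint ℂ) (h : OnePoint ℂ → ℂ) : Prop :=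
  ∀ g : GL (Fin 2) ℂ,
    MeromorphicNFAt (fun w : ℂ => h (g • (w : OnePoint ℂ))) 0 ∧
    meromorphicOrderAt (fun w : ℂ => h (g • (w : OnePoint ℂ))) 0 =
      (divisorAt mp mm z (g • ((0 : ℂ) : OnePoint ℂ)) : WithTop ℤ)

/-! The trivial cylinder `u₀` is a bijection from `ℂ*` onto `ℝ × γ(ℝ)`, so a map into the cylinder
is `u₀ ∘ h` for exactly one nowhere vanishing `h` off the punctures. Along the universal covering `s
+ it ↦ (s, γ t)` the structure `J` is multiplication by `i`, and the covering is an immersion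
because `R` has no zero on `γ`. Hence `u` is `J`-holomorphic if and only if `h` is holomorphic. The
asymptotic conditions force `h` to have a pole or zero of order `m k` at each puncture, and a
positive real leading coefficient in every affine coordinate adapted to the marker (`IsPositiveAt`);
conversely, these properties give the asymptotics. Turning a marker by `ζ` multiplies that
coefficient by `ζ ^ e`, where `e = ∓ m k`, so the admissible markers form one orbit of the `m k`-th
roots of unity. This is the first part.

For given punctures `h` exists and is unique up to a factor in `ℂ*`: the quotient of two such
functions is constant by Liouville, and a product of linear forms `∏ [x, v k] ^ e k`, which has
degree zero since `∑ e k = 0`, is a solution. Translations of the target absorb the positive real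
factors and leave a circle over each configuration.

To trivialize this circle bundle over `M_{0,n}`, each label `k` is given two further labels
(`LabelFrame`); this is where `n ≥ 3` enters. The coordinate with `z k`, `z (snd k)`, `z (fst k)` at
`0`, `1`, `∞` is equivariant under automorphisms, so the `angle` of the marker at `k` in it is an
invariant. The leading coefficient of the bracket product in that coordinate is `lead`; under
automorphisms and changes of homogeneous coordinates it acquires a factor independent of `k`. Thus
the phase `ψ k` of `lead k / lead o`, for a fixed label `o`, is a continuous function on `M_{0,n}`,
and the phase `θ` of the leading coefficient of `h` at `o` is a well-defined circle coordinate.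

Positivity at all markers now reads `angle k ^ e k = (θ * ψ k)⁻¹`. So the moduli space is
homeomorphic to the space of tuples of roots of given functions on `S¹ × M_{0,n}`
(`OrbitCurve.moduliHomeomorph`). Such a space is a covering by local continuity of roots
(`isCoveringMap_rootCover`), and choosing a root at every point, without continuity, identifies it
as a set with the product by `∏ ℤ_{m k}` (`exists_rootCover_equiv`). -/

/-! ### Phases of complex numbers -/

/-- The unit complex number `z / |z|` (and `1` for `z = 0`). -/
noncomputable def phase (z : ℂ) : Circle := Circle.exp z.arg

theorem coe_phase {z : ℂ} (hz : z ≠ 0) : (phase z : ℂ) = z / ‖z‖ := by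
  have h := Complex.norm_mul_exp_arg_mul_I z
  have h0 : (‖z‖ : ℂ) ≠ 0 := by exact_mod_cast norm_ne_zero_iff.mpr hz
  rw [phase, Circle.coe_exp, eq_div_iff h0, mul_comm]
  exact h

theorem norm_mul_phase (z : ℂ) : (‖z‖ : ℂ) * phase z = z := by
  rw [phase, Circle.coe_exp]
  exact Complex.norm_mul_exp_arg_mul_I z

theorem phase_mul {z w : ℂ} (hz : z ≠ 0) (hw : w ≠ 0) : phase (z * w) = phase z * phase w := by
  apply Subtype.ext
  rw [Circle.coe_mul, coe_phase hz, coe_phase hw, coe_phase (mul_ne_zero hz hw), norm_mul]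
  push_cast
  rw [mul_div_mul_comm]

@[simp]
theorem phase_one : phase 1 = 1 := by simp [phase]

theorem phase_zpow {z : ℂ} (hz : z ≠ 0) (n : ℤ) : phase (z ^ n) = phase z ^ n := by
  apply Subtype.ext
  rw [Circle.coe_zpow, coe_phase hz, coe_phase (zpow_ne_zero n hz), norm_zpow, div_zpow]
  push_cast
  rfl

theorem phase_ofReal {r : ℝ} (hr : 0 < r) : phase r = 1 := by
  simp [phase, Complex.arg_ofReal_of_nonneg hr.le]

theorem phase_coe (ζ : Circle) : phase ζ = ζ := Circle.exp_arg ζ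

theorem phase_eq_one_iff {z : ℂ} (hz : z ≠ 0) : phase z = 1 ↔ ∃ r : ℝ, 0 < r ∧ z = r := by
  constructor
  · intro h
    refine ⟨‖z‖, norm_pos_iff.mpr hz, ?_⟩
    have := norm_mul_phase z
    rw [h] at this
    simpa using this.symm
  · rintro ⟨r, hr, rfl⟩
    exact phase_ofReal hr

theorem continuousAt_phase {z : ℂ} (hz : z ≠ 0) : ContinuousAt phase z := by
  have hi : Topology.IsInducing (fun ζ : Circle => (ζ : ℂ)) := ⟨rfl⟩
  rw [hi.continuousAt_iff]
  have h : ContinuousAt (fun z : ℂ => z / (‖z‖ : ℂ)) z :=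
    continuousAt_id.div (Complex.continuous_ofReal.comp continuous_norm).continuousAt
      (by simpa using hz)
  refine h.congr ?_
  filter_upwards [isOpen_ne.mem_nhds hz] with w hw
  exact (coe_phase hw).symm

/-! ### Homogeneous coordinates on the Riemann sphere -/

/-- The point of the Riemann sphere with homogeneous coordinates `v`. -/
noncomputable def projPoint (v : Fin 2 → ℂ) : OnePoint ℂ :=
  open Classical in if v 1 = 0 then OnePoint.infty else ((v 0 / v 1 : ℂ) : OnePoint ℂ)

theorem projPoint_of_ne_zero {v : Fin 2 → ℂ} (hv : v 1 ≠ 0) :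
    projPoint v = ((v 0 / v 1 : ℂ) : OnePoint ℂ) := if_neg hv

/-- The determinant of two vectors of `ℂ²`. -/
def bracket (v w : Fin 2 → ℂ) : ℂ := v 0 * w 1 - v 1 * w 0

/-- The second column of a matrix, homogeneous coordinates of the image of `0`. -/
def secondCol (g : GL (Fin 2) ℂ) : Fin 2 → ℂ := fun i => g i 1

/-- Homogeneous coordinates of the image of `w`. -/
def colAt (g : GL (Fin 2) ℂ) (w : ℂ) : Fin 2 → ℂ := fun i => g i 0 * w + g i 1

@[simp]
theorem colAt_zero (g : GL (Fin 2) ℂ) : colAt g 0 = secondCol g := by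
  ext i; simp [colAt, secondCol]

theorem bracket_self (v : Fin 2 → ℂ) : bracket v v = 0 := by simp [bracket]; ring

theorem bracket_smul_left (c : ℂ) (v w : Fin 2 → ℂ) : bracket (c • v) w = c * bracket v w := by
  simp [bracket]; ring

theorem bracket_smul_right (c : ℂ) (v w : Fin 2 → ℂ) : bracket v (c • w) = c * bracket v w := by
  simp [bracket]; ring

theorem bracket_mulVec (A : Matrix (Fin 2) (Fin 2) ℂ) (v w : Fin 2 → ℂ) :
    bracket (A.mulVec v) (A.mulVec w) = A.det * bracket v w := by
  simp [bracket, Matrix.mulVec, dotProduct, Fin.sum_univ_two, Matrix.det_fin_two]; ring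

theorem colAt_ne_zero (g : GL (Fin 2) ℂ) (w : ℂ) : colAt g w ≠ 0 := by
  intro h
  apply g.det_ne_zero
  have h0 : g 0 0 * w + g 0 1 = 0 := congrFun h 0
  have h1 : g 1 0 * w + g 1 1 = 0 := congrFun h 1
  rw [Matrix.det_fin_two]
  linear_combination g 0 0 * h1 - g 1 0 * h0

theorem secondCol_ne_zero (g : GL (Fin 2) ℂ) : secondCol g ≠ 0 := by
  rw [← colAt_zero]; exact colAt_ne_zero g 0

theorem smul_coe_eq (g : GL (Fin 2) ℂ) (w : ℂ) :
    g • (w : OnePoint ℂ) = projPoint (colAt g w) := by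
  rw [OnePoint.smul_some_eq_ite]
  simp only [projPoint, colAt]
  congr

theorem smul_zero_eq (g : GL (Fin 2) ℂ) :
    g • ((0 : ℂ) : OnePoint ℂ) = projPoint (secondCol g) := by
  rw [smul_coe_eq, colAt_zero]

theorem secondCol_mul (A g : GL (Fin 2) ℂ) :
    secondCol (A * g) = A.1.mulVec (secondCol g) := by
  ext i; simp [secondCol, Matrix.mul_apply, Matrix.mulVec, dotProduct]

theorem ne_zero_cases {v : Fin 2 → ℂ} (hv : v ≠ 0) (h1 : v 1 = 0) : v 0 ≠ 0 := by
  intro h0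
  apply hv
  ext i; fin_cases i <;> simp [h0, h1]

theorem projPoint_smul {c : ℂ} (hc : c ≠ 0) (v : Fin 2 → ℂ) :
    projPoint (c • v) = projPoint v := by
  simp [projPoint, hc, mul_div_mul_left]

theorem eq_smul_of_bracket_eq_zero {v w : Fin 2 → ℂ} (hv : v ≠ 0) (hw : w ≠ 0)
    (h : bracket v w = 0) : ∃ c : ℂ, c ≠ 0 ∧ w = c • v := by
  simp only [bracket] at h
  by_cases h1 : v 1 = 0
  · have h0 := ne_zero_cases hv h1
    have hw1 : w 1 = 0 := by
      rw [h1] at h; simpa [h0] using h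
    refine ⟨w 0 / v 0, div_ne_zero (ne_zero_cases hw hw1) h0, ?_⟩
    ext i; fin_cases i <;> simp [h1, hw1, h0]
  · have e : w = (w 1 / v 1) • v := by
      ext i; fin_cases i
      · simp only [Pi.smul_apply, smul_eq_mul, Fin.zero_eta]
        field_simp
        linear_combination -h
      · simp [h1]
    refine ⟨w 1 / v 1, ?_, e⟩
    intro h0
    rw [h0] at e
    exact hw (by simpa using e)

theorem projPoint_eq_iff {v w : Fin 2 → ℂ} (hv : v ≠ 0) (hw : w ≠ 0) :
    projPoint v = projPoint w ↔ bracket v w = 0 := by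
  constructor
  · intro h
    simp only [projPoint, bracket] at h ⊢
    by_cases h1 : v 1 = 0 <;> by_cases h2 : w 1 = 0
    · simp [h1, h2]
    · simp [h1, h2] at h
    · simp [h1, h2] at h
    · rw [if_neg h1, if_neg h2, OnePoint.coe_eq_coe, div_eq_div_iff h1 h2] at h
      linear_combination h
  · intro h
    obtain ⟨c, hc, rfl⟩ := eq_smul_of_bracket_eq_zero hv hw h
    exact (projPoint_smul hc v).symm

/-- Homogeneous coordinates of a point. -/
noncomputable def homCoord (p : OnePoint ℂ) : Fin 2 → ℂ :=
  OnePoint.elim p ![1, 0] (fun w => ![w, 1])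

theorem homCoord_ne_zero (p : OnePoint ℂ) : homCoord p ≠ 0 := by
  induction p using OnePoint.rec with
  | infty => intro h; simpa [homCoord] using congrFun h 0
  | coe w => intro h; simpa [homCoord] using congrFun h 1

@[simp]
theorem projPoint_homCoord (p : OnePoint ℂ) : projPoint (homCoord p) = p := by
  induction p using OnePoint.rec with
  | infty => simp [homCoord, projPoint]
  | coe w => simp [homCoord, projPoint]

theorem exists_frame {v : Fin 2 → ℂ} (hv : v ≠ 0) : ∃ g : GL (Fin 2) ℂ, secondCol g = v := by
  by_cases h1 : v 1 = 0
  · refine ⟨Matrix.GeneralLinearGroup.mkOfDetNeZero !![0, v 0; 1, v 1]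
      (by simpa using ne_zero_cases hv h1), ?_⟩
    ext i; fin_cases i <;> simp [secondCol, Matrix.GeneralLinearGroup.mkOfDetNeZero]
  · refine ⟨Matrix.GeneralLinearGroup.mkOfDetNeZero !![1, v 0; 0, v 1] (by simpa using h1), ?_⟩
    ext i; fin_cases i <;> simp [secondCol, Matrix.GeneralLinearGroup.mkOfDetNeZero]

theorem exists_smul_zero_eq (p : OnePoint ℂ) :
    ∃ g : GL (Fin 2) ℂ, g • ((0 : ℂ) : OnePoint ℂ) = p := by
  obtain ⟨g, hg⟩ := exists_frame (homCoord_ne_zero p)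
  exact ⟨g, by rw [smul_zero_eq, hg, projPoint_homCoord]⟩

theorem mulVec_ne_zero (A : GL (Fin 2) ℂ) {v : Fin 2 → ℂ} (hv : v ≠ 0) : A.1.mulVec v ≠ 0 := by
  obtain ⟨g, rfl⟩ := exists_frame hv
  rw [← secondCol_mul]
  exact secondCol_ne_zero _

theorem smul_projPoint (A : GL (Fin 2) ℂ) {v : Fin 2 → ℂ} (hv : v ≠ 0) :
    A • projPoint v = projPoint (A.1.mulVec v) := by
  obtain ⟨g, rfl⟩ := exists_frame hv
  rw [← secondCol_mul, ← smul_zero_eq, ← smul_zero_eq, mul_smul]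

theorem det_eq_bracket (g : GL (Fin 2) ℂ) :
    g.1.det = bracket (fun i => g i 0) (secondCol g) := by
  simp [bracket, secondCol, Matrix.det_fin_two]; ring

theorem bracket_colAt (g : GL (Fin 2) ℂ) (w : ℂ) (v : Fin 2 → ℂ) :
    bracket (colAt g w) v = w * bracket (fun i => g i 0) v + bracket (secondCol g) v := by
  simp [bracket, colAt, secondCol]; ring

theorem bracket_colAt_secondCol (g : GL (Fin 2) ℂ) (w : ℂ) :
    bracket (colAt g w) (secondCol g) = w * g.1.det := by
  rw [bracket_colAt, bracket_self, det_eq_bracket, add_zero]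

theorem tendsto_inv_infty :
    Tendsto (fun t : ℂ => ((t⁻¹ : ℂ) : OnePoint ℂ)) (𝓝[≠] 0) (𝓝 OnePoint.infty) := by
  rw [OnePoint.nhds_infty_eq, Filter.coclosedCompact_eq_cocompact]
  refine Tendsto.mono_right (tendsto_map.comp ?_) le_sup_left
  rw [← Metric.cobounded_eq_cocompact]
  exact Filter.tendsto_inv₀_nhdsNE_zero

/-- At the point at infinity the coordinate `v 1 / v 0` is used, followed by inversion with `0` sent
to infinity. -/
theorem continuousAt_projPoint {v : Fin 2 → ℂ} (hv : v ≠ 0) : ContinuousAt projPoint v := by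
  by_cases h1 : v 1 = 0
  · have h0 := ne_zero_cases hv h1
    have hc : ContinuousAt (fun t : ℂ => if t = 0 then OnePoint.infty
        else ((t⁻¹ : ℂ) : OnePoint ℂ)) 0 := by
      rw [continuousAt_iff_punctured_nhds]
      simp only [if_true]
      refine tendsto_inv_infty.congr' ?_
      filter_upwards [self_mem_nhdsWithin] with t ht
      exact (if_neg ht).symm
    have hd : ContinuousAt (fun w : Fin 2 → ℂ => w 1 / w 0) v :=
      (continuous_apply 1).continuousAt.div (continuous_apply 0).continuousAt h0
    have := ContinuousAt.comp (f := fun w : Fin 2 → ℂ => w 1 / w 0) (x := v)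
      (by simpa [h1] using hc) hd
    refine this.congr ?_
    filter_upwards [(continuous_apply (0 : Fin 2)).continuousAt.eventually_ne h0] with w hw
    by_cases hw1 : w 1 = 0 <;> simp [projPoint, hw, hw1]
  · have hd : ContinuousAt (fun w : Fin 2 → ℂ => ((w 0 / w 1 : ℂ) : OnePoint ℂ)) v :=
      OnePoint.continuous_coe.continuousAt.comp
        ((continuous_apply 0).continuousAt.div (continuous_apply 1).continuousAt h1)
    refine hd.congr ?_
    filter_upwards [(continuous_apply (1 : Fin 2)).continuousAt.eventually_ne h1] with w hw
    simp [projPoint, hw]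

/-- Homogeneous coordinates can be chosen continuously near a point. -/
theorem exists_homCoord_continuousAt (p : OnePoint ℂ) : ∃ l : OnePoint ℂ → Fin 2 → ℂ,
    (∀ q, l q ≠ 0) ∧ (∀ q, projPoint (l q) = q) ∧ ContinuousAt l p := by
  induction p using OnePoint.rec with
  | infty =>
    -- The affine origin has no coordinates of the form `(1, w⁻¹)`; any choice there will do, since
    -- continuity is only claimed at infinity.
    refine ⟨fun q => OnePoint.elim q ![1, 0] (fun w => if w = 0 then ![0, 1] else ![1, w⁻¹]),
      fun q => ?_, fun q => ?_, ?_⟩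
    · induction q using OnePoint.rec with
      | infty => intro h; simpa using congrFun h 0
      | coe w =>
        intro h
        by_cases hw : w = 0
        · simpa [hw] using congrFun h 1
        · simpa [hw] using congrFun h 0
    · induction q using OnePoint.rec with
      | infty => simp [projPoint]
      | coe w => by_cases hw : w = 0 <;> simp [projPoint, hw]
    · rw [OnePoint.continuousAt_infty', Filter.coclosedCompact_eq_cocompact,
        ← Metric.cobounded_eq_cocompact]
      have h : Tendsto (fun w : ℂ => ![1, w⁻¹]) (Bornology.cobounded ℂ) (𝓝 ![1, 0]) := by
        rw [tendsto_pi_nhds]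
        intro i
        fin_cases i
        · exact tendsto_const_nhds
        · exact tendsto_inv₀_cobounded
      refine h.congr' ?_
      filter_upwards [(Bornology.isBounded_def.mp (Bornology.isBounded_singleton (x := (0 : ℂ))))] with w hw
      have : w ≠ 0 := hw
      simp [this]
  | coe w =>
    refine ⟨homCoord, homCoord_ne_zero, projPoint_homCoord, ?_⟩
    rw [OnePoint.continuousAt_coe]
    apply Continuous.continuousAt
    change Continuous fun w : ℂ => ![w, 1]
    fun_prop

/-! ### Leading coefficients -/

/-- `f w ~ c w ^ e` as `w → 0`. -/
def HasLeadingCoeff (f : ℂ → ℂ) (e : ℤ) (c : ℂ) : Prop :=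
  Tendsto (fun w : ℂ => f w * w ^ (-e)) (𝓝[≠] 0) (𝓝 c)

theorem HasLeadingCoeff.unique {f : ℂ → ℂ} {e : ℤ} {c c' : ℂ} (h : HasLeadingCoeff f e c)
    (h' : HasLeadingCoeff f e c') : c = c' :=
  tendsto_nhds_unique h h'

theorem HasLeadingCoeff.const_mul {f : ℂ → ℂ} {e : ℤ} {c : ℂ} (h : HasLeadingCoeff f e c)
    (a : ℂ) : HasLeadingCoeff (fun w => a * f w) e (a * c) := by
  simpa only [HasLeadingCoeff, mul_assoc] using Tendsto.const_mul a h

theorem HasLeadingCoeff.congr' {f f' : ℂ → ℂ} {e : ℤ} {c : ℂ} (h : HasLeadingCoeff f e c)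
    (hf : ∀ᶠ w in 𝓝[≠] 0, f w = f' w) : HasLeadingCoeff f' e c :=
  Tendsto.congr' (hf.mono fun w hw => by simp only [hw]) h

theorem exists_hasLeadingCoeff {f : ℂ → ℂ} {e : ℤ} (hf : MeromorphicAt f 0)
    (he : meromorphicOrderAt f 0 = e) : ∃ c ≠ 0, HasLeadingCoeff f e c := by
  obtain ⟨G, hG, hG0, h⟩ := (meromorphicOrderAt_eq_int_iff hf).mp he
  refine ⟨G 0, hG0, (hG.continuousAt.tendsto.mono_left nhdsWithin_le_nhds).congr' ?_⟩
  filter_upwards [h, self_mem_nhdsWithin] with w hw (hw0 : w ≠ 0)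
  rw [hw, sub_zero, smul_eq_mul, zpow_neg]
  field_simp

/-- Riemann's removable singularity theorem for `f w * w ^ (-e)`, extended by its limit `c`. -/
theorem HasLeadingCoeff.exists_analytic {f : ℂ → ℂ} {e : ℤ} {c : ℂ}
    (hf : ∀ᶠ w in 𝓝[≠] 0, DifferentiableAt ℂ f w) (h : HasLeadingCoeff f e c) :
    ∃ G : ℂ → ℂ, AnalyticAt ℂ G 0 ∧ G 0 = c ∧ ∀ w ≠ 0, f w = w ^ e * G w := by
  refine ⟨Function.update (fun w => f w * w ^ (-e)) 0 c, ?_, by simp, ?_⟩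
  · apply Complex.analyticAt_of_differentiable_on_punctured_nhds_of_continuousAt
    · filter_upwards [hf, self_mem_nhdsWithin] with w hw (hw0 : w ≠ 0)
      have hd : DifferentiableAt ℂ (fun w => f w * w ^ (-e)) w :=
        hw.mul (differentiableAt_zpow.mpr (Or.inl hw0))
      refine hd.congr_of_eventuallyEq ?_
      filter_upwards [isOpen_ne.mem_nhds hw0] with y hy
      exact Function.update_of_ne hy _ _
    · exact continuousAt_update_same.mpr h
  · intro w hw
    rw [Function.update_of_ne hw, zpow_neg]
    field_simp

/-- With `e ≠ 0` one has `0 ^ e = 0` also for negative `e`, so the value `0` at the centre is the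
one that the normal form requires, at poles as well as at zeros. -/
theorem HasLeadingCoeff.meromorphicNFAt {f : ℂ → ℂ} {e : ℤ} {c : ℂ}
    (hf : ∀ᶠ w in 𝓝[≠] 0, DifferentiableAt ℂ f w) (h : HasLeadingCoeff f e c) (hc : c ≠ 0)
    (he : e ≠ 0) (h0 : f 0 = 0) :
    MeromorphicNFAt f 0 ∧ meromorphicOrderAt f 0 = e := by
  obtain ⟨G, hG, rfl, hfG⟩ := h.exists_analytic hf
  have hNF : MeromorphicNFAt f 0 := by
    refine Or.inr ⟨e, G, hG, hc, Eventually.of_forall fun w => ?_⟩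
    rcases eq_or_ne w 0 with rfl | hw
    · simp [h0, zero_zpow e he]
    · simp [hfG w hw]
  refine ⟨hNF, (meromorphicOrderAt_eq_int_iff hNF.meromorphicAt).mpr ⟨G, hG, hc, ?_⟩⟩
  filter_upwards [self_mem_nhdsWithin] with w hw
  simp [hfG w hw]

/-- The coordinate change `d` fixes `0` with derivative `d 0 0 / d 1 1`, and a leading coefficient
of order `e` scales by the `e`-th power of the derivative. All statements about markers rest on this
rule. -/
theorem HasLeadingCoeff.comp_mul {h : OnePoint ℂ → ℂ} {g d : GL (Fin 2) ℂ} {e : ℤ} {c : ℂ}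
    (hd : d 0 1 = 0) (H : HasLeadingCoeff (fun w => h (g • (w : OnePoint ℂ))) e c) :
    HasLeadingCoeff (fun w => h ((g * d) • (w : OnePoint ℂ))) e (c * (d 0 0 / d 1 1) ^ e) := by
  have hdet := d.det_ne_zero
  rw [Matrix.det_fin_two, hd, zero_mul, sub_zero] at hdet
  have h0 : d 0 0 ≠ 0 := left_ne_zero_of_mul hdet
  have h1 : d 1 1 ≠ 0 := right_ne_zero_of_mul hdet
  have hden : ∀ᶠ w : ℂ in 𝓝 0, d 1 0 * w + d 1 1 ≠ 0 := by
    have : ContinuousAt (fun w : ℂ => d 1 0 * w + d 1 1) 0 := by fun_prop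
    exact this.eventually_ne (by simpa using h1)
  have hq : Tendsto (fun w : ℂ => d 0 0 / (d 1 0 * w + d 1 1)) (𝓝[≠] 0) (𝓝 (d 0 0 / d 1 1)) := by
    have : ContinuousAt (fun w : ℂ => d 0 0 / (d 1 0 * w + d 1 1)) 0 :=
      ContinuousAt.div (by fun_prop) (by fun_prop) (by simpa using h1)
    have := this.tendsto
    simp only [mul_zero, zero_add] at this
    exact this.mono_left nhdsWithin_le_nhds
  have hm : Tendsto (fun w : ℂ => d 0 0 / (d 1 0 * w + d 1 1) * w) (𝓝[≠] 0) (𝓝[≠] 0) := by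
    rw [tendsto_nhdsWithin_iff]
    constructor
    · simpa using hq.mul (tendsto_id.mono_left nhdsWithin_le_nhds : Tendsto id (𝓝[≠] (0 : ℂ)) _)
    · filter_upwards [self_mem_nhdsWithin, hden.filter_mono nhdsWithin_le_nhds] with w hw hw'
      exact mul_ne_zero (div_ne_zero h0 hw') hw
  have hz := hq.zpow₀ e (Or.inl (div_ne_zero h0 h1))
  refine ((Tendsto.comp H hm).mul hz).congr' ?_
  filter_upwards [self_mem_nhdsWithin, hden.filter_mono nhdsWithin_le_nhds] with w (hw : w ≠ 0) hw'
  have e1 : (g * d) • (w : OnePoint ℂ)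
      = g • ((d 0 0 / (d 1 0 * w + d 1 1) * w : ℂ) : OnePoint ℂ) := by
    rw [mul_smul, smul_coe_eq d, projPoint_of_ne_zero (v := colAt d w) hw']
    simp only [colAt]
    rw [hd, add_zero, mul_div_right_comm]
  have hr : d 0 0 / (d 1 0 * w + d 1 1) ≠ 0 := div_ne_zero h0 hw'
  simp only [Function.comp]
  rw [e1, mul_zpow, zpow_neg, zpow_neg]
  have := zpow_ne_zero e hr
  have := zpow_ne_zero e hw
  field_simp

/-! ### Meromorphic functions with prescribed divisor -/

/-- The translation `w ↦ w + a`. -/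
noncomputable def translationMatrix (a : ℂ) : GL (Fin 2) ℂ :=
  Matrix.GeneralLinearGroup.mkOfDetNeZero !![1, a; 0, 1] (by simp)

theorem mul_translation_smul (g : GL (Fin 2) ℂ) (a w : ℂ) :
    (g * translationMatrix a) • (w : OnePoint ℂ) = g • ((w + a : ℂ) : OnePoint ℂ) := by
  rw [mul_smul, smul_coe_eq (translationMatrix a)]
  simp [projPoint, colAt, translationMatrix, Matrix.GeneralLinearGroup.mkOfDetNeZero]

/-- The order at each puncture. -/
def punctureOrder {np nm : ℕ} (mp : Fin np → ℕ) (mm : Fin nm → ℕ) : Fin np ⊕ Fin nm → ℤ :=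
  Sum.elim (fun k => -(mp k : ℤ)) (fun k => (mm k : ℤ))

section Divisor

variable {np nm : ℕ} {mp : Fin np → ℕ} {mm : Fin nm → ℕ} {z : Fin np ⊕ Fin nm → OnePoint ℂ}
  {h : OnePoint ℂ → ℂ}

theorem punctureOrder_ne_zero (hmp : ∀ k, 0 < mp k) (hmm : ∀ k, 0 < mm k) (k : Fin np ⊕ Fin nm) :
    punctureOrder mp mm k ≠ 0 := by
  rcases k with k | k
  · have := hmp k; simp [punctureOrder]; omega
  · have := hmm k; simp [punctureOrder]; omega

theorem sum_punctureOrder (hsum : ∑ k, mp k = ∑ k, mm k) : ∑ k, punctureOrder mp mm k = 0 := by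
  simp only [punctureOrder, Fintype.sum_sum_type, Sum.elim_inl, Sum.elim_inr,
    Finset.sum_neg_distrib]
  have : (∑ k, (mp k : ℤ)) = ∑ k, (mm k : ℤ) := by exact_mod_cast hsum
  rw [this]; ring

theorem divisorAt_eq_sum (p : OnePoint ℂ) :
    divisorAt mp mm z p = open Classical in ∑ k, if z k = p then punctureOrder mp mm k else 0 := by
  classical
  simp [divisorAt, punctureOrder, Fintype.sum_sum_type]

theorem divisorAt_puncture (hz : Function.Injective z) (k : Fin np ⊕ Fin nm) :
    divisorAt mp mm z (z k) = punctureOrder mp mm k := by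
  classical
  rw [divisorAt_eq_sum, Finset.sum_eq_single k]
  · simp
  · intro j _ hj; simp [hz.ne hj]
  · simp

theorem divisorAt_of_notMem {p : OnePoint ℂ} (hp : p ∉ range z) : divisorAt mp mm z p = 0 := by
  classical
  rw [divisorAt_eq_sum]
  refine Finset.sum_eq_zero fun k _ => if_neg fun hk => hp ⟨k, hk⟩

/-- The definition speaks of the origin of each coordinate only; other points are moved there by a
translation. -/
theorem IsMeromorphicWithDivisor.analyticAt (H : IsMeromorphicWithDivisor mp mm z h)
    (g : GL (Fin 2) ℂ) (w : ℂ) (hw : g • (w : OnePoint ℂ) ∉ range z) :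
    AnalyticAt ℂ (fun w : ℂ => h (g • (w : OnePoint ℂ))) w := by
  obtain ⟨h1, h2⟩ := H (g * translationMatrix w)
  rw [mul_translation_smul, zero_add, divisorAt_of_notMem hw] at h2
  have h3 := h1.meromorphicOrderAt_nonneg_iff_analyticAt.mp h2.ge
  have h4 : AnalyticAt ℂ (fun y : ℂ => y - w) w := by fun_prop
  have h5 := AnalyticAt.fun_comp (f := fun y : ℂ => y - w) (x := w) (by simpa using h3) h4
  simpa [mul_translation_smul] using h5

theorem IsMeromorphicWithDivisor.ne_zero (H : IsMeromorphicWithDivisor mp mm z h)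
    {p : OnePoint ℂ} (hp : p ∉ range z) : h p ≠ 0 := by
  obtain ⟨g, rfl⟩ := exists_smul_zero_eq p
  obtain ⟨h1, h2⟩ := H g
  rw [divisorAt_of_notMem hp] at h2
  exact h1.meromorphicOrderAt_eq_zero_iff.mp h2

theorem IsMeromorphicWithDivisor.eq_zero (H : IsMeromorphicWithDivisor mp mm z h)
    (hmp : ∀ k, 0 < mp k) (hmm : ∀ k, 0 < mm k) (hz : Function.Injective z)
    (k : Fin np ⊕ Fin nm) : h (z k) = 0 := by
  obtain ⟨g, hg⟩ := exists_smul_zero_eq (z k)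
  obtain ⟨h1, h2⟩ := H g
  rw [hg, divisorAt_puncture hz] at h2
  by_contra h3
  have h4 := h1.meromorphicOrderAt_eq_zero_iff.mpr (by rwa [hg])
  rw [h2] at h4
  exact punctureOrder_ne_zero hmp hmm k (by exact_mod_cast h4)

theorem IsMeromorphicWithDivisor.exists_leadingCoeff (H : IsMeromorphicWithDivisor mp mm z h)
    (hz : Function.Injective z) {k : Fin np ⊕ Fin nm} {g : GL (Fin 2) ℂ}
    (hg : g • ((0 : ℂ) : OnePoint ℂ) = z k) :
    ∃ c ≠ 0, HasLeadingCoeff (fun w => h (g • (w : OnePoint ℂ))) (punctureOrder mp mm k) c := by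
  obtain ⟨h1, h2⟩ := H g
  rw [hg, divisorAt_puncture hz] at h2
  exact exists_hasLeadingCoeff h1.meromorphicAt h2

theorem smul_coe_injective (g : GL (Fin 2) ℂ) :
    Function.Injective fun w : ℂ => g • (w : OnePoint ℂ) :=
  (MulAction.injective g).comp (OnePoint.coe_injective)

theorem eventually_notMem_range {ι : Type*} [Finite ι] (z : ι → OnePoint ℂ)
    (g : GL (Fin 2) ℂ) (w₀ : ℂ) : ∀ᶠ w : ℂ in 𝓝[≠] w₀, g • (w : OnePoint ℂ) ∉ range z := by
  have hfin : ((fun w : ℂ => g • (w : OnePoint ℂ)) ⁻¹' range z).Finite :=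
    (finite_range z).preimage (smul_coe_injective g).injOn
  have h1 : ((fun w : ℂ => g • (w : OnePoint ℂ)) ⁻¹' range z \ {w₀})ᶜ ∈ 𝓝 w₀ :=
    (hfin.subset sdiff_subset).isClosed.isOpen_compl.mem_nhds (by simp)
  filter_upwards [mem_nhdsWithin_of_mem_nhds h1, self_mem_nhdsWithin] with w hw hw' hw''
  exact hw ⟨hw'', hw'⟩

theorem exists_eq_mul_of_smul_zero_eq {g g' : GL (Fin 2) ℂ}
    (hg : g • ((0 : ℂ) : OnePoint ℂ) = g' • ((0 : ℂ) : OnePoint ℂ)) :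
    ∃ d : GL (Fin 2) ℂ, d 0 1 = 0 ∧ g' = g * d := by
  refine ⟨g⁻¹ * g', ?_, by group⟩
  have h1 : (g⁻¹ * g') • ((0 : ℂ) : OnePoint ℂ) = ((0 : ℂ) : OnePoint ℂ) := by
    rw [mul_smul, ← hg, inv_smul_smul]
  rw [smul_zero_eq, projPoint] at h1
  split_ifs at h1 with h2
  · exact absurd h1 (OnePoint.infty_ne_coe _)
  · rw [OnePoint.coe_eq_coe, div_eq_zero_iff] at h1
    exact h1.resolve_right h2

theorem diag_ne_zero {d : GL (Fin 2) ℂ} (hd : d 0 1 = 0) : d 0 0 ≠ 0 ∧ d 1 1 ≠ 0 := by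
  have hdet := d.det_ne_zero
  rw [Matrix.det_fin_two, hd, zero_mul, sub_zero] at hdet
  exact ⟨left_ne_zero_of_mul hdet, right_ne_zero_of_mul hdet⟩

/-- A function with the right leading behaviour at the punctures is meromorphic with the given
divisor. -/
theorem isMeromorphicWithDivisor_of_leadingCoeff (hmp : ∀ k, 0 < mp k) (hmm : ∀ k, 0 < mm k)
    (hz : Function.Injective z)
    (hdiff : ∀ (g : GL (Fin 2) ℂ) (w : ℂ), g • (w : OnePoint ℂ) ∉ range z →
      DifferentiableAt ℂ (fun w : ℂ => h (g • (w : OnePoint ℂ))) w)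
    (hne : ∀ p, p ∉ range z → h p ≠ 0) (h0 : ∀ k, h (z k) = 0)
    (hlc : ∀ k, ∃ g : GL (Fin 2) ℂ, g • ((0 : ℂ) : OnePoint ℂ) = z k ∧ ∃ c ≠ 0,
      HasLeadingCoeff (fun w => h (g • (w : OnePoint ℂ))) (punctureOrder mp mm k) c) :
    IsMeromorphicWithDivisor mp mm z h := by
  intro g
  have hd : ∀ᶠ w : ℂ in 𝓝[≠] 0, DifferentiableAt ℂ (fun w : ℂ => h (g • (w : OnePoint ℂ))) w :=
    (eventually_notMem_range z g 0).mono fun w hw => hdiff g w hw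
  by_cases hp : g • ((0 : ℂ) : OnePoint ℂ) ∈ range z
  · obtain ⟨k, hk⟩ := hp
    obtain ⟨g', hg', c, hc, hlc⟩ := hlc k
    -- The leading behaviour is known in one coordinate centred at the puncture; any other differs
    -- from it by a coordinate change fixing `0`.
    obtain ⟨d, hd01, rfl⟩ := exists_eq_mul_of_smul_zero_eq (hg'.trans hk)
    obtain ⟨h00, h11⟩ := diag_ne_zero hd01
    rw [← hk, divisorAt_puncture hz]
    exact (hlc.comp_mul hd01).meromorphicNFAt hd
      (mul_ne_zero hc (zpow_ne_zero _ (div_ne_zero h00 h11)))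
      (punctureOrder_ne_zero hmp hmm k) (by rw [← hk]; exact h0 k)
  · have hd' : ∀ᶠ w : ℂ in 𝓝 0, DifferentiableAt ℂ (fun w : ℂ => h (g • (w : OnePoint ℂ))) w := by
      rw [← nhdsNE_sup_pure, eventually_sup, eventually_pure]
      exact ⟨hd, hdiff g 0 hp⟩
    have ha : AnalyticAt ℂ (fun w : ℂ => h (g • (w : OnePoint ℂ))) 0 :=
      Complex.analyticAt_iff_eventually_differentiableAt.mpr hd'
    refine ⟨ha.meromorphicNFAt, ?_⟩
    rw [divisorAt_of_notMem hp]
    exact ha.meromorphicNFAt.meromorphicOrderAt_eq_zero_iff.mpr (hne _ hp)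

/-- A meromorphic function on the sphere is determined by its divisor up to a factor. -/
theorem IsMeromorphicWithDivisor.exists_eq_mul (hmp : ∀ k, 0 < mp k) (hmm : ∀ k, 0 < mm k)
    (hz : Function.Injective z) {h h' : OnePoint ℂ → ℂ}
    (H : IsMeromorphicWithDivisor mp mm z h) (H' : IsMeromorphicWithDivisor mp mm z h') :
    ∃ a ≠ 0, ∀ p, h' p = a * h p := by
  -- The quotient has order zero at every point, so it has a finite nonzero limit everywhere,
  -- although its values at the punctures are `0 / 0`.
  let q : OnePoint ℂ → ℂ := fun p => h' p / h p
  have hq : ∀ (g : GL (Fin 2) ℂ), MeromorphicAt (fun w : ℂ => q (g • (w : OnePoint ℂ))) 0 ∧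
      meromorphicOrderAt (fun w : ℂ => q (g • (w : OnePoint ℂ))) 0 = 0 := by
    intro g
    obtain ⟨h1, h2⟩ := H g
    obtain ⟨h1', h2'⟩ := H' g
    refine ⟨h1'.meromorphicAt.fun_div h1.meromorphicAt, ?_⟩
    have := meromorphicOrderAt_div h1'.meromorphicAt h1.meromorphicAt
    rw [h2, h2'] at this
    refine Eq.trans this ?_
    rw [← WithTop.LinearOrderedAddCommGroup.coe_sub]
    simp
  have hlim : ∀ (g : GL (Fin 2) ℂ), ∃ c : ℂ, c ≠ 0 ∧
      Tendsto (fun w : ℂ => q (g • (w : OnePoint ℂ))) (𝓝[≠] 0) (𝓝 c) := fun g =>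
    tendsto_ne_zero_of_meromorphicOrderAt_eq_zero (hq g).1 (hq g).2
  have hlim' : ∀ w₀ : ℂ, ∃ c : ℂ, c ≠ 0 ∧
      Tendsto (fun w : ℂ => q (w : OnePoint ℂ)) (𝓝[≠] w₀) (𝓝 c) := by
    intro w₀
    obtain ⟨c, hc, hl⟩ := hlim (translationMatrix w₀)
    refine ⟨c, hc, ?_⟩
    have ht : Tendsto (fun y : ℂ => y - w₀) (𝓝[≠] w₀) (𝓝[≠] 0) := by
      rw [tendsto_nhdsWithin_iff]
      constructor
      · have : ContinuousAt (fun y : ℂ => y - w₀) w₀ := by fun_prop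
        simpa using this.tendsto.mono_left nhdsWithin_le_nhds
      · filter_upwards [self_mem_nhdsWithin] with y hy
        exact sub_ne_zero.mpr hy
    refine (hl.comp ht).congr fun y => ?_
    have := mul_translation_smul 1 w₀ (y - w₀)
    simp only [one_mul, one_smul, sub_add_cancel] at this
    simp [this]
  -- `Q` collects these limits; it is the extension of `q` over the punctures, hence entire.
  choose Q hQ0 hQ using hlim'
  have hane : ∀ w : ℂ, (w : OnePoint ℂ) ∉ range z →
      AnalyticAt ℂ (fun w : ℂ => q (w : OnePoint ℂ)) w ∧ q w = Q w := by
    intro w hw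
    have h1 := H.analyticAt 1 w (by simpa using hw)
    have h2 := H'.analyticAt 1 w (by simpa using hw)
    simp only [one_smul] at h1 h2
    have h3 : AnalyticAt ℂ (fun w : ℂ => q (w : OnePoint ℂ)) w := h2.fun_div h1 (H.ne_zero hw)
    exact ⟨h3, tendsto_nhds_unique
      (h3.continuousAt.tendsto.mono_left nhdsWithin_le_nhds) (hQ w)⟩
  have hev : ∀ w₀ : ℂ, ∀ᶠ w : ℂ in 𝓝[≠] w₀, q w = Q w ∧ DifferentiableAt ℂ Q w := by
    intro w₀
    have hr := eventually_notMem_range z 1 w₀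
    simp only [one_smul] at hr
    have hr2 := (eventually_eventually_nhdsWithin.mpr hr)
    filter_upwards [hr, hr2, self_mem_nhdsWithin] with w hw hw2 hw3
    refine ⟨(hane w hw).2, (hane w hw).1.differentiableAt.congr_of_eventuallyEq ?_⟩
    rw [IsOpen.nhdsWithin_eq isOpen_compl_singleton hw3] at hw2
    exact hw2.mono fun y hy => (hane y hy).2.symm
  have hQd : Differentiable ℂ Q := by
    intro w₀
    refine (Complex.analyticAt_of_differentiable_on_punctured_nhds_of_continuousAt
      ((hev w₀).mono fun w hw => hw.2) ?_).differentiableAt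
    rw [continuousAt_iff_punctured_nhds]
    exact (hQ w₀).congr' ((hev w₀).mono fun w hw => hw.1)
  -- The limit of `q` at infinity, seen in the coordinate `w ↦ 1 / w`; an entire function with a
  -- finite limit at infinity is constant.
  obtain ⟨a, ha, hla⟩ := hlim (Matrix.GeneralLinearGroup.mkOfDetNeZero !![0, 1; 1, 0] (by simp))
  have hcon : ∀ w, Q w = a := by
    intro w
    refine hQd.apply_eq_of_tendsto_cocompact w ?_
    rw [← Metric.cobounded_eq_cocompact]
    have hfin : ((fun w : ℂ => (w : OnePoint ℂ)) ⁻¹' range z).Finite :=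
      (finite_range z).preimage OnePoint.coe_injective.injOn
    refine (hla.comp tendsto_inv₀_cobounded').congr' ?_
    filter_upwards [Bornology.isBounded_def.mp hfin.isBounded,
      Bornology.isBounded_def.mp (Bornology.isBounded_singleton (x := (0 : ℂ)))] with y hy hy0
    have hy0' : y ≠ 0 := hy0
    rw [← (hane y hy).2]
    simp only [Function.comp]
    rw [smul_coe_eq]
    simp [projPoint, colAt, Matrix.GeneralLinearGroup.mkOfDetNeZero, hy0']
  have hoff : ∀ p : OnePoint ℂ, p ∉ range z → h' p = a * h p := by
    intro p hp
    have hne := H.ne_zero hp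
    induction p using OnePoint.rec with
    | infty =>
      have hg : (Matrix.GeneralLinearGroup.mkOfDetNeZero !![0, 1; 1, 0] (by simp) :
          GL (Fin 2) ℂ) • ((0 : ℂ) : OnePoint ℂ) = OnePoint.infty := by
        rw [smul_coe_eq]
        simp [projPoint, colAt, Matrix.GeneralLinearGroup.mkOfDetNeZero]
      rw [← hg] at hp hne ⊢
      have h1 := H.analyticAt _ 0 hp
      have h2 := H'.analyticAt _ 0 hp
      have h3 := (h2.continuousAt.div h1.continuousAt hne).tendsto
      have h4 := tendsto_nhds_unique (h3.mono_left nhdsWithin_le_nhds) hla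
      rw [← h4, Pi.div_apply, div_mul_cancel₀ _ hne]
    | coe w =>
      rw [← hcon w, ← (hane w hp).2, div_mul_cancel₀ _ hne]
  refine ⟨a, ha, fun p => ?_⟩
  by_cases hp : p ∈ range z
  · obtain ⟨k, rfl⟩ := hp
    rw [H.eq_zero hmp hmm hz, H'.eq_zero hmp hmm hz, mul_zero]
  · exact hoff p hp

end Divisor

/-! ### The explicit meromorphic function -/

section BracketProduct

variable {ι : Type*} [Fintype ι]

/-- The product of the linear forms vanishing at the `v k`, with exponents `e k`. -/
noncomputable def bracketProduct (e : ι → ℤ) (v : ι → Fin 2 → ℂ) (x : Fin 2 → ℂ) : ℂ :=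
  ∏ k, bracket x (v k) ^ e k

theorem prod_zpow_eq_zpow_sum {ι : Type*} {c : ℂ} (hc : c ≠ 0) (s : Finset ι) (e : ι → ℤ) :
    ∏ k ∈ s, c ^ e k = c ^ ∑ k ∈ s, e k := by
  classical
  induction s using Finset.induction_on with
  | empty => simp
  | insert a s ha ih => rw [Finset.prod_insert ha, Finset.sum_insert ha, zpow_add₀ hc, ih]

theorem bracketProduct_smul {e : ι → ℤ} (he : ∑ k, e k = 0) (v : ι → Fin 2 → ℂ) {c : ℂ}
    (hc : c ≠ 0) (x : Fin 2 → ℂ) : bracketProduct e v (c • x) = bracketProduct e v x := by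
  simp only [bracketProduct, bracket_smul_left, mul_zpow, Finset.prod_mul_distrib]
  rw [prod_zpow_eq_zpow_sum hc, he, zpow_zero, one_mul]

/-- `bracketProduct` as a function on the sphere. -/
noncomputable def sphereProduct (e : ι → ℤ) (v : ι → Fin 2 → ℂ) (p : OnePoint ℂ) : ℂ :=
  bracketProduct e v (homCoord p)

/-- Degree zero makes the product independent of the homogeneous coordinates of the point. -/
theorem sphereProduct_projPoint {e : ι → ℤ} (he : ∑ k, e k = 0) (v : ι → Fin 2 → ℂ)
    {x : Fin 2 → ℂ} (hx : x ≠ 0) : sphereProduct e v (projPoint x) = bracketProduct e v x := by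
  have h : bracket x (homCoord (projPoint x)) = 0 :=
    (projPoint_eq_iff hx (homCoord_ne_zero _)).mp (projPoint_homCoord _).symm
  obtain ⟨c, hc, h⟩ := eq_smul_of_bracket_eq_zero hx (homCoord_ne_zero _) h
  rw [sphereProduct, h, bracketProduct_smul he v hc]

/-- In the coordinate `g` the factor with label `k` is exactly `(w * det g) ^ e k`, while the others
have nonzero limits at `w = 0`. -/
theorem sphereProduct_hasLeadingCoeff [DecidableEq ι] {e : ι → ℤ} (he : ∑ k, e k = 0)
    {v : ι → Fin 2 → ℂ} {k : ι} {g : GL (Fin 2) ℂ} (hg : secondCol g = v k)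
    (hv : ∀ j ≠ k, bracket (v k) (v j) ≠ 0) :
    HasLeadingCoeff (fun w => sphereProduct e v (g • (w : OnePoint ℂ))) (e k)
      (g.1.det ^ e k * ∏ j ∈ Finset.univ.erase k, bracket (v k) (v j) ^ e j) := by
  have h1 : Tendsto (fun w : ℂ => g.1.det ^ e k *
      ∏ j ∈ Finset.univ.erase k, bracket (colAt g w) (v j) ^ e j) (𝓝[≠] 0)
      (𝓝 (g.1.det ^ e k * ∏ j ∈ Finset.univ.erase k, bracket (v k) (v j) ^ e j)) := by
    refine Tendsto.const_mul _ (tendsto_finsetProd _ fun j hj => ?_)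
    have hj' := hv j (Finset.ne_of_mem_erase hj)
    refine Tendsto.zpow₀ ?_ _ (Or.inl hj')
    have : ContinuousAt (fun w => bracket (colAt g w) (v j)) 0 := by
      simp only [bracket_colAt]; fun_prop
    have := this.tendsto.mono_left (nhdsWithin_le_nhds (s := {0}ᶜ))
    simpa [hg] using this
  refine h1.congr' ?_
  filter_upwards [self_mem_nhdsWithin] with w (hw : w ≠ 0)
  rw [smul_coe_eq, sphereProduct_projPoint he v (colAt_ne_zero g w), bracketProduct,
    ← Finset.mul_prod_erase _ _ (Finset.mem_univ k), ← hg, bracket_colAt_secondCol, mul_zpow,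
    zpow_neg]
  have := zpow_ne_zero (e k) hw
  field_simp

end BracketProduct

theorem bracket_ne_zero_of_projPoint_ne {v w : Fin 2 → ℂ} (hv : v ≠ 0) (hw : w ≠ 0)
    (h : projPoint v ≠ projPoint w) : bracket v w ≠ 0 :=
  fun h0 => h ((projPoint_eq_iff hv hw).mpr h0)

theorem isMeromorphicWithDivisor_sphereProduct {np nm : ℕ} {mp : Fin np → ℕ} {mm : Fin nm → ℕ}
    (hmp : ∀ k, 0 < mp k) (hmm : ∀ k, 0 < mm k) (hsum : ∑ k, mp k = ∑ k, mm k)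
    {v : Fin np ⊕ Fin nm → Fin 2 → ℂ} (hv : ∀ k, v k ≠ 0)
    (hinj : Function.Injective fun k => projPoint (v k)) :
    IsMeromorphicWithDivisor mp mm (fun k => projPoint (v k))
      (sphereProduct (punctureOrder mp mm) v) := by
  have he := sum_punctureOrder hsum
  have hb : ∀ {p : OnePoint ℂ}, p ∉ range (fun k => projPoint (v k)) →
      ∀ k x, x ≠ 0 → projPoint x = p → bracket x (v k) ≠ 0 := by
    intro p hp k x hx hxp
    exact bracket_ne_zero_of_projPoint_ne hx (hv k) fun h => hp ⟨k, by simp [← hxp, h]⟩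
  apply isMeromorphicWithDivisor_of_leadingCoeff hmp hmm hinj
  · intro g w hw
    have : (fun w : ℂ => sphereProduct (punctureOrder mp mm) v (g • (w : OnePoint ℂ)))
        = fun w => ∏ k, (w * bracket (fun i => g i 0) (v k) + bracket (secondCol g) (v k)) ^
          punctureOrder mp mm k := by
      ext w
      rw [smul_coe_eq, sphereProduct_projPoint he v (colAt_ne_zero g w), bracketProduct]
      simp only [bracket_colAt]
    rw [this]
    refine DifferentiableAt.fun_finsetProd fun k _ => DifferentiableAt.zpow (by fun_prop) (Or.inl ?_)
    rw [← bracket_colAt]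
    exact hb hw k _ (colAt_ne_zero g w) (smul_coe_eq g w).symm
  · intro p hp
    rw [sphereProduct, bracketProduct]
    exact Finset.prod_ne_zero_iff.mpr fun k _ => zpow_ne_zero _
      (hb hp k _ (homCoord_ne_zero p) (projPoint_homCoord p))
  · intro k
    rw [sphereProduct_projPoint he v (hv k)]
    refine Finset.prod_eq_zero (Finset.mem_univ k) ?_
    rw [bracket_self, zero_zpow _ (punctureOrder_ne_zero hmp hmm k)]
  · intro k
    obtain ⟨g, hg⟩ := exists_frame (hv k)
    have hbk : ∀ j ≠ k, bracket (v k) (v j) ≠ 0 := fun j hj =>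
      bracket_ne_zero_of_projPoint_ne (hv k) (hv j) (hinj.ne hj.symm)
    refine ⟨g, by rw [smul_zero_eq, hg], _, ?_, sphereProduct_hasLeadingCoeff he hg hbk⟩
    exact mul_ne_zero (zpow_ne_zero _ g.det_ne_zero) (Finset.prod_ne_zero_iff.mpr fun j hj =>
      zpow_ne_zero _ (hbk j (Finset.ne_of_mem_erase hj)))

/-! ### Smoothness of integral curves -/

/-- Bootstrapping: if `f` is of class `C^m`, then so is its derivative `v ∘ f`, hence `f` is of
class `C^(m+1)`. -/
theorem contDiffOn_of_hasDerivAt_comp {E : Type*} [NormedAddCommGroup E] [NormedSpace ℝ E]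
    {n : ℕ} {f : ℝ → E} {v : E → E} {s : Set ℝ} {U : Set E} (hs : IsOpen s)
    (hU : ContDiffOn ℝ n v U) (hmaps : MapsTo f s U)
    (hf : ∀ t ∈ s, HasDerivAt f (v (f t)) t) : ContDiffOn ℝ n f s := by
  suffices h : ∀ m : ℕ, m ≤ n → ContDiffOn ℝ m f s from h n le_rfl
  intro m
  induction m with
  | zero => exact fun _ => contDiffOn_zero.mpr fun t ht => (hf t ht).continuousAt.continuousWithinAt
  | succ m ih =>
    intro hm
    rw [show ((m + 1 : ℕ) : WithTop ℕ∞) = (m : WithTop ℕ∞) + 1 by push_cast; rfl,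
      contDiffOn_succ_iff_deriv_of_isOpen hs]
    refine ⟨fun t ht => (hf t ht).differentiableAt.differentiableWithinAt, by simp, ?_⟩
    have : ContDiffOn ℝ m (v ∘ f) s :=
      (hU.of_le (by exact_mod_cast (Nat.le_succ m).trans hm)).comp
        (ih ((Nat.le_succ m).trans hm)) hmaps
    exact this.congr fun t ht => (hf t ht).deriv

section

variable {E : Type*} [NormedAddCommGroup E] [NormedSpace ℝ E]
  {V : Type*} [TopologicalSpace V] [ChartedSpace E V] [IsManifold 𝓘(ℝ, E) ∞ V]

theorem isManifold_one_of_infty : IsManifold 𝓘(ℝ, E) 1 V :=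
  IsManifold.of_le (n := ∞) (by exact_mod_cast le_top)

theorem IsMIntegralCurve.contMDiff {v : ∀ x : V, TangentSpace 𝓘(ℝ, E) x}
    (hv : ContMDiff 𝓘(ℝ, E) 𝓘(ℝ, E).tangent ∞ (fun x => (⟨x, v x⟩ : TangentBundle 𝓘(ℝ, E) V)))
    {c : ℝ → V} (hc : IsMIntegralCurve c v) : ContMDiff 𝓘(ℝ, ℝ) 𝓘(ℝ, E) ∞ c := by
  have := isManifold_one_of_infty (E := E) (V := V)
  rw [contMDiff_infty]
  intro n t₀
  have h1 := (contMDiffAt_iff.mp ((hv.of_le (show (n : WithTop ℕ∞) ≤ ∞ by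
    exact_mod_cast le_top)) (c t₀))).2
  -- The vector field read in the chart at `c t₀`; there the integral curve solves an ordinary
  -- differential equation.
  let w : E → E := fun y => tangentCoordChange 𝓘(ℝ, E) ((extChartAt 𝓘(ℝ, E) (c t₀)).symm y) (c t₀)
    ((extChartAt 𝓘(ℝ, E) (c t₀)).symm y) (v ((extChartAt 𝓘(ℝ, E) (c t₀)).symm y))
  have h2 : ContDiffAt ℝ n w (extChartAt 𝓘(ℝ, E) (c t₀) (c t₀)) :=
    (h1.contDiffAt (by simp)).snd
  obtain ⟨U, hU, hwU⟩ := h2.contDiffOn le_rfl (by simp)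
  have hcont := hc.continuous
  have h3 := hc.isMIntegralCurveAt t₀ |>.eventually_hasDerivAt
  have hsrc : ∀ᶠ t in 𝓝 t₀, c t ∈ (extChartAt 𝓘(ℝ, E) (c t₀)).source :=
    hcont.continuousAt.eventually_mem (extChartAt_source_mem_nhds (c t₀))
  have hU' : ∀ᶠ t in 𝓝 t₀, extChartAt 𝓘(ℝ, E) (c t₀) (c t) ∈ U :=
    ((continuousAt_extChartAt (c t₀)).comp hcont.continuousAt).eventually_mem hU
  obtain ⟨s, hs, hso, ht₀⟩ := eventually_nhds_iff.mp (h3.and (hsrc.and hU'))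
  have key : ContDiffOn ℝ n (extChartAt 𝓘(ℝ, E) (c t₀) ∘ c) s := by
    refine contDiffOn_of_hasDerivAt_comp hso hwU (fun t ht => (hs t ht).2.2) fun t ht => ?_
    obtain ⟨ha, hb, -⟩ := hs t ht
    have e : (extChartAt 𝓘(ℝ, E) (c t₀)).symm (extChartAt 𝓘(ℝ, E) (c t₀) (c t)) = c t :=
      (extChartAt 𝓘(ℝ, E) (c t₀)).left_inv hb
    -- The base point occurs in the types of the tangent vectors, so it is exchanged by matching on
    -- an equation instead of rewriting.
    have hw : ∀ p, p = c t → (tangentCoordChange 𝓘(ℝ, E) p (c t₀) p (v p) : E)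
        = tangentCoordChange 𝓘(ℝ, E) (c t) (c t₀) (c t) (v (c t)) := by
      rintro _ rfl; rfl
    have hw' : w ((extChartAt 𝓘(ℝ, E) (c t₀) ∘ c) t)
        = tangentCoordChange 𝓘(ℝ, E) (c t) (c t₀) (c t) (v (c t)) := hw _ e
    rw [hw']
    exact ha
  rw [contMDiffAt_iff]
  refine ⟨hcont.continuousAt, ?_⟩
  simp only [extChartAt_model_space_eq_id, PartialEquiv.refl_symm, PartialEquiv.refl_coe,
    Function.comp_id, id, modelWithCornersSelf_coe, range_id, contDiffWithinAt_univ]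
  exact key.contDiffAt (hso.mem_nhds ht₀)

variable {X : CylindricalStructure E V}

theorem SimpleClosedOrbit.contMDiff_orbit (γ : SimpleClosedOrbit X) :
    ContMDiff 𝓘(ℝ, ℝ) 𝓘(ℝ, E) ∞ γ.orbit :=
  γ.isIntegralCurve.contMDiff X.reeb_smooth

/-- At a zero of the field the constant curve is integral, so by uniqueness of integral curves in a
Hausdorff manifold the orbit would be constant, against its injectivity on a period. -/
theorem SimpleClosedOrbit.reeb_ne_zero [T2Space V] [FiniteDimensional ℝ E]
    (γ : SimpleClosedOrbit X) (t : ℝ) :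
    X.reeb (γ.orbit t) ≠ 0 := by
  intro h0
  have := isManifold_one_of_infty (E := E) (V := V)
  have hconst : IsMIntegralCurve (fun _ : ℝ => γ.orbit t) X.reeb := by
    intro s
    have h := hasMFDerivAt_const (I := 𝓘(ℝ, ℝ)) (I' := 𝓘(ℝ, E)) (γ.orbit t) s
    refine h.congr_mfderiv ?_
    apply ContinuousLinearMap.ext
    intro a
    have h0' : (X.reeb (γ.orbit t) : E) = 0 := h0
    change (0 : E) = ((show ℝ from a) • (X.reeb (γ.orbit t) : E) : E)
    rw [h0', smul_zero]
    rfl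
  have : CompleteSpace E := FiniteDimensional.complete ℝ E
  have hcd : ContMDiff 𝓘(ℝ, E) 𝓘(ℝ, E).tangent 1
    (fun x => (⟨x, X.reeb x⟩ : TangentBundle 𝓘(ℝ, E) V)) :=
    X.reeb_smooth.of_le (by exact_mod_cast le_top)
  have h := isMIntegralCurve_Ioo_eq_of_contMDiff_boundaryless (t₀ := t) hcd γ.isIntegralCurve hconst
    rfl
  have hp := γ.period_pos
  have := γ.injOn (x₁ := 0) (x₂ := γ.period / 2) ⟨le_rfl, hp⟩ ⟨by positivity, by linarith⟩
    (by rw [h])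
  linarith

end

/-! ### The trivial cylinder and its universal covering. -/

section

variable {E : Type*} [NormedAddCommGroup E] [NormedSpace ℝ E]
  {V : Type*} [TopologicalSpace V] [ChartedSpace E V] [IsManifold 𝓘(ℝ, E) ∞ V]
  {X : CylindricalStructure E V}

/-- The value of the vector field at a point, as an element of the model space. -/
def CylindricalStructure.reebVec (X : CylindricalStructure E V) (x : V) : E := X.reeb x

/-- From `J ∂_s = R` and `J² = -1` one gets `J R = -∂_s`, so the plane spanned by both is complex
and `J` acts there like `i`. -/
theorem CylindricalStructure.J_reeb (X : CylindricalStructure E V) (a : ℝ) (x : V) (s t : ℝ) :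
    (X.J (a, x) ((s, t • X.reebVec x) : ℝ × E) : ℝ × E) = (-t, s • X.reebVec x) := by
  have key : ∀ (J' : ℝ × E →L[ℝ] ℝ × E) (r : E), (∀ v, J' (J' v) = -v) → J' (1, 0) = (0, r) →
      J' (s, t • r) = (-t, s • r) := by
    intro J' r hsq h1
    have h2 : J' (0, r) = -(1, 0) := by rw [← h1, hsq]
    have e : (s, t • r) = s • ((1, 0) : ℝ × E) + t • (0, r) := by ext <;> simp
    rw [e, map_add, map_smul, map_smul, h1, h2]
    ext <;> simp
  exact key (X.J (a, x)) (X.reebVec x) (X.J_sq (a, x)) (X.J_ds a x)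

namespace SimpleClosedOrbit

/-- The universal covering `s + i t ↦ (s, γ t)` of the trivial cylinder. -/
def stripMap (γ : SimpleClosedOrbit X) (z : ℂ) : ℝ × V := (z.re, γ.orbit z.im)

/-- The differential of `stripMap`. -/
noncomputable def stripDeriv (γ : SimpleClosedOrbit X) (z : ℂ) : ℂ →L[ℝ] ℝ × E :=
  Complex.reCLM.prod (Complex.imCLM.smulRight (X.reebVec (γ.orbit z.im)))

theorem stripDeriv_apply (γ : SimpleClosedOrbit X) (z v : ℂ) :
    γ.stripDeriv z v = (v.re, v.im • (X.reebVec (γ.orbit z.im))) := rfl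

theorem contMDiff_stripMap (γ : SimpleClosedOrbit X) :
    ContMDiff 𝓘(ℝ, ℂ) (𝓘(ℝ, ℝ).prod 𝓘(ℝ, E)) ∞ γ.stripMap :=
  ContMDiff.prodMk Complex.reCLM.contDiff.contMDiff
    (γ.contMDiff_orbit.comp Complex.imCLM.contDiff.contMDiff)

theorem hasMFDerivAt_stripMap (γ : SimpleClosedOrbit X) (z : ℂ) :
    HasMFDerivAt 𝓘(ℝ, ℂ) (𝓘(ℝ, ℝ).prod 𝓘(ℝ, E)) γ.stripMap z (γ.stripDeriv z) := by
  have h1 : HasMFDerivAt 𝓘(ℝ, ℂ) 𝓘(ℝ, ℝ) Complex.re z Complex.reCLM :=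
    Complex.reCLM.hasFDerivAt.hasMFDerivAt
  have h2 : HasMFDerivAt 𝓘(ℝ, ℂ) 𝓘(ℝ, ℝ) Complex.im z Complex.imCLM :=
    Complex.imCLM.hasFDerivAt.hasMFDerivAt
  have h3 := (γ.isIntegralCurve z.im).comp z h2
  exact (h1.prodMk h3).congr_mfderiv rfl

theorem J_stripDeriv (γ : SimpleClosedOrbit X) (z v : ℂ) :
    (X.J (γ.stripMap z) (γ.stripDeriv z v) : ℝ × E) = γ.stripDeriv z (Complex.I * v) := by
  rw [stripDeriv_apply, stripDeriv_apply]
  have := X.J_reeb z.re (γ.orbit z.im) v.re v.im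
  simp only [Complex.mul_re, Complex.mul_im, Complex.I_re, Complex.I_im, zero_mul, one_mul,
    zero_sub, zero_add]
  exact this

theorem stripDeriv_injective [T2Space V] [FiniteDimensional ℝ E] (γ : SimpleClosedOrbit X)
    (z : ℂ) : Function.Injective (γ.stripDeriv z) := by
  intro v w h
  rw [stripDeriv_apply, stripDeriv_apply, Prod.mk.injEq] at h
  exact Complex.ext h.1 (smul_left_injective ℝ (γ.reeb_ne_zero z.im) h.2)

theorem orbit_eq_of_circleExp_eq (γ : SimpleClosedOrbit X) {s t : ℝ}
    (h : Circle.exp s = Circle.exp t) :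
    γ.orbit (γ.period * (s / (2 * Real.pi))) = γ.orbit (γ.period * (t / (2 * Real.pi))) := by
  obtain ⟨m, hm⟩ := Circle.exp_eq_exp.mp h
  rw [hm]
  have e : γ.period * ((t + m * (2 * Real.pi)) / (2 * Real.pi))
      = γ.period * (t / (2 * Real.pi)) + m * γ.period := by
    field_simp
  rw [e]
  exact γ.periodic.int_mul m _

/-- Both arguments are reduced to `[0, 2π)`, which corresponds to one period, where the orbit is
injective because it is simple. -/
theorem circleExp_eq_of_orbit_eq (γ : SimpleClosedOrbit X) {s t : ℝ}
    (h : γ.orbit (γ.period * (s / (2 * Real.pi))) = γ.orbit (γ.period * (t / (2 * Real.pi)))) :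
    Circle.exp s = Circle.exp t := by
  have hp := γ.period_pos
  have hr : ∀ s : ℝ, ∃ s', Circle.exp s' = Circle.exp s ∧ γ.period * (s' / (2 * Real.pi)) ∈
      Ico 0 γ.period := by
    intro s
    refine ⟨toIcoMod Real.two_pi_pos 0 s, ?_, ?_⟩
    · rw [Circle.exp_eq_exp]
      refine ⟨-toIcoDiv Real.two_pi_pos 0 s, ?_⟩
      rw [toIcoMod]; push_cast; rw [zsmul_eq_mul]; ring
    · have := toIcoMod_mem_Ico Real.two_pi_pos 0 s
      rw [zero_add] at this
      refine ⟨mul_nonneg hp.le (div_nonneg this.1 Real.two_pi_pos.le), ?_⟩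
      have h1 := (div_lt_one Real.two_pi_pos).mpr this.2
      nlinarith
  obtain ⟨s', hs, hs'⟩ := hr s
  obtain ⟨t', ht, ht'⟩ := hr t
  rw [← γ.orbit_eq_of_circleExp_eq hs, ← γ.orbit_eq_of_circleExp_eq ht] at h
  have := γ.injOn hs' ht' h
  have e : s' = t' := by
    have h2 := mul_left_cancel₀ hp.ne' this
    exact (div_left_inj' Real.two_pi_pos.ne').mp h2
  rw [← hs, ← ht, e]

/-- The simple closed orbit as a map on the circle. -/
noncomputable def onCircle (γ : SimpleClosedOrbit X) (ζ : Circle) : V :=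
  γ.orbit (γ.period * ((ζ : ℂ).arg / (2 * Real.pi)))

theorem onCircle_exp (γ : SimpleClosedOrbit X) (s : ℝ) :
    γ.onCircle (Circle.exp s) = γ.orbit (γ.period * (s / (2 * Real.pi))) :=
  γ.orbit_eq_of_circleExp_eq (Circle.exp_arg _)

theorem onCircle_injective (γ : SimpleClosedOrbit X) : Function.Injective γ.onCircle := by
  intro ζ ξ h
  have := γ.circleExp_eq_of_orbit_eq h
  rwa [Circle.exp_arg, Circle.exp_arg] at this

theorem continuous_onCircle (γ : SimpleClosedOrbit X) : Continuous γ.onCircle := by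
  have hq : Topology.IsQuotientMap (Circle.exp : ℝ → Circle) :=
    isLocalHomeomorph_circleExp.isOpenMap.isQuotientMap Circle.exp.continuous
      fun ζ => ⟨_, Circle.exp_arg ζ⟩
  rw [hq.continuous_iff]
  have : γ.onCircle ∘ Circle.exp = fun s : ℝ => γ.orbit (γ.period * (s / (2 * Real.pi))) :=
    funext γ.onCircle_exp
  rw [this]
  exact γ.isIntegralCurve.continuous.comp (by fun_prop)

/-- A continuous injection of a compact space into a Hausdorff space. This recovers convergence of
phases from convergence in `V`. -/
theorem isEmbedding_onCircle [T2Space V] (γ : SimpleClosedOrbit X) :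
    Topology.IsEmbedding γ.onCircle :=
  (γ.continuous_onCircle.isClosedEmbedding γ.onCircle_injective).isEmbedding

theorem trivialCylinder_eq (γ : SimpleClosedOrbit X) (w : ℂ) :
    γ.trivialCylinder w = (γ.period * (Real.log ‖w‖ / (2 * Real.pi)), γ.onCircle (phase w)) := by
  rw [phase, onCircle_exp]
  rfl

theorem trivialCylinder_injOn (γ : SimpleClosedOrbit X) {w w' : ℂ} (hw : w ≠ 0) (hw' : w' ≠ 0)
    (h : γ.trivialCylinder w = γ.trivialCylinder w') : w = w' := by
  rw [trivialCylinder_eq, trivialCylinder_eq, Prod.mk.injEq] at h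
  have h1 := mul_left_cancel₀ γ.period_pos.ne' h.1
  have h2 := (div_left_inj' Real.two_pi_pos.ne').mp h1
  have h3 := Real.log_injOn_pos (norm_pos_iff.mpr hw) (norm_pos_iff.mpr hw') h2
  rw [← norm_mul_phase w, ← norm_mul_phase w', h3, γ.onCircle_injective h.2]

theorem continuousAt_trivialCylinder (γ : SimpleClosedOrbit X) {w : ℂ} (hw : w ≠ 0) :
    ContinuousAt γ.trivialCylinder w := by
  have : γ.trivialCylinder = fun w => _ := funext γ.trivialCylinder_eq
  rw [this]
  refine ContinuousAt.prodMk ?_ (γ.continuous_onCircle.continuousAt.comp (continuousAt_phase hw))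
  exact continuousAt_const.mul
    ((continuous_norm.continuousAt.log (norm_ne_zero_iff.mpr hw)).div_const _)

/-- The reason why translations of the target cancel precisely the positive real factors of the
meromorphic function. -/
theorem trivialCylinder_mul_ofReal (γ : SimpleClosedOrbit X) {r : ℝ} (hr : 0 < r) {w : ℂ}
    (hw : w ≠ 0) : γ.trivialCylinder (r * w) =
      ((γ.trivialCylinder w).1 + γ.period * (Real.log r / (2 * Real.pi)),
        (γ.trivialCylinder w).2) := by
  have hr' : (r : ℂ) ≠ 0 := by exact_mod_cast hr.ne'
  rw [trivialCylinder_eq, trivialCylinder_eq, phase_mul hr' hw, phase_ofReal hr, one_mul, norm_mul,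
    Complex.norm_real, Real.norm_of_nonneg hr.le,
    Real.log_mul hr.ne' (norm_ne_zero_iff.mpr hw)]
  ext
  · simp only; ring
  · rfl

theorem trivialCylinder_exp (γ : SimpleClosedOrbit X) (z : ℂ) :
    γ.trivialCylinder (Complex.exp (2 * Real.pi / γ.period * z)) = γ.stripMap z := by
  have hp := γ.period_pos.ne'
  have e : (2 * Real.pi / γ.period * z : ℂ) = ((2 * Real.pi / γ.period : ℝ) : ℂ) * z := by
    push_cast; rfl
  have h1 : phase (Complex.exp (2 * Real.pi / γ.period * z))
      = Circle.exp (2 * Real.pi / γ.period * z.im) := by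
    apply Subtype.ext
    rw [coe_phase (Complex.exp_ne_zero _), Complex.norm_exp, Circle.coe_exp, e,
      Complex.re_ofReal_mul, Complex.ofReal_exp, ← Complex.exp_sub]
    congr 1
    apply Complex.ext <;> simp
  rw [trivialCylinder_eq, h1, onCircle_exp, Complex.norm_exp, Real.log_exp, e,
    Complex.re_ofReal_mul, stripMap]
  have := Real.pi_ne_zero
  congr 2 <;> field_simp

theorem trivialCylinder_surjOn (γ : SimpleClosedOrbit X) {p : ℝ × V} (hp : p.2 ∈ range γ.orbit) :
    ∃ w ≠ 0, γ.trivialCylinder w = p := by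
  obtain ⟨t, ht⟩ := hp
  refine ⟨_, Complex.exp_ne_zero (2 * Real.pi / γ.period * (⟨p.1, t⟩ : ℂ)), ?_⟩
  rw [trivialCylinder_exp, stripMap]
  exact Prod.ext rfl ht

theorem trivialCylinder_snd_mem (γ : SimpleClosedOrbit X) (w : ℂ) :
    (γ.trivialCylinder w).2 ∈ range γ.orbit := ⟨_, rfl⟩

end SimpleClosedOrbit

end

/-- A continuous local solution `τ` of `p (τ w) = q w`, with `p` of nonzero derivative and `q`
differentiable, is differentiable. -/
theorem differentiableAt_of_comp {F : Type*} [NormedAddCommGroup F] [NormedSpace ℝ F]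
    {p : ℝ → ℝ} {p' : ℝ} {τ : F → ℝ} {w₀ : F} (hp : HasDerivAt p p' (τ w₀)) (hp' : p' ≠ 0)
    (hτ : ContinuousAt τ w₀) (hq : DifferentiableAt ℝ (p ∘ τ) w₀) : DifferentiableAt ℝ τ w₀ := by
  -- Writing `p (τ w) - p (τ w₀)` as `(τ w - τ w₀)` times the slope of `p`, whose limit `p'` is not
  -- zero, one can divide by the slope; the differential of `τ` is that of `p ∘ τ` divided by `p'`.
  have hs : ContinuousAt (dslope p (τ w₀)) (τ w₀) := continuousAt_dslope_same.mpr hp.differentiableAt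
  have hs0 : dslope p (τ w₀) (τ w₀) ≠ 0 := by rwa [dslope_same, hp.deriv]
  have hc : ContinuousAt (fun w => (dslope p (τ w₀) (τ w))⁻¹) w₀ :=
    ContinuousAt.inv₀ (ContinuousAt.comp (f := τ) hs hτ) hs0
  obtain ⟨L, hL⟩ := hq
  have hO : (fun w => (p ∘ τ) w - (p ∘ τ) w₀ - L (w - w₀)) =o[𝓝 w₀] fun w => w - w₀ :=
    hL.isLittleO
  refine ⟨(dslope p (τ w₀) (τ w₀))⁻¹ • L, ?_⟩
  rw [hasFDerivAt_iff_isLittleO]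
  have h1 : (fun w => (dslope p (τ w₀) (τ w))⁻¹ * ((p ∘ τ) w - (p ∘ τ) w₀ - L (w - w₀)))
      =o[𝓝 w₀] fun w => w - w₀ := by
    have := (hc.tendsto.isBigO_one ℝ).mul_isLittleO hO.norm_right
    simpa using this.norm_right
  have h2 : (fun w => ((dslope p (τ w₀) (τ w))⁻¹ - (dslope p (τ w₀) (τ w₀))⁻¹) * L (w - w₀))
      =o[𝓝 w₀] fun w => w - w₀ := by
    have h3 : (fun w => (dslope p (τ w₀) (τ w))⁻¹ - (dslope p (τ w₀) (τ w₀))⁻¹)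
        =o[𝓝 w₀] (fun _ => (1 : ℝ)) := by
      rw [Asymptotics.isLittleO_one_iff]
      have := hc.tendsto.sub_const (dslope p (τ w₀) (τ w₀))⁻¹
      rwa [sub_self] at this
    have := h3.mul_isBigO ((L.isBigO_comp (fun w => w - w₀) (𝓝 w₀)).norm_right)
    simpa using this.norm_right
  refine (h1.add h2).congr' ?_ EventuallyEq.rfl
  have hne := (ContinuousAt.comp (f := τ) hs hτ).eventually_ne hs0
  filter_upwards [hne] with w hw
  have h4 : (τ w - τ w₀) * dslope p (τ w₀) (τ w) = p (τ w) - p (τ w₀) := by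
    simpa using sub_smul_dslope p (τ w₀) (τ w)
  simp only [Function.comp] at hw ⊢
  have h5 : τ w - τ w₀ = (dslope p (τ w₀) (τ w))⁻¹ * (p (τ w) - p (τ w₀)) := by
    rw [← h4]; field_simp
  rw [h5]
  simp
  ring

/-! ### `J`-holomorphic maps into the cylinder and holomorphic functions. -/

section

variable {E : Type*} [NormedAddCommGroup E] [NormedSpace ℝ E]
  {V : Type*} [TopologicalSpace V] [ChartedSpace E V] [IsManifold 𝓘(ℝ, E) ∞ V]
  {X : CylindricalStructure E V}

namespace SimpleClosedOrbit

/-- A local lift of `f` to the strip near `w₀`. -/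
noncomputable def stripLift (γ : SimpleClosedOrbit X) (f : ℂ → ℂ) (w₀ : ℂ) (w : ℂ) : ℂ :=
  γ.period / (2 * Real.pi) * (Complex.log (f w / f w₀) + Complex.log (f w₀))

theorem exp_stripLift (γ : SimpleClosedOrbit X) {f : ℂ → ℂ} {w₀ w : ℂ} (h0 : f w₀ ≠ 0)
    (hw : f w ≠ 0) : Complex.exp (2 * Real.pi / γ.period * γ.stripLift f w₀ w) = f w := by
  have hp : (γ.period : ℂ) ≠ 0 := by exact_mod_cast γ.period_pos.ne'
  have hpi : (Real.pi : ℂ) ≠ 0 := by exact_mod_cast Real.pi_ne_zero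
  have e : 2 * Real.pi / γ.period * γ.stripLift f w₀ w
      = Complex.log (f w / f w₀) + Complex.log (f w₀) := by
    rw [stripLift]; field_simp
  rw [e, Complex.exp_add, Complex.exp_log (div_ne_zero hw h0), Complex.exp_log h0,
    div_mul_cancel₀ _ h0]

theorem stripMap_stripLift (γ : SimpleClosedOrbit X) {f : ℂ → ℂ} {w₀ w : ℂ} (h0 : f w₀ ≠ 0)
    (hw : f w ≠ 0) : γ.stripMap (γ.stripLift f w₀ w) = γ.trivialCylinder (f w) := by
  rw [← trivialCylinder_exp, exp_stripLift γ h0 hw]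

/-- Division by `f w₀` in the lift puts the argument of the logarithm near `1`, away from the branch
cut. -/
theorem continuousAt_stripLift (γ : SimpleClosedOrbit X) {f : ℂ → ℂ} {w₀ : ℂ} (h0 : f w₀ ≠ 0)
    (hf : ContinuousAt f w₀) : ContinuousAt (γ.stripLift f w₀) w₀ := by
  refine continuousAt_const.mul (ContinuousAt.add ?_ continuousAt_const)
  exact (hf.div_const _).clog (by simp [h0])

theorem analyticAt_stripLift (γ : SimpleClosedOrbit X) {f : ℂ → ℂ} {w₀ : ℂ} (h0 : f w₀ ≠ 0)
    (hf : AnalyticAt ℂ f w₀) : AnalyticAt ℂ (γ.stripLift f w₀) w₀ := by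
  refine analyticAt_const.mul (AnalyticAt.add ?_ analyticAt_const)
  exact (hf.div_const).clog (by simp [h0])

/-- The composition of a nonvanishing holomorphic function with the trivial cylinder is smooth
and `J`-holomorphic. -/
theorem holomorphic_trivialCylinder_comp (γ : SimpleClosedOrbit X) {u : ℂ → ℝ × V} {f : ℂ → ℂ}
    {w₀ : ℂ} (hf : AnalyticAt ℂ f w₀) (h0 : f w₀ ≠ 0)
    (hu : ∀ᶠ w in 𝓝 w₀, u w = γ.trivialCylinder (f w)) :
    ContMDiffAt 𝓘(ℝ, ℂ) (𝓘(ℝ, ℝ).prod 𝓘(ℝ, E)) ∞ u w₀ ∧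
    ∀ v : ℂ, mfderiv 𝓘(ℝ, ℂ) (𝓘(ℝ, ℝ).prod 𝓘(ℝ, E)) u w₀ (Complex.I * v : ℂ) =
      X.J (u w₀) (mfderiv 𝓘(ℝ, ℂ) (𝓘(ℝ, ℝ).prod 𝓘(ℝ, E)) u w₀ v) := by
  have hev : u =ᶠ[𝓝 w₀] γ.stripMap ∘ γ.stripLift f w₀ := by
    filter_upwards [hu, hf.continuousAt.eventually_ne h0] with w hw hw0
    rw [hw, Function.comp, stripMap_stripLift γ h0 hw0]
  have hΛ := γ.analyticAt_stripLift h0 hf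
  constructor
  · refine ContMDiffAt.congr_of_eventuallyEq ?_ hev
    exact γ.contMDiff_stripMap.contMDiffAt.comp w₀
      ((hΛ.contDiffAt (n := ∞)).restrict_scalars ℝ).contMDiffAt
  · have h1 : HasFDerivAt (γ.stripLift f w₀)
        ((fderiv ℂ (γ.stripLift f w₀) w₀).restrictScalars ℝ) w₀ :=
      hΛ.differentiableAt.hasFDerivAt.restrictScalars ℝ
    have h2 := ((γ.hasMFDerivAt_stripMap (γ.stripLift f w₀ w₀)).comp w₀
      h1.hasMFDerivAt).congr_of_eventuallyEq hev
    intro v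
    rw [h2.mfderiv, hev.eq_of_nhds]
    have h3 := γ.J_stripDeriv (γ.stripLift f w₀ w₀) (fderiv ℂ (γ.stripLift f w₀) w₀ v)
    refine Eq.trans ?_ h3.symm
    change γ.stripDeriv _ (fderiv ℂ (γ.stripLift f w₀) w₀ (Complex.I * v)) = _
    rw [← smul_eq_mul, map_smul, smul_eq_mul]

/-- A differentiable `J`-holomorphic map into the trivial cylinder comes from a holomorphic
function. -/
theorem differentiableAt_of_holomorphic [T2Space V] [FiniteDimensional ℝ E]
    (γ : SimpleClosedOrbit X) {u : ℂ → ℝ × V} {f : ℂ → ℂ} {w₀ : ℂ}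
    (hu : ∀ᶠ w in 𝓝 w₀, f w ≠ 0 ∧ u w = γ.trivialCylinder (f w))
    (hd : MDifferentiableAt 𝓘(ℝ, ℂ) (𝓘(ℝ, ℝ).prod 𝓘(ℝ, E)) u w₀)
    (hJ : ∀ v : ℂ, mfderiv 𝓘(ℝ, ℂ) (𝓘(ℝ, ℝ).prod 𝓘(ℝ, E)) u w₀ (Complex.I * v : ℂ) =
      X.J (u w₀) (mfderiv 𝓘(ℝ, ℂ) (𝓘(ℝ, ℝ).prod 𝓘(ℝ, E)) u w₀ v)) :
    DifferentiableAt ℂ f w₀ := by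
  have h0 := hu.self_of_nhds.1
  have hcu := hd.continuousAt
  have hp := γ.period_pos
  -- The norm of `f` is read off from the `ℝ`-component of `u`, and its phase from the
  -- `V`-component, as the orbit embeds the circle.
  have hfc : ContinuousAt f w₀ := by
    have h1 : ContinuousAt (fun w => ‖f w‖) w₀ := by
      have : ContinuousAt (fun w => Real.exp ((u w).1 * (2 * Real.pi) / γ.period)) w₀ :=
        Real.continuous_exp.continuousAt.comp ((hcu.fst.mul_const _).div_const _)
      refine this.congr ?_
      filter_upwards [hu] with w hw
      rw [hw.2, trivialCylinder_eq]
      have := Real.pi_ne_zero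
      have e : γ.period * (Real.log ‖f w‖ / (2 * Real.pi)) * (2 * Real.pi) / γ.period
        = Real.log ‖f w‖ := by field_simp
      simp only
      rw [e, Real.exp_log (norm_pos_iff.mpr hw.1)]
    have h2 : ContinuousAt (fun w => phase (f w)) w₀ := by
      rw [γ.isEmbedding_onCircle.isInducing.continuousAt_iff]
      refine hcu.snd.congr ?_
      filter_upwards [hu] with w hw
      rw [hw.2, trivialCylinder_eq]
      rfl
    have h3 : ContinuousAt (fun w => (‖f w‖ : ℂ) * (phase (f w) : ℂ)) w₀ :=
      (Complex.continuous_ofReal.continuousAt.comp h1).mul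
        (continuous_subtype_val.continuousAt.comp h2)
    simpa only [norm_mul_phase] using h3
  have hΛc := γ.continuousAt_stripLift h0 hfc
  set Λ := γ.stripLift f w₀ with hΛdef
  have hev : u =ᶠ[𝓝 w₀] γ.stripMap ∘ Λ := by
    filter_upwards [hu] with w hw
    rw [hw.2, Function.comp, stripMap_stripLift γ h0 hw.1]
  have hu1 : DifferentiableAt ℝ (fun w => (Λ w).re) w₀ := by
    have : MDifferentiableAt 𝓘(ℝ, ℂ) 𝓘(ℝ, ℝ) (fun w => (u w).1) w₀ :=
      (mdifferentiableAt_fst (I := 𝓘(ℝ, ℝ)) (I' := 𝓘(ℝ, E))).comp w₀ hd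
    refine this.differentiableAt.congr_of_eventuallyEq ?_
    filter_upwards [hev] with w hw
    rw [hw]; rfl
  have hu2 : DifferentiableAt ℝ (fun w => (Λ w).im) w₀ := by
    have hm : MDifferentiableAt 𝓘(ℝ, ℂ) 𝓘(ℝ, E) (fun w => γ.orbit (Λ w).im) w₀ := by
      have : MDifferentiableAt 𝓘(ℝ, ℂ) 𝓘(ℝ, E) (fun w => (u w).2) w₀ :=
        (mdifferentiableAt_snd (I := 𝓘(ℝ, ℝ)) (I' := 𝓘(ℝ, E))).comp w₀ hd
      refine this.congr_of_eventuallyEq ?_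
      filter_upwards [hev] with w hw
      rw [hw]; rfl
    have h1 := hm.differentiableWithinAt_writtenInExtChartAt
    have h2 := (γ.isIntegralCurve (Λ w₀).im).2
    simp only [writtenInExtChartAt, extChartAt_model_space_eq_id, PartialEquiv.refl_symm,
      PartialEquiv.refl_coe, Function.comp_id, id, modelWithCornersSelf_coe, range_id,
      differentiableWithinAt_univ] at h1 h2
    have hne : X.reebVec (γ.orbit (Λ w₀).im) ≠ 0 := γ.reeb_ne_zero _
    -- A functional that does not vanish on `R` reduces the matter to real functions: `l` of the
    -- orbit in the chart has nonzero derivative, and its composition with the imaginary part of the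
    -- lift is differentiable since `u` is.
    obtain ⟨l, -, hl⟩ := exists_dual_vector ℝ (X.reebVec (γ.orbit (Λ w₀).im))
      (norm_ne_zero_iff.mpr hne)
    have hr : l (X.reebVec (γ.orbit (Λ w₀).im)) ≠ 0 := by
      rw [hl]
      simpa using hne
    have h3 : HasFDerivAt (extChartAt 𝓘(ℝ, E) (γ.orbit (Λ w₀).im) ∘ γ.orbit)
        ((1 : ℝ →L[ℝ] ℝ).smulRight (X.reebVec (γ.orbit (Λ w₀).im))) (Λ w₀).im :=
      HasFDerivWithinAt.hasFDerivAt h2 univ_mem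
    have h2' := (l.hasFDerivAt.comp _ h3).hasDerivAt
    refine differentiableAt_of_comp (τ := fun w => (Λ w).im) h2' ?_
      (Complex.continuous_im.continuousAt.comp hΛc) (l.differentiableAt.comp w₀ h1)
    change l ((1 : ℝ) • X.reebVec (γ.orbit (Λ w₀).im)) ≠ 0
    rwa [one_smul]
  have hΛd : DifferentiableAt ℝ Λ w₀ := by
    have : DifferentiableAt ℝ (fun w => ((Λ w).re : ℂ) + ((Λ w).im : ℂ) * Complex.I) w₀ :=
      (Complex.ofRealCLM.differentiableAt.comp w₀ hu1).add
        ((Complex.ofRealCLM.differentiableAt.comp w₀ hu2).mul_const _)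
    simpa only [Complex.re_add_im] using this
  have hmf := ((γ.hasMFDerivAt_stripMap (Λ w₀)).comp w₀
    hΛd.hasFDerivAt.hasMFDerivAt).congr_of_eventuallyEq hev
  -- The differential of the covering is injective and turns `i` into `J`, so the equation for `u`
  -- becomes the Cauchy-Riemann equation for the lift.
  have hCR : fderiv ℝ Λ w₀ Complex.I = Complex.I • fderiv ℝ Λ w₀ 1 := by
    have h1 := hJ 1
    rw [hmf.mfderiv, hev.eq_of_nhds, mul_one] at h1
    apply γ.stripDeriv_injective (Λ w₀)
    exact h1.trans (γ.J_stripDeriv (Λ w₀) (fderiv ℝ Λ w₀ 1))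
  have hΛC : DifferentiableAt ℂ Λ w₀ :=
    differentiableAt_complex_iff_differentiableAt_real.mpr ⟨hΛd, hCR⟩
  refine ((hΛC.const_mul (2 * Real.pi / γ.period : ℂ)).cexp).congr_of_eventuallyEq ?_
  filter_upwards [hu] with w hw
  exact (γ.exp_stripLift h0 hw.1).symm

end SimpleClosedOrbit

end

/-! ### Directions and leading coefficients -/

namespace SphereDirection

/-- The direction determined by an affine coordinate. -/
abbrev mk (g : GL (Fin 2) ℂ) : SphereDirection := QuotientGroup.mk g

theorem mk_surjective : Function.Surjective mk := QuotientGroup.mk_surjective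

theorem point_mk (g : GL (Fin 2) ℂ) :
    (SphereDirection.mk g).point = g • ((0 : ℂ) : OnePoint ℂ) := rfl

theorem rotate_mk (ζ : Circle) (g : GL (Fin 2) ℂ) :
    (SphereDirection.mk g).rotate ζ
      = SphereDirection.mk (g * rotationMatrix ζ) := rfl

theorem mk_eq_mk_iff {g g' : GL (Fin 2) ℂ} :
    SphereDirection.mk g = SphereDirection.mk g' ↔ g⁻¹ * g' ∈ directionStabilizer :=
  QuotientGroup.eq

theorem rotationMatrix_apply (ζ : Circle) :
    rotationMatrix ζ 0 0 = ζ ∧ rotationMatrix ζ 0 1 = 0 ∧ rotationMatrix ζ 1 0 = 0 ∧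
      rotationMatrix ζ 1 1 = 1 := by
  simp [rotationMatrix, Matrix.GeneralLinearGroup.mkOfDetNeZero]

/-- Only the argument of the derivative of `d` at `0` affects the direction; its modulus is absorbed
by the stabilizer. -/
theorem mk_mul_eq_rotate {g d : GL (Fin 2) ℂ} (hd : d 0 1 = 0) :
    SphereDirection.mk (g * d)
      = (SphereDirection.mk g).rotate (phase (d 0 0 / d 1 1)) := by
  obtain ⟨h0, h1⟩ := diag_ne_zero hd
  set ζ := phase (d 0 0 / d 1 1) with hζ
  have hn : (‖d 0 0 / d 1 1‖ : ℂ) * ζ = d 0 0 / d 1 1 := norm_mul_phase _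
  rw [rotate_mk, eq_comm, mk_eq_mk_iff]
  obtain ⟨r00, r01, r10, r11⟩ := rotationMatrix_apply ζ
  have e : g * d = g * rotationMatrix ζ * ((rotationMatrix ζ)⁻¹ * d) := by group
  rw [e, inv_mul_cancel_left]
  set c := (rotationMatrix ζ)⁻¹ * d with hc
  have hdc : d = rotationMatrix ζ * c := by rw [hc]; group
  have e00 : d 0 0 = ζ * c 0 0 := by
    rw [hdc]; simp [Matrix.mul_apply, Fin.sum_univ_two, r00, r01]
  have e01 : d 0 1 = ζ * c 0 1 := by
    rw [hdc]; simp [Matrix.mul_apply, Fin.sum_univ_two, r00, r01]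
  have e11 : d 1 1 = c 1 1 := by
    rw [hdc]; simp [Matrix.mul_apply, Fin.sum_univ_two, r10, r11]
  have hζ0 : (ζ : ℂ) ≠ 0 := Circle.coe_ne_zero ζ
  refine ⟨?_, ‖d 0 0 / d 1 1‖, norm_pos_iff.mpr (div_ne_zero h0 h1), ?_⟩
  · rw [hd] at e01
    exact (mul_eq_zero.mp e01.symm).resolve_left hζ0
  · apply mul_left_cancel₀ hζ0
    rw [← e00, ← e11, ← mul_assoc, mul_comm (ζ : ℂ), hn, div_mul_cancel₀ _ h1]

theorem exists_rotate_eq {μ ν : SphereDirection} (h : μ.point = ν.point) :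
    ∃ ζ, ν = μ.rotate ζ := by
  obtain ⟨g, rfl⟩ := mk_surjective μ
  obtain ⟨g', rfl⟩ := mk_surjective ν
  obtain ⟨d, hd, rfl⟩ := exists_eq_mul_of_smul_zero_eq h
  exact ⟨_, mk_mul_eq_rotate hd⟩

@[simp]
theorem point_rotate (ζ : Circle) (μ : SphereDirection) : (μ.rotate ζ).point = μ.point := by
  obtain ⟨g, rfl⟩ := mk_surjective μ
  obtain ⟨r00, r01, r10, r11⟩ := rotationMatrix_apply ζ
  rw [rotate_mk, point_mk, point_mk, mul_smul, smul_coe_eq, colAt_zero,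
    projPoint_of_ne_zero (by simp [secondCol, r11])]
  simp [secondCol, r01]

end SphereDirection

/-- The function `h` has a positive real leading coefficient, of order `e`, in coordinates whose
positive real axis has the direction `ν`. -/
def IsPositiveAt (h : OnePoint ℂ → ℂ) (e : ℤ) (ν : SphereDirection) : Prop :=
  ∃ g : GL (Fin 2) ℂ, SphereDirection.mk g = ν ∧ ∃ r : ℝ, 0 < r ∧
    HasLeadingCoeff (fun w => h (g • (w : OnePoint ℂ))) e r

/-- Two coordinates for the same direction differ by a map with positive derivative at `0`, so
positivity in one of them implies it in all. -/
theorem IsPositiveAt.leadingCoeff {h : OnePoint ℂ → ℂ} {e : ℤ} {ν : SphereDirection}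
    (H : IsPositiveAt h e ν) {g : GL (Fin 2) ℂ} (hg : SphereDirection.mk g = ν) :
    ∃ r : ℝ, 0 < r ∧ HasLeadingCoeff (fun w => h (g • (w : OnePoint ℂ))) e r := by
  obtain ⟨g', rfl, r, hr, hl⟩ := H
  obtain ⟨d, hd⟩ : ∃ d, d = g'⁻¹ * g := ⟨_, rfl⟩
  have hg' : g = g' * d := by rw [hd]; group
  obtain ⟨h01, s, hs, h00⟩ := SphereDirection.mk_eq_mk_iff.mp hg.symm
  rw [← hd] at h01 h00
  have h11 := (diag_ne_zero h01).2
  refine ⟨r * s ^ e, by positivity, ?_⟩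
  have := hl.comp_mul h01
  rw [h00, mul_div_cancel_right₀ _ h11, ← hg'] at this
  exact_mod_cast this

/-- The rotation multiplies the leading coefficient by `ζ ^ e`, a unit complex number, which
preserves positivity only if it is `1`. -/
theorem IsPositiveAt.rotate_iff {h : OnePoint ℂ → ℂ} {e : ℤ} {ν : SphereDirection}
    (H : IsPositiveAt h e ν) (ζ : Circle) : IsPositiveAt h e (ν.rotate ζ) ↔ ζ ^ e = 1 := by
  obtain ⟨g, rfl, r, hr, hl⟩ := H
  obtain ⟨r00, r01, r10, r11⟩ := SphereDirection.rotationMatrix_apply ζ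
  have h1 := hl.comp_mul r01
  rw [r00, r11, div_one] at h1
  have hr' : (r : ℂ) ≠ 0 := by exact_mod_cast hr.ne'
  constructor
  · intro H'
    obtain ⟨s, hs, hl'⟩ := H'.leadingCoeff (SphereDirection.rotate_mk ζ g).symm
    have h2 := congrArg phase (h1.unique hl')
    rw [phase_mul hr' (zpow_ne_zero _ (Circle.coe_ne_zero ζ)), phase_ofReal hr, phase_ofReal hs,
      ← Circle.coe_zpow, phase_coe, one_mul] at h2
    exact h2
  · intro hζ
    refine ⟨_, (SphereDirection.rotate_mk ζ g).symm, r, hr, ?_⟩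
    rw [← Circle.coe_zpow, hζ, Circle.coe_one, mul_one] at h1
    exact h1

theorem Circle.exists_pow_eq (ξ : Circle) {m : ℕ} (hm : 0 < m) : ∃ ζ : Circle, ζ ^ m = ξ := by
  refine ⟨Circle.exp ((ξ : ℂ).arg / m), ?_⟩
  have hm' : (m : ℝ) ≠ 0 := by exact_mod_cast hm.ne'
  rw [← Circle.exp_natCast_mul, mul_div_cancel₀ _ hm', Circle.exp_arg]

/-! ### Asymptotics of maps into the trivial cylinder -/

theorem HasLeadingCoeff.tendsto_phase {α : Type*} {l : Filter α} {W : α → ℂ} {f : ℂ → ℂ} {e : ℤ}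
    {c : ℂ} {ξ : Circle} (hf : HasLeadingCoeff f e c) (hc : c ≠ 0) (hW : Tendsto W l (𝓝[≠] 0))
    (hξ : Tendsto (fun q => phase (W q)) l (𝓝 ξ)) :
    Tendsto (fun q => phase (f (W q))) l (𝓝 (ξ ^ e * phase c)) := by
  have h1 := (continuousAt_phase hc).tendsto.comp (Tendsto.comp hf hW)
  have h2 := (hξ.zpow e).mul h1
  refine h2.congr' ?_
  have h3 : ∀ᶠ w in 𝓝[≠] (0 : ℂ), f w * w ^ (-e) ≠ 0 := Tendsto.eventually_ne hf hc
  filter_upwards [hW.eventually h3, hW.eventually self_mem_nhdsWithin] with q hq (hq' : W q ≠ 0)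
  simp only [Function.comp]
  rw [← phase_zpow hq', ← phase_mul (zpow_ne_zero _ hq') hq, zpow_neg]
  congr 1
  have := zpow_ne_zero e hq'
  field_simp

theorem HasLeadingCoeff.eventually_eq {f : ℂ → ℂ} {e : ℤ} {c : ℂ} (hf : HasLeadingCoeff f e c)
    (hc : c ≠ 0) :
    ∀ᶠ w in 𝓝[≠] (0 : ℂ), f w ≠ 0 ∧ ‖f w‖ = ‖w‖ ^ e * ‖f w * w ^ (-e)‖ := by
  have h3 : ∀ᶠ w in 𝓝[≠] (0 : ℂ), f w * w ^ (-e) ≠ 0 := Tendsto.eventually_ne hf hc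
  filter_upwards [h3, self_mem_nhdsWithin] with w hw (hw' : w ≠ 0)
  refine ⟨left_ne_zero_of_mul hw, ?_⟩
  rw [← norm_zpow, ← norm_mul, zpow_neg]
  have := zpow_ne_zero e hw'
  congr 1
  field_simp

/-- `log ‖f w‖` is `e * log ‖w‖` plus a convergent term, so the sign of `e` decides between the two
ends of the cylinder. -/
theorem HasLeadingCoeff.tendsto_log_norm {f : ℂ → ℂ} {e : ℤ} {c : ℂ} (hf : HasLeadingCoeff f e c)
    (hc : c ≠ 0) (he : e ≠ 0) :
    Tendsto (fun w => Real.log ‖f w‖) (𝓝[≠] 0) (if e < 0 then atTop else atBot) := by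
  have h1 : Tendsto (fun w : ℂ => Real.log ‖w‖) (𝓝[≠] 0) atBot :=
    Real.tendsto_log_nhdsGT_zero.comp tendsto_norm_nhdsNE_zero
  have h2 : Tendsto (fun w : ℂ => Real.log ‖f w * w ^ (-e)‖) (𝓝[≠] 0) (𝓝 (Real.log ‖c‖)) :=
    (Tendsto.norm hf).log (norm_ne_zero_iff.mpr hc)
  have h3 : ∀ᶠ w in 𝓝[≠] (0 : ℂ),
      e * Real.log ‖w‖ + Real.log ‖f w * w ^ (-e)‖ = Real.log ‖f w‖ := by
    filter_upwards [hf.eventually_eq hc, self_mem_nhdsWithin] with w ⟨hw, hw'⟩ (hw0 : w ≠ 0)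
    have hn := norm_ne_zero_iff.mpr hw0
    have hfw := norm_ne_zero_iff.mpr hw
    rw [hw'] at hfw ⊢
    rw [Real.log_mul (zpow_ne_zero _ hn) (right_ne_zero_of_mul hfw), Real.log_zpow]
  split_ifs with h
  · refine Tendsto.congr' h3 (Tendsto.atTop_add ?_ h2)
    exact h1.const_mul_atBot_of_neg (by exact_mod_cast h)
  · refine Tendsto.congr' h3 (Tendsto.atBot_add ?_ h2)
    exact h1.const_mul_atBot (by exact_mod_cast lt_of_le_of_ne (not_lt.mp h) he.symm)

theorem tendsto_exp_pos (t₀ : ℝ) :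
    Tendsto (fun q : ℝ × ℝ => Complex.exp (-(2 * Real.pi * (q.1 + q.2 * Complex.I))))
      (atTop ×ˢ 𝓝 t₀) (𝓝[≠] 0) := by
  rw [tendsto_nhdsWithin_iff]
  refine ⟨?_, Eventually.of_forall fun q => Complex.exp_ne_zero _⟩
  rw [tendsto_zero_iff_norm_tendsto_zero]
  have : (fun q : ℝ × ℝ => ‖Complex.exp (-(2 * Real.pi * (q.1 + q.2 * Complex.I)))‖)
      = fun q => Real.exp (-(2 * Real.pi * q.1)) := by
    ext q; rw [Complex.norm_exp]; congr 1; simp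
  rw [this]
  refine Real.tendsto_exp_atBot.comp (tendsto_neg_atTop_atBot.comp ?_)
  exact tendsto_fst.const_mul_atTop Real.two_pi_pos

theorem tendsto_exp_neg (t₀ : ℝ) :
    Tendsto (fun q : ℝ × ℝ => Complex.exp (2 * Real.pi * (q.1 + q.2 * Complex.I)))
      (atBot ×ˢ 𝓝 t₀) (𝓝[≠] 0) := by
  rw [tendsto_nhdsWithin_iff]
  refine ⟨?_, Eventually.of_forall fun q => Complex.exp_ne_zero _⟩
  rw [tendsto_zero_iff_norm_tendsto_zero]
  have : (fun q : ℝ × ℝ => ‖Complex.exp (2 * Real.pi * (q.1 + q.2 * Complex.I))‖)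
      = fun q => Real.exp (2 * Real.pi * q.1) := by
    ext q; rw [Complex.norm_exp]; congr 1; simp
  rw [this]
  refine Real.tendsto_exp_atBot.comp ?_
  exact tendsto_fst.const_mul_atBot Real.two_pi_pos

theorem phase_exp (z : ℂ) : phase (Complex.exp z) = Circle.exp z.im := by
  apply Subtype.ext
  rw [coe_phase (Complex.exp_ne_zero _), Complex.norm_exp, Circle.coe_exp, Complex.ofReal_exp,
    ← Complex.exp_sub]
  congr 1
  apply Complex.ext <;> simp

theorem tendsto_phase_exp_pos (t₀ : ℝ) :
    Tendsto (fun q : ℝ × ℝ => phase (Complex.exp (-(2 * Real.pi * (q.1 + q.2 * Complex.I)))))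
      (atTop ×ˢ 𝓝 t₀) (𝓝 (Circle.exp (-(2 * Real.pi * t₀)))) := by
  have : (fun q : ℝ × ℝ => phase (Complex.exp (-(2 * Real.pi * (q.1 + q.2 * Complex.I)))))
      = fun q => Circle.exp (-(2 * Real.pi * q.2)) := by
    ext1 q; rw [phase_exp]; congr 1; simp
  rw [this]
  have h : Continuous fun t : ℝ => Circle.exp (-(2 * Real.pi * t)) :=
    Circle.exp.continuous.comp (by fun_prop)
  exact h.continuousAt.tendsto.comp tendsto_snd

theorem tendsto_phase_exp_neg (t₀ : ℝ) :
    Tendsto (fun q : ℝ × ℝ => phase (Complex.exp (2 * Real.pi * (q.1 + q.2 * Complex.I))))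
      (atBot ×ˢ 𝓝 t₀) (𝓝 (Circle.exp (2 * Real.pi * t₀))) := by
  have : (fun q : ℝ × ℝ => phase (Complex.exp (2 * Real.pi * (q.1 + q.2 * Complex.I))))
      = fun q => Circle.exp (2 * Real.pi * q.2) := by
    ext1 q; rw [phase_exp]; congr 1; simp
  rw [this]
  have h : Continuous fun t : ℝ => Circle.exp (2 * Real.pi * t) :=
    Circle.exp.continuous.comp (by fun_prop)
  exact h.continuousAt.tendsto.comp tendsto_snd

/-- A limit at infinity in cylindrical coordinates which is locally uniform in the angle gives a
limit at the puncture. -/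
theorem tendsto_nhdsNE_of_pos {α : Type*} {F : ℂ → α} {l : Filter α}
    (h : ∀ t₀ : ℝ, Tendsto (fun q : ℝ × ℝ =>
      F (Complex.exp (-(2 * Real.pi * (q.1 + q.2 * Complex.I))))) (atTop ×ˢ 𝓝 t₀) l) :
    Tendsto F (𝓝[≠] 0) l := by
  have h1 : Tendsto (fun q : ℝ × ℝ => F (Complex.exp (-(2 * Real.pi * (q.1 + q.2 * Complex.I)))))
      (atTop ×ˢ 𝓝ˢ (Icc (-1) 1)) l := by
    -- Compactness of the interval of angles makes the convergence uniform in the angle.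
    rw [isCompact_Icc.prod_nhdsSet_eq_biSup, tendsto_iSup]
    intro t
    rw [tendsto_iSup]
    exact fun _ => h t
  -- The inverse of the cylindrical coordinates. The principal argument jumps, but its values stay
  -- in the compact interval.
  have hq : Tendsto (fun w : ℂ => (-(Real.log ‖w‖ / (2 * Real.pi)), -(w.arg / (2 * Real.pi))))
      (𝓝[≠] 0) (atTop ×ˢ 𝓝ˢ (Icc (-1) 1)) := by
    refine Tendsto.prodMk ?_ ?_
    · refine tendsto_neg_atBot_atTop.comp (Tendsto.atBot_div_const Real.two_pi_pos ?_)
      exact Real.tendsto_log_nhdsGT_zero.comp tendsto_norm_nhdsNE_zero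
    · refine Tendsto.mono_right (tendsto_principal.mpr ?_) principal_le_nhdsSet
      refine Eventually.of_forall fun w => ?_
      have h1 := Complex.neg_pi_lt_arg w
      have h2 := Complex.arg_le_pi w
      have := Real.pi_pos
      constructor
      · rw [neg_le_neg_iff, div_le_one Real.two_pi_pos]; linarith
      · rw [neg_le, le_div_iff₀ Real.two_pi_pos]; linarith
  refine (h1.comp hq).congr' ?_
  filter_upwards [self_mem_nhdsWithin] with w (hw : w ≠ 0)
  simp only [Function.comp]
  congr 1
  have hpi : (Real.pi : ℂ) ≠ 0 := by exact_mod_cast Real.pi_ne_zero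
  have e : -(2 * Real.pi * (((-(Real.log ‖w‖ / (2 * Real.pi)) : ℝ) : ℂ)
      + ((-(w.arg / (2 * Real.pi)) : ℝ) : ℂ) * Complex.I)) = Complex.log w := by
    rw [Complex.log]; push_cast; field_simp; ring
  rw [e, Complex.exp_log hw]

theorem tendsto_nhdsNE_of_neg {α : Type*} {F : ℂ → α} {l : Filter α}
    (h : ∀ t₀ : ℝ, Tendsto (fun q : ℝ × ℝ =>
      F (Complex.exp (2 * Real.pi * (q.1 + q.2 * Complex.I)))) (atBot ×ˢ 𝓝 t₀) l) :
    Tendsto F (𝓝[≠] 0) l := by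
  refine tendsto_nhdsNE_of_pos fun t₀ => ?_
  have h1 : Tendsto (fun q : ℝ × ℝ => (-q.1, -q.2)) (atTop ×ˢ 𝓝 t₀) (atBot ×ˢ 𝓝 (-t₀)) :=
    (tendsto_neg_atTop_atBot.comp tendsto_fst).prodMk (tendsto_snd.neg)
  refine ((h (-t₀)).comp h1).congr fun q => ?_
  simp only [Function.comp]
  congr 2
  push_cast
  ring

/-- The singularity is removable, and the order is finite because `F` does not vanish near the
origin. -/
theorem exists_hasLeadingCoeff_of_tendsto_zero {F : ℂ → ℂ}
    (hd : ∀ᶠ w in 𝓝[≠] 0, DifferentiableAt ℂ F w) (h0 : ∀ᶠ w in 𝓝[≠] 0, F w ≠ 0)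
    (hF : Tendsto F (𝓝[≠] 0) (𝓝 0)) : ∃ (e : ℤ) (c : ℂ), c ≠ 0 ∧ HasLeadingCoeff F e c := by
  have h1 : HasLeadingCoeff F 0 0 := by simpa [HasLeadingCoeff] using hF
  obtain ⟨G, hG, -, hFG⟩ := h1.exists_analytic hd
  have hm : MeromorphicAt F 0 := by
    refine hG.meromorphicAt.congr ?_
    filter_upwards [self_mem_nhdsWithin] with w hw
    rw [hFG w hw, zpow_zero, one_mul]
  have ht := (meromorphicOrderAt_ne_top_iff_eventually_ne_zero hm).mpr h0
  obtain ⟨e, he⟩ := WithTop.ne_top_iff_exists.mp ht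
  obtain ⟨c, hc, h⟩ := exists_hasLeadingCoeff hm he.symm
  exact ⟨e, c, hc, h⟩

theorem HasLeadingCoeff.inv {f : ℂ → ℂ} {e : ℤ} {c : ℂ} (h : HasLeadingCoeff f e c) (hc : c ≠ 0) :
    HasLeadingCoeff (fun w => (f w)⁻¹) (-e) c⁻¹ := by
  refine (Tendsto.inv₀ h hc).congr fun w => ?_
  rw [mul_inv, zpow_neg, inv_inv, neg_neg]

theorem exists_hasLeadingCoeff_of_tendsto_infty {F : ℂ → ℂ}
    (hd : ∀ᶠ w in 𝓝[≠] 0, DifferentiableAt ℂ F w) (h0 : ∀ᶠ w in 𝓝[≠] 0, F w ≠ 0)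
    (hF : Tendsto (fun w => ‖F w‖) (𝓝[≠] 0) atTop) :
    ∃ (e : ℤ) (c : ℂ), c ≠ 0 ∧ HasLeadingCoeff F e c := by
  obtain ⟨e, c, hc, h⟩ := exists_hasLeadingCoeff_of_tendsto_zero (F := fun w => (F w)⁻¹)
    (by filter_upwards [hd, h0] with w hw hw0 using hw.inv hw0)
    (h0.mono fun w hw => inv_ne_zero hw)
    (by
      rw [tendsto_zero_iff_norm_tendsto_zero]
      simp only [norm_inv]
      exact hF.inv_tendsto_atTop)
  exact ⟨-e, c⁻¹, inv_ne_zero hc, by simpa using h.inv hc⟩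

/-- For `N ≠ 0` the choice `t = 1 / (2 * N)` gives `exp (π i) = -1`. -/
theorem eq_zero_of_forall_circleExp_eq {N : ℤ}
    (h : ∀ t : ℝ, Circle.exp (2 * Real.pi * t) ^ N = 1) : N = 0 := by
  by_contra hN
  have hN' : (N : ℝ) ≠ 0 := by exact_mod_cast hN
  have h1 := h (1 / (2 * N))
  rw [← Circle.exp_intCast_mul] at h1
  have e : (N : ℝ) * (2 * Real.pi * (1 / (2 * N))) = Real.pi := by field_simp
  rw [e] at h1
  have := congrArg (fun z : Circle => (z : ℂ)) h1
  simp [Circle.coe_exp, Complex.exp_pi_mul_I] at this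
  norm_num [Complex.ext_iff] at this

/-! ### Orbit curves and meromorphic functions. -/

section

variable {E : Type*} [NormedAddCommGroup E] [NormedSpace ℝ E]
  {V : Type*} [TopologicalSpace V] [ChartedSpace E V] [IsManifold 𝓘(ℝ, E) ∞ V]
  {X : CylindricalStructure E V}

namespace SimpleClosedOrbit

theorem orbit_mul_period (γ : SimpleClosedOrbit X) (m : ℕ) (t : ℝ) :
    γ.orbit (m * γ.period * t) = γ.onCircle (Circle.exp (2 * Real.pi * t) ^ (m : ℤ)) := by
  rw [← Circle.exp_intCast_mul, onCircle_exp]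
  have := Real.pi_ne_zero
  congr 1
  push_cast
  field_simp

theorem tendsto_trivialCylinder_fst (γ : SimpleClosedOrbit X) {α : Type*} {l : Filter α} {W : α → ℂ}
    {f : ℂ → ℂ} {e : ℤ} {c : ℂ} (hf : HasLeadingCoeff f e c) (hc : c ≠ 0) (he : e ≠ 0)
    (hW : Tendsto W l (𝓝[≠] 0)) :
    Tendsto (fun q => (γ.trivialCylinder (f (W q))).1) l (if e < 0 then atTop else atBot) := by
  have h := (hf.tendsto_log_norm hc he).comp hW
  have e1 : (fun q => (γ.trivialCylinder (f (W q))).1)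
      = fun q => γ.period / (2 * Real.pi) * (((fun w => Real.log ‖f w‖) ∘ W) q) := by
    ext q
    rw [trivialCylinder_eq]
    simp only [Function.comp]
    ring
  have hp : 0 < γ.period / (2 * Real.pi) := div_pos γ.period_pos Real.two_pi_pos
  rw [e1]
  split_ifs at h ⊢
  · exact h.const_mul_atTop hp
  · exact h.const_mul_atBot hp

theorem tendsto_trivialCylinder_snd (γ : SimpleClosedOrbit X) {α : Type*} {l : Filter α} {W : α → ℂ}
    {f : ℂ → ℂ} {e : ℤ} {c : ℂ} {ξ : Circle} (hf : HasLeadingCoeff f e c) (hc : c ≠ 0)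
    (hW : Tendsto W l (𝓝[≠] 0)) (hξ : Tendsto (fun q => phase (W q)) l (𝓝 ξ)) :
    Tendsto (fun q => (γ.trivialCylinder (f (W q))).2) l
      (𝓝 (γ.onCircle (ξ ^ e * phase c))) := by
  simp only [trivialCylinder_eq]
  exact γ.continuous_onCircle.continuousAt.tendsto.comp (hf.tendsto_phase hc hW hξ)

end SimpleClosedOrbit

theorem eventually_notMem_range_nhds {ι : Type*} [Finite ι] {z : ι → OnePoint ℂ}
    {g : GL (Fin 2) ℂ} {w₀ : ℂ} (h : g • (w₀ : OnePoint ℂ) ∉ range z) :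
    ∀ᶠ w : ℂ in 𝓝 w₀, g • (w : OnePoint ℂ) ∉ range z := by
  rw [← nhdsNE_sup_pure, eventually_sup, eventually_pure]
  exact ⟨eventually_notMem_range z g w₀, h⟩

theorem isJHolomorphicOn_trivialCylinder {ι : Type*} [Finite ι] (γ : SimpleClosedOrbit X)
    {z : ι → OnePoint ℂ} {h : OnePoint ℂ → ℂ} {u : OnePoint ℂ → ℝ × V}
    (ha : ∀ (g : GL (Fin 2) ℂ) (w : ℂ), g • (w : OnePoint ℂ) ∉ range z →
      AnalyticAt ℂ (fun w : ℂ => h (g • (w : OnePoint ℂ))) w)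
    (h0 : ∀ p, p ∉ range z → h p ≠ 0)
    (hu : ∀ p, p ∉ range z → u p = γ.trivialCylinder (h p)) : IsJHolomorphicOn X u (range z)ᶜ := by
  intro g
  have key := fun (w : ℂ) (hw : g • (w : OnePoint ℂ) ∉ range z) =>
    γ.holomorphic_trivialCylinder_comp (u := fun w : ℂ => u (g • (w : OnePoint ℂ))) (ha g w hw)
      (h0 _ hw) ((eventually_notMem_range_nhds hw).mono fun y hy => hu _ hy)
  exact ⟨fun w hw => (key w hw).1.contMDiffWithinAt, fun w hw => (key w hw).2⟩

namespace OrbitCurve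

variable {γ : SimpleClosedOrbit X} {np nm : ℕ} {mp : Fin np → ℕ} {mm : Fin nm → ℕ}

/-- The orbit curve given by a meromorphic function and admissible markers. -/
theorem exists_of_meromorphic [T2Space V] (hmp : ∀ k, 0 < mp k) (hmm : ∀ k, 0 < mm k)
    {ν : Fin np ⊕ Fin nm → SphereDirection} (hinj : Function.Injective fun k => (ν k).point)
    {h : OnePoint ℂ → ℂ} (H : IsMeromorphicWithDivisor mp mm (fun k => (ν k).point) h)
    (hpos : ∀ k, IsPositiveAt h (punctureOrder mp mm k) (ν k))
    {u : OnePoint ℂ → ℝ × V}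
    (hu : ∀ p, p ∉ range (fun k => (ν k).point) → u p = γ.trivialCylinder (h p)) :
    ∃ C : OrbitCurve γ mp mm, C.marker = ν ∧ C.u = u := by
  have hev : ∀ g : GL (Fin 2) ℂ, ∀ᶠ w : ℂ in 𝓝[≠] 0,
      γ.trivialCylinder (h (g • (w : OnePoint ℂ))) = u (g • (w : OnePoint ℂ)) := fun g =>
    (eventually_notMem_range _ g 0).mono fun w hw => (hu _ hw).symm
  refine ⟨⟨ν, hinj, u, isJHolomorphicOn_trivialCylinder γ H.analyticAt (fun _ => H.ne_zero) hu,
    fun w hw => ?_, fun k g hg t₀ => ?_, fun k g hg t₀ => ?_⟩, rfl, rfl⟩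
  · rw [hu w hw]; exact γ.trivialCylinder_snd_mem _
  · obtain ⟨r, hr, hl⟩ := (hpos (Sum.inl k)).leadingCoeff hg
    have hr' : (r : ℂ) ≠ 0 := by exact_mod_cast hr.ne'
    have hW := tendsto_exp_pos t₀
    have he : punctureOrder mp mm (Sum.inl k) < 0 := by
      have := hmp k; simp [punctureOrder]; omega
    constructor
    · have := γ.tendsto_trivialCylinder_fst hl hr' he.ne hW
      rw [if_pos he] at this
      exact this.congr' ((hW.eventually (hev g)).mono fun q hq => by rw [hq])
    · have := γ.tendsto_trivialCylinder_snd hl hr' hW (tendsto_phase_exp_pos t₀)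
      rw [phase_ofReal hr, mul_one, Circle.exp_neg, punctureOrder, Sum.elim_inl, inv_zpow, zpow_neg,
        inv_inv, ← γ.orbit_mul_period] at this
      exact this.congr' ((hW.eventually (hev g)).mono fun q hq => by rw [hq])
  · obtain ⟨r, hr, hl⟩ := (hpos (Sum.inr k)).leadingCoeff hg
    have hr' : (r : ℂ) ≠ 0 := by exact_mod_cast hr.ne'
    have hW := tendsto_exp_neg t₀
    have he : 0 < punctureOrder mp mm (Sum.inr k) := by
      have := hmm k; simp [punctureOrder]; omega
    constructor
    · have := γ.tendsto_trivialCylinder_fst hl hr' he.ne' hW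
      rw [if_neg he.not_gt] at this
      exact this.congr' ((hW.eventually (hev g)).mono fun q hq => by rw [hq])
    · have := γ.tendsto_trivialCylinder_snd hl hr' hW (tendsto_phase_exp_neg t₀)
      rw [phase_ofReal hr, mul_one, punctureOrder, Sum.elim_inr, ← γ.orbit_mul_period] at this
      exact this.congr' ((hW.eventually (hev g)).mono fun q hq => by rw [hq])

/-- The asymptotics make `‖h‖` tend to infinity or zero at a puncture, so `h` has some leading term
there. Comparison of phases along every ray fixes its order and the phase of its coefficient. -/
theorem exists_meromorphic [T2Space V] [FiniteDimensional ℝ E]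
    (hmp : ∀ k, 0 < mp k) (hmm : ∀ k, 0 < mm k) (C : OrbitCurve γ mp mm) :
    ∃ h : OnePoint ℂ → ℂ, IsMeromorphicWithDivisor mp mm C.domain.1 h ∧
      (∀ p, p ∉ range C.domain.1 → C.u p = γ.trivialCylinder (h p)) ∧
      ∀ k, IsPositiveAt h (punctureOrder mp mm k) (C.marker k) := by
  classical
  -- The value at the punctures is set to the conventional `0`, which the normal form demands at
  -- zeros and poles.
  have hex : ∀ p, ∃ a : ℂ, (p ∈ range C.domain.1 → a = 0) ∧
      (p ∉ range C.domain.1 → a ≠ 0 ∧ C.u p = γ.trivialCylinder a) := by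
    intro p
    by_cases hp : p ∈ range C.domain.1
    · exact ⟨0, fun _ => rfl, fun h => absurd hp h⟩
    · obtain ⟨a, ha, h⟩ := γ.trivialCylinder_surjOn (C.mem_cylinder p hp)
      exact ⟨a, fun h => absurd h hp, fun _ => ⟨ha, h.symm⟩⟩
  choose h hz hnz using hex
  have hu : ∀ p, p ∉ range C.domain.1 → C.u p = γ.trivialCylinder (h p) := fun p hp => (hnz p hp).2
  have hdiff : ∀ (g : GL (Fin 2) ℂ) (w : ℂ), g • (w : OnePoint ℂ) ∉ range C.domain.1 →
      DifferentiableAt ℂ (fun w : ℂ => h (g • (w : OnePoint ℂ))) w := by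
    intro g w hw
    have hev := eventually_notMem_range_nhds hw
    obtain ⟨h1, h2⟩ := C.holomorphic g
    refine γ.differentiableAt_of_holomorphic (u := fun w : ℂ => C.u (g • (w : OnePoint ℂ)))
      (hev.mono fun y hy => hnz _ hy) ?_ (h2 w hw)
    exact (h1.contMDiffAt hev).mdifferentiableAt (by simp)
  have hd : ∀ g : GL (Fin 2) ℂ, ∀ᶠ w : ℂ in 𝓝[≠] 0,
      DifferentiableAt ℂ (fun w : ℂ => h (g • (w : OnePoint ℂ))) w := fun g =>
    (eventually_notMem_range C.domain.1 g 0).mono fun w hw => hdiff g w hw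
  have hn0 : ∀ g : GL (Fin 2) ℂ, ∀ᶠ w : ℂ in 𝓝[≠] 0, h (g • (w : OnePoint ℂ)) ≠ 0 := fun g =>
    (eventually_notMem_range C.domain.1 g 0).mono fun w hw => (hnz _ hw).1
  have hev : ∀ g : GL (Fin 2) ℂ, ∀ᶠ w : ℂ in 𝓝[≠] 0,
      C.u (g • (w : OnePoint ℂ)) = γ.trivialCylinder (h (g • (w : OnePoint ℂ))) := fun g =>
    (eventually_notMem_range _ g 0).mono fun w hw => hu _ hw
  have hnorm : ∀ g : GL (Fin 2) ℂ, ∀ᶠ w : ℂ in 𝓝[≠] 0,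
      Real.exp ((C.u (g • (w : OnePoint ℂ))).1 * (2 * Real.pi / γ.period))
        = ‖h (g • (w : OnePoint ℂ))‖ := by
    intro g
    filter_upwards [hev g, hn0 g] with w hw hw0
    have hp := γ.period_pos.ne'
    have := Real.pi_ne_zero
    rw [hw, γ.trivialCylinder_eq]
    have e : γ.period * (Real.log ‖h (g • (w : OnePoint ℂ))‖ / (2 * Real.pi))
        * (2 * Real.pi / γ.period) = Real.log ‖h (g • (w : OnePoint ℂ))‖ := by field_simp
    simp only
    rw [e, Real.exp_log (norm_pos_iff.mpr hw0)]
  have hcoef : 0 < 2 * Real.pi / γ.period := div_pos Real.two_pi_pos γ.period_pos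
  have hpos : ∀ k, IsPositiveAt h (punctureOrder mp mm k) (C.marker k) := by
    rintro (k | k)
    · obtain ⟨g, hg⟩ := SphereDirection.mk_surjective (C.marker (Sum.inl k))
      have has := C.asymptotic_pos k g hg
      have hlim := tendsto_nhdsNE_of_pos
        (F := fun w : ℂ => (C.u (g • (w : OnePoint ℂ))).1) fun t₀ => (has t₀).1
      have hinf : Tendsto (fun w : ℂ => ‖h (g • (w : OnePoint ℂ))‖) (𝓝[≠] 0) atTop :=
        (Real.tendsto_exp_atTop.comp (hlim.atTop_mul_const hcoef)).congr' (hnorm g)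
      obtain ⟨e, c, hc, hl⟩ := exists_hasLeadingCoeff_of_tendsto_infty (hd g) (hn0 g) hinf
      -- Two limits of the `V`-component along the angle `t₀`: one from the leading term, one from
      -- the asymptotic condition. At `t₀ = 0`, the marker, they give `phase c = 1`; then all `t₀`
      -- together give the exponent.
      have hphase : ∀ t₀ : ℝ, Circle.exp (2 * Real.pi * t₀) ^ (-e) * phase c
          = Circle.exp (2 * Real.pi * t₀) ^ (mp k : ℤ) := by
        intro t₀
        have hW := tendsto_exp_pos t₀
        have h1 := γ.tendsto_trivialCylinder_snd hl hc hW (tendsto_phase_exp_pos t₀)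
        have h2 := (has t₀).2.congr' ((hW.eventually (hev g)).mono fun q hq => by rw [hq])
        have h3 := tendsto_nhds_unique h1 h2
        rw [γ.orbit_mul_period, Circle.exp_neg, inv_zpow, ← zpow_neg] at h3
        exact γ.onCircle_injective h3
      have hc1 : phase c = 1 := by simpa using hphase 0
      have he : e = punctureOrder mp mm (Sum.inl k) := by
        have : -e - mp k = 0 := eq_zero_of_forall_circleExp_eq fun t => by
          have := hphase t
          rw [hc1, mul_one] at this
          rw [zpow_sub, this, mul_inv_cancel]
        simp only [punctureOrder, Sum.elim_inl]
        omega
      obtain ⟨r, hr, rfl⟩ := (phase_eq_one_iff hc).mp hc1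
      exact ⟨g, hg, r, hr, he ▸ hl⟩
    · obtain ⟨g, hg⟩ := SphereDirection.mk_surjective (C.marker (Sum.inr k))
      have has := C.asymptotic_neg k g hg
      have hlim := tendsto_nhdsNE_of_neg
        (F := fun w : ℂ => (C.u (g • (w : OnePoint ℂ))).1) fun t₀ => (has t₀).1
      have hinf : Tendsto (fun w : ℂ => h (g • (w : OnePoint ℂ))) (𝓝[≠] 0) (𝓝 0) := by
        rw [tendsto_zero_iff_norm_tendsto_zero]
        exact (Real.tendsto_exp_atBot.comp (hlim.atBot_mul_const hcoef)).congr' (hnorm g)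
      obtain ⟨e, c, hc, hl⟩ := exists_hasLeadingCoeff_of_tendsto_zero (hd g) (hn0 g) hinf
      have hphase : ∀ t₀ : ℝ, Circle.exp (2 * Real.pi * t₀) ^ e * phase c
          = Circle.exp (2 * Real.pi * t₀) ^ (mm k : ℤ) := by
        intro t₀
        have hW := tendsto_exp_neg t₀
        have h1 := γ.tendsto_trivialCylinder_snd hl hc hW (tendsto_phase_exp_neg t₀)
        have h2 := (has t₀).2.congr' ((hW.eventually (hev g)).mono fun q hq => by rw [hq])
        have h3 := tendsto_nhds_unique h1 h2
        rw [γ.orbit_mul_period] at h3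
        exact γ.onCircle_injective h3
      have hc1 : phase c = 1 := by simpa using hphase 0
      have he : e = punctureOrder mp mm (Sum.inr k) := by
        have : e - mm k = 0 := eq_zero_of_forall_circleExp_eq fun t => by
          have := hphase t
          rw [hc1, mul_one] at this
          rw [zpow_sub, this, mul_inv_cancel]
        simp only [punctureOrder, Sum.elim_inr]
        omega
      obtain ⟨r, hr, rfl⟩ := (phase_eq_one_iff hc).mp hc1
      exact ⟨g, hg, r, hr, he ▸ hl⟩
  refine ⟨h, isMeromorphicWithDivisor_of_leadingCoeff hmp hmm C.domain.2 hdiff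
    (fun p hp => (hnz p hp).1) (fun k => hz _ ⟨k, rfl⟩) fun k => ?_, hu, hpos⟩
  obtain ⟨g, hg, r, hr, hl⟩ := hpos k
  refine ⟨g, ?_, r, by exact_mod_cast hr.ne', hl⟩
  rw [← SphereDirection.point_mk, hg]
  rfl

end OrbitCurve

theorem IsMeromorphicWithDivisor.eq_of_trivialCylinder_eq {np nm : ℕ} {mp : Fin np → ℕ}
    {mm : Fin nm → ℕ} (hmp : ∀ k, 0 < mp k) (hmm : ∀ k, 0 < mm k) (γ : SimpleClosedOrbit X)
    {z : Fin np ⊕ Fin nm → OnePoint ℂ} (hz : Function.Injective z) {h h' : OnePoint ℂ → ℂ}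
    (H : IsMeromorphicWithDivisor mp mm z h) (H' : IsMeromorphicWithDivisor mp mm z h')
    (hu : ∀ p, p ∉ range z → γ.trivialCylinder (h p) = γ.trivialCylinder (h' p)) : h = h' := by
  ext p
  by_cases hp : p ∈ range z
  · obtain ⟨k, rfl⟩ := hp
    rw [H.eq_zero hmp hmm hz, H'.eq_zero hmp hmm hz]
  · exact γ.trivialCylinder_injOn (H.ne_zero hp) (H'.ne_zero hp) (hu p hp)

theorem zpow_punctureOrder_eq_one_iff {np nm : ℕ} (mp : Fin np → ℕ) (mm : Fin nm → ℕ)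
    (k : Fin np ⊕ Fin nm) (ζ : Circle) :
    ζ ^ punctureOrder mp mm k = 1 ↔ ζ ^ (Sum.elim mp mm k) = 1 := by
  rcases k with k | k <;> simp [punctureOrder]

theorem exists_zpow_punctureOrder_eq {np nm : ℕ} {mp : Fin np → ℕ} {mm : Fin nm → ℕ}
    (hmp : ∀ k, 0 < mp k) (hmm : ∀ k, 0 < mm k) (k : Fin np ⊕ Fin nm) (ξ : Circle) :
    ∃ ζ : Circle, ζ ^ punctureOrder mp mm k = ξ := by
  rcases k with k | k
  · obtain ⟨ζ, hζ⟩ := Circle.exists_pow_eq ξ⁻¹ (hmp k)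
    exact ⟨ζ, by simp [punctureOrder, hζ]⟩
  · obtain ⟨ζ, hζ⟩ := Circle.exists_pow_eq ξ (hmm k)
    exact ⟨ζ, by simp [punctureOrder, hζ]⟩

/-- Starting from any direction at the puncture, a rotation by an `e`-th root of the inverse phase
makes the leading coefficient positive. -/
theorem IsMeromorphicWithDivisor.exists_positive {np nm : ℕ} {mp : Fin np → ℕ}
    {mm : Fin nm → ℕ} (hmp : ∀ k, 0 < mp k) (hmm : ∀ k, 0 < mm k)
    {z : Fin np ⊕ Fin nm → OnePoint ℂ} (hz : Function.Injective z) {h : OnePoint ℂ → ℂ}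
    (H : IsMeromorphicWithDivisor mp mm z h) (k : Fin np ⊕ Fin nm) :
    ∃ ν : SphereDirection, ν.point = z k ∧ IsPositiveAt h (punctureOrder mp mm k) ν := by
  obtain ⟨g, hg⟩ := exists_smul_zero_eq (z k)
  obtain ⟨c, hc, hl⟩ := H.exists_leadingCoeff hz hg
  obtain ⟨ζ, hζ⟩ := exists_zpow_punctureOrder_eq hmp hmm k (phase c)⁻¹
  obtain ⟨r00, r01, r10, r11⟩ := SphereDirection.rotationMatrix_apply ζ
  refine ⟨(SphereDirection.mk g).rotate ζ, by rw [SphereDirection.point_rotate]; exact hg, _,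
    (SphereDirection.rotate_mk ζ g).symm, ‖c‖, norm_pos_iff.mpr hc, ?_⟩
  have h1 := hl.comp_mul r01
  rw [r00, r11, div_one, ← Circle.coe_zpow, hζ] at h1
  have e : c * ((phase c)⁻¹ : Circle) = (‖c‖ : ℂ) := by
    nth_rw 1 [← norm_mul_phase c]
    rw [mul_assoc, ← Circle.coe_mul, mul_inv_cancel, Circle.coe_one, mul_one]
  rwa [e] at h1

/-- The maps underlying orbit curves are the meromorphic functions with the given divisor. -/
theorem exists_orbitCurve_iff [T2Space V] [FiniteDimensional ℝ E] {np nm : ℕ} {mp : Fin np → ℕ}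
    {mm : Fin nm → ℕ} (γ : SimpleClosedOrbit X) (hmp : ∀ k, 0 < mp k) (hmm : ∀ k, 0 < mm k)
    (z : PuncturedSphere (Fin np ⊕ Fin nm)) (u : OnePoint ℂ → ℝ × V) :
    (∃ C : OrbitCurve γ mp mm, C.domain = z ∧ C.u = u) ↔
      ∃! h : OnePoint ℂ → ℂ, IsMeromorphicWithDivisor mp mm z.1 h ∧
        ∀ w, w ∉ range z.1 → u w = γ.trivialCylinder (h w) := by
  constructor
  · rintro ⟨C, rfl, rfl⟩
    obtain ⟨h, H, hu, -⟩ := C.exists_meromorphic hmp hmm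
    refine ⟨h, ⟨H, hu⟩, fun h' ⟨H', hu'⟩ => ?_⟩
    exact H'.eq_of_trivialCylinder_eq hmp hmm γ C.domain.2 H fun p hp => by
      rw [← hu p hp, ← hu' p hp]
  · rintro ⟨h, ⟨H, hu⟩, -⟩
    choose ν hν hpos using H.exists_positive hmp hmm z.2
    have hν' : (fun k => (ν k).point) = z.1 := funext hν
    obtain ⟨C, hC, hCu⟩ := OrbitCurve.exists_of_meromorphic (γ := γ) hmp hmm (ν := ν)
      (by rw [hν']; exact z.2) (by rw [hν']; exact H) hpos (u := u) (by rw [hν']; exact hu)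
    refine ⟨C, Subtype.ext ?_, hCu⟩
    rw [← hν', ← hC]
    rfl

/-- The markers of an orbit curve can be rotated exactly by the roots of unity. -/
theorem exists_orbitCurve_marker_iff [T2Space V] [FiniteDimensional ℝ E] {np nm : ℕ}
    {mp : Fin np → ℕ} {mm : Fin nm → ℕ} {γ : SimpleClosedOrbit X} (hmp : ∀ k, 0 < mp k)
    (hmm : ∀ k, 0 < mm k) (C : OrbitCurve γ mp mm) (ν : Fin np ⊕ Fin nm → SphereDirection) :
    (∃ C' : OrbitCurve γ mp mm, C'.domain = C.domain ∧ C'.u = C.u ∧ C'.marker = ν) ↔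
      ∀ k, ∃ ζ : Circle, ζ ^ (Sum.elim mp mm k) = 1 ∧ ν k = (C.marker k).rotate ζ := by
  obtain ⟨h, H, hu, hpos⟩ := C.exists_meromorphic hmp hmm
  constructor
  · rintro ⟨C', hd, hCu, rfl⟩ k
    obtain ⟨h', H', hu', hpos'⟩ := C'.exists_meromorphic hmp hmm
    rw [hd] at H' hu'
    -- Both curves have the same function, so both markers are positive directions of it.
    obtain rfl := H'.eq_of_trivialCylinder_eq hmp hmm γ C.domain.2 H fun p hp => by
      rw [← hu p hp, ← hu' p hp, hCu]
    have hpt : (C.marker k).point = (C'.marker k).point :=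
      (congrFun (congrArg Subtype.val hd) k).symm
    obtain ⟨ζ, hζ⟩ := SphereDirection.exists_rotate_eq hpt
    refine ⟨ζ, ?_, hζ⟩
    rw [← zpow_punctureOrder_eq_one_iff, ← (hpos k).rotate_iff, ← hζ]
    exact hpos' k
  · intro hν
    have hpt : (fun k => (ν k).point) = C.domain.1 := by
      ext1 k
      obtain ⟨ζ, -, hζ⟩ := hν k
      rw [hζ, SphereDirection.point_rotate]
      rfl
    obtain ⟨C', hC', hCu⟩ := OrbitCurve.exists_of_meromorphic (γ := γ) hmp hmm (ν := ν)
      (by rw [hpt]; exact C.domain.2) (by rw [hpt]; exact H) (fun k => by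
        obtain ⟨ζ, h1, hζ⟩ := hν k
        rw [hζ, (hpos k).rotate_iff, zpow_punctureOrder_eq_one_iff, h1])
      (u := C.u) (by rw [hpt]; exact hu)
    refine ⟨C', Subtype.ext ?_, hCu, hC'⟩
    rw [← hpt, ← hC']
    rfl

end

/-! ### Invariants of tuples of directions -/

section Invariants

variable {ι : Type*}

/-- A choice, for each label, of two further labels. -/
structure LabelFrame (ι : Type*) where
  fst : ι → ι
  snd : ι → ι
  fst_ne : ∀ k, fst k ≠ k
  snd_ne : ∀ k, snd k ≠ k
  fst_ne_snd : ∀ k, fst k ≠ snd k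

theorem nonempty_labelFrame [Fintype ι] (h : 3 ≤ Fintype.card ι) : Nonempty (LabelFrame ι) := by
  classical
  have key : ∀ k : ι, ∃ a b : ι, a ≠ k ∧ b ≠ k ∧ a ≠ b := by
    intro k
    have h1 : 1 < (Finset.univ.erase k).card := by
      rw [Finset.card_erase_of_mem (Finset.mem_univ k), Finset.card_univ]; omega
    obtain ⟨a, ha, b, hb, hab⟩ := Finset.one_lt_card.mp h1
    exact ⟨a, b, Finset.ne_of_mem_erase ha, Finset.ne_of_mem_erase hb, hab⟩
  choose a b ha hb hab using key
  exact ⟨⟨a, b, ha, hb, hab⟩⟩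

/-- Pairwise independent vectors. -/
def PairwiseIndependent (v : ι → Fin 2 → ℂ) : Prop := ∀ i j, i ≠ j → bracket (v i) (v j) ≠ 0

theorem pairwiseIndependent_of_injective {v : ι → Fin 2 → ℂ} (hv : ∀ k, v k ≠ 0)
    (hinj : Function.Injective fun k => projPoint (v k)) : PairwiseIndependent v :=
  fun i j hij => bracket_ne_zero_of_projPoint_ne (hv i) (hv j) (hinj.ne hij)

namespace LabelFrame

variable (F : LabelFrame ι)

/-- The normalizing factor of the frame at a label, homogeneous of degree two in the vector with
that label and of degree zero in the others. -/
noncomputable def scale (v : ι → Fin 2 → ℂ) (k : ι) : ℂ :=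
  bracket (v (F.snd k)) (v k) * bracket (v (F.fst k)) (v k) / bracket (v (F.fst k)) (v (F.snd k))

/-- The product of the brackets of a vector with the others, normalized by the frame. -/
noncomputable def lead [Fintype ι] [DecidableEq ι] (e : ι → ℤ) (v : ι → Fin 2 → ℂ) (k : ι) : ℂ :=
  ∏ j, (if j = k then F.scale v k else bracket (v k) (v j)) ^ e j

/-- The derivative of an affine coordinate at a label, relative to the frame. -/
noncomputable def ratio (g : ι → GL (Fin 2) ℂ) (k : ι) : ℂ :=
  (g k).1.det / F.scale (fun j => secondCol (g j)) k

variable {F} {v v' : ι → Fin 2 → ℂ}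

theorem scale_ne_zero (hv : PairwiseIndependent v) (k : ι) : F.scale v k ≠ 0 :=
  div_ne_zero (mul_ne_zero (hv _ _ (F.snd_ne k)) (hv _ _ (F.fst_ne k)))
    (hv _ _ (F.fst_ne_snd k))

theorem lead_ne_zero [Fintype ι] [DecidableEq ι] (e : ι → ℤ) (hv : PairwiseIndependent v) (k : ι) :
    F.lead e v k ≠ 0 := by
  refine Finset.prod_ne_zero_iff.mpr fun j _ => zpow_ne_zero _ ?_
  split_ifs with h
  · exact scale_ne_zero hv k
  · exact hv k j (Ne.symm h)

theorem ratio_ne_zero {g : ι → GL (Fin 2) ℂ} (hg : PairwiseIndependent fun j => secondCol (g j))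
    (k : ι) : F.ratio g k ≠ 0 :=
  div_ne_zero (g k).det_ne_zero (scale_ne_zero hg k)

theorem bracket_transform {A : Matrix (Fin 2) (Fin 2) ℂ} {a : ι → ℂ}
    (h : ∀ k, v' k = a k • A.mulVec (v k)) (i j : ι) :
    bracket (v' i) (v' j) = a i * a j * A.det * bracket (v i) (v j) := by
  rw [h, h, bracket_smul_left, bracket_smul_right, bracket_mulVec]; ring

/-- The factors belonging to the two auxiliary labels occur once above and once below the fraction
line and cancel. -/
theorem scale_transform (hv : PairwiseIndependent v) {A : GL (Fin 2) ℂ} {a : ι → ℂ}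
    (ha : ∀ k, a k ≠ 0) (h : ∀ k, v' k = a k • A.1.mulVec (v k)) (k : ι) :
    F.scale v' k = a k * a k * A.1.det * F.scale v k := by
  simp only [scale, bracket_transform h]
  have h1 := hv _ _ (F.fst_ne_snd k)
  have h2 := ha (F.fst k)
  have h3 := ha (F.snd k)
  have h4 : A.1.det ≠ 0 := A.det_ne_zero
  field_simp

/-- Each factor acquires `a k * det A * a j`, also for `j = k` by the weight of `scale`. The part `a
k * det A` disappears since the exponents sum to zero, and what remains does not depend on `k`:
ratios of leading coefficients are invariants of the configuration. -/
theorem lead_transform [Fintype ι] [DecidableEq ι] {e : ι → ℤ} (he : ∑ k, e k = 0)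
    (hv : PairwiseIndependent v) {A : GL (Fin 2) ℂ} {a : ι → ℂ}
    (ha : ∀ k, a k ≠ 0) (h : ∀ k, v' k = a k • A.1.mulVec (v k)) (k : ι) :
    F.lead e v' k = (∏ j, a j ^ e j) * F.lead e v k := by
  have h4 : A.1.det ≠ 0 := A.det_ne_zero
  have e1 : ∀ j, (if j = k then F.scale v' k else bracket (v' k) (v' j)) ^ e j
      = (a k * A.1.det) ^ e j * (a j ^ e j *
        (if j = k then F.scale v k else bracket (v k) (v j)) ^ e j) := by
    intro j
    rw [← mul_zpow, ← mul_zpow]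
    congr 1
    split_ifs with hj
    · rw [scale_transform hv ha h, hj]; ring
    · rw [bracket_transform h]; ring
  simp only [lead, e1, Finset.prod_mul_distrib]
  rw [prod_zpow_eq_zpow_sum (mul_ne_zero (ha k) h4), he, zpow_zero, one_mul]

theorem secondCol_mul_of_apply_eq_zero (A g : GL (Fin 2) ℂ) {d : GL (Fin 2) ℂ} (hd : d 0 1 = 0) :
    secondCol (A * g * d) = d 1 1 • A.1.mulVec (secondCol g) := by
  rw [← secondCol_mul]
  ext i
  simp [secondCol, Matrix.mul_apply, Fin.sum_univ_two, hd]
  ring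

/-- An automorphism cancels between determinant and `scale`, while a coordinate change at `k`
contributes its derivative at `0`. Therefore the phase of `ratio` is an invariant angle. -/
theorem ratio_transform {g : ι → GL (Fin 2) ℂ}
    (hg : PairwiseIndependent fun j => secondCol (g j)) (A : GL (Fin 2) ℂ)
    {d : ι → GL (Fin 2) ℂ} (hd : ∀ k, d k 0 1 = 0) (k : ι) :
    F.ratio (fun j => A * g j * d j) k = F.ratio g k * (d k 0 0 / d k 1 1) := by
  have h1 : ∀ k, d k 1 1 ≠ 0 := fun k => (diag_ne_zero (hd k)).2
  have h2 := scale_transform (F := F) hg (A := A) h1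
    (v' := fun j => secondCol (A * g j * d j)) (fun j => secondCol_mul_of_apply_eq_zero A (g j) (hd j))
  have h3 := scale_ne_zero (F := F) hg k
  have h4 : A.1.det ≠ 0 := A.det_ne_zero
  have h5 := h1 k
  have h6 : (A * g k * d k).1.det = A.1.det * (g k).1.det * (d k 0 0 * d k 1 1) := by
    have : (d k).1.det = d k 0 0 * d k 1 1 := by
      rw [Matrix.det_fin_two, hd]; ring
    rw [← this, ← Matrix.det_mul, ← Matrix.det_mul]
    rfl
  rw [ratio, ratio, h2, h6]
  field_simp

end LabelFrame

/-! ### Angles of directions -/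

namespace LabelFrame

variable (F : LabelFrame ι)

/-- The angle of a direction in the coordinates given by two further points. -/
noncomputable def angle (ν : ι → SphereDirection) (k : ι) : Circle :=
  phase (F.ratio (fun j => Quotient.out (ν j)) k)

variable {F}

theorem pairwiseIndependent_secondCol {g : ι → GL (Fin 2) ℂ} {ν : ι → SphereDirection}
    (hinj : Function.Injective fun k => (ν k).point) (hg : ∀ k, SphereDirection.mk (g k) = ν k) :
    PairwiseIndependent fun j => secondCol (g j) := by
  refine pairwiseIndependent_of_injective (fun k => secondCol_ne_zero _) ?_
  have : (fun k => projPoint (secondCol (g k))) = fun k => (ν k).point := by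
    ext1 k
    rw [← hg, SphereDirection.point_mk, smul_zero_eq]
  rwa [this]

theorem phase_ratio_transform {g : ι → GL (Fin 2) ℂ}
    (hg : PairwiseIndependent fun j => secondCol (g j)) (A : GL (Fin 2) ℂ)
    {d : ι → GL (Fin 2) ℂ} (hd : ∀ k, d k 0 1 = 0) (k : ι) :
    phase (F.ratio (fun j => A * g j * d j) k)
      = phase (F.ratio g k) * phase (d k 0 0 / d k 1 1) := by
  have h1 := diag_ne_zero (hd k)
  rw [ratio_transform hg A hd, phase_mul (ratio_ne_zero hg k) (div_ne_zero h1.1 h1.2)]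

/-- Other representatives of the directions differ by elements of the stabilizer, whose derivatives
at `0` are positive and have phase `1`. -/
theorem angle_eq {g : ι → GL (Fin 2) ℂ} {ν : ι → SphereDirection}
    (hinj : Function.Injective fun k => (ν k).point) (hg : ∀ k, SphereDirection.mk (g k) = ν k)
    (k : ι) : F.angle ν k = phase (F.ratio g k) := by
  have hout : ∀ j, SphereDirection.mk (Quotient.out (ν j)) = ν j := fun j => Quotient.out_eq (ν j)
  have hmem : ∀ j, (g j)⁻¹ * Quotient.out (ν j) ∈ directionStabilizer := fun j =>
    SphereDirection.mk_eq_mk_iff.mp ((hg j).trans (hout j).symm)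
  have e : (fun j => Quotient.out (ν j)) = fun j => 1 * g j * ((g j)⁻¹ * Quotient.out (ν j)) := by
    ext1 j; group
  rw [angle, e, phase_ratio_transform (pairwiseIndependent_secondCol hinj hg) 1
    (fun j => (hmem j).1)]
  obtain ⟨h01, r, hr, h00⟩ := hmem k
  rw [h00, mul_div_cancel_right₀ _ (diag_ne_zero h01).2, phase_ofReal hr, mul_one]

theorem angle_rotate {ν : ι → SphereDirection} (hinj : Function.Injective fun k => (ν k).point)
    (ζ : ι → Circle) (k : ι) :
    F.angle (fun j => (ν j).rotate (ζ j)) k = F.angle ν k * ζ k := by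
  choose g hg using fun j => SphereDirection.mk_surjective (ν j)
  have h := fun j => SphereDirection.rotationMatrix_apply (ζ j)
  rw [angle_eq hinj hg, angle_eq (g := fun j => 1 * g j * SphereDirection.rotationMatrix (ζ j))
    (by simpa only [SphereDirection.point_rotate] using hinj)
    (fun j => by rw [one_mul, ← SphereDirection.rotate_mk, hg]),
    phase_ratio_transform (pairwiseIndependent_secondCol hinj hg) 1 (fun j => (h j).2.1),
    (h k).1, (h k).2.2.2, div_one, phase_coe]

theorem injective_point_smul {ν : ι → SphereDirection}
    (hinj : Function.Injective fun k => (ν k).point) (A : GL (Fin 2) ℂ) :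
    Function.Injective fun k => (A • ν k).point := by
  simp only [SphereDirection.point_smul]
  exact (MulAction.injective A).comp hinj

theorem angle_smul {ν : ι → SphereDirection} (hinj : Function.Injective fun k => (ν k).point)
    (A : GL (Fin 2) ℂ) (k : ι) : F.angle (fun j => A • ν j) k = F.angle ν k := by
  choose g hg using fun j => SphereDirection.mk_surjective (ν j)
  rw [angle_eq hinj hg, angle_eq (g := fun j => A * g j * 1) (injective_point_smul hinj A)
    (fun j => by rw [mul_one, ← hg]; rfl),
    phase_ratio_transform (d := fun _ => 1) (pairwiseIndependent_secondCol hinj hg) A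
      (fun j => by simp)]
  simp

theorem eq_of_angle_eq {ν ν' : ι → SphereDirection}
    (hinj : Function.Injective fun k => (ν k).point) (hpt : ∀ k, (ν k).point = (ν' k).point)
    (h : ∀ k, F.angle ν k = F.angle ν' k) : ν = ν' := by
  choose ζ hζ using fun k => SphereDirection.exists_rotate_eq (hpt k)
  have e : ν' = fun k => (ν k).rotate (ζ k) := funext hζ
  ext1 k
  have h1 := h k
  rw [e, angle_rotate hinj, left_eq_mul] at h1
  obtain ⟨g, hg⟩ := SphereDirection.mk_surjective (ν k)
  rw [hζ k, h1, ← hg, SphereDirection.rotate_mk]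
  congr 1
  have : SphereDirection.rotationMatrix 1 = 1 := by
    ext i j
    fin_cases i <;> fin_cases j <;>
      simp [SphereDirection.rotationMatrix, Matrix.GeneralLinearGroup.mkOfDetNeZero]
  rw [this, mul_one]

/-- The phase of the leading coefficient at a direction of the product of brackets. -/
theorem isPositiveAt_iff [Fintype ι] [DecidableEq ι] {e : ι → ℤ} (he : ∑ k, e k = 0)
    {v : ι → Fin 2 → ℂ} (hv : ∀ k, v k ≠ 0) {ν : ι → SphereDirection}
    (hinj : Function.Injective fun k => (ν k).point) (hpt : ∀ k, projPoint (v k) = (ν k).point)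
    {c : ℂ} (hc : c ≠ 0) (k : ι) :
    IsPositiveAt (fun p => c * sphereProduct e v p) (e k) (ν k) ↔
      phase (c * F.lead e v k) * F.angle ν k ^ e k = 1 := by
  choose g hg using fun j => SphereDirection.mk_surjective (ν j)
  have hind := pairwiseIndependent_secondCol hinj hg
  have hindv : PairwiseIndependent v := pairwiseIndependent_of_injective hv (by
    simpa only [hpt] using hinj)
  have hex : ∀ j, ∃ a : ℂ, a ≠ 0 ∧ secondCol (g j) = a • v j := fun j =>
    eq_smul_of_bracket_eq_zero (hv j) (secondCol_ne_zero _)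
      ((projPoint_eq_iff (hv j) (secondCol_ne_zero _)).mp (by
        rw [hpt, ← hg, SphereDirection.point_mk, smul_zero_eq]))
  choose a ha hga using hex
  have hP : ∏ j, a j ^ e j ≠ 0 := Finset.prod_ne_zero_iff.mpr fun j _ => zpow_ne_zero _ (ha j)
  have hlead : F.lead e (fun j => secondCol (g j)) k = (∏ j, a j ^ e j) * F.lead e v k :=
    lead_transform he hindv (A := 1) ha (fun j => by simpa using hga j) k
  have hl := sphereProduct_hasLeadingCoeff he (v := fun j => secondCol (g j)) (k := k) (g := g k)
    rfl (fun j hj => hind k j hj.symm)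
  have hs := scale_ne_zero (F := F) hind k
  -- As `det = ratio * scale`, the power of `scale` completes the product over `j ≠ k` to `lead`.
  have e1 : (g k).1.det ^ e k * ∏ j ∈ Finset.univ.erase k,
      bracket (secondCol (g k)) (secondCol (g j)) ^ e j
      = F.ratio g k ^ e k * F.lead e (fun j => secondCol (g j)) k := by
    rw [lead, ← Finset.mul_prod_erase _ _ (Finset.mem_univ k), if_pos rfl, ← mul_assoc, ← mul_zpow,
      ratio, div_mul_cancel₀ _ hs]
    congr 1
    refine Finset.prod_congr rfl fun j hj => ?_
    rw [if_neg (Finset.ne_of_mem_erase hj)]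
  have e2 : ∀ p, sphereProduct e (fun j => secondCol (g j)) p
      = (∏ j, a j ^ e j) * sphereProduct e v p := by
    intro p
    simp only [sphereProduct, bracketProduct, hga, bracket_smul_right, mul_zpow,
      Finset.prod_mul_distrib]
  have hl2 : HasLeadingCoeff (fun w => c * sphereProduct e v (g k • (w : OnePoint ℂ))) (e k)
      (c * F.lead e v k * F.ratio g k ^ e k) := by
    rw [e1, hlead] at hl
    have := hl.const_mul (c / ∏ j, a j ^ e j)
    have h1 : ∀ w : ℂ, c / (∏ j, a j ^ e j) *
        sphereProduct e (fun j => secondCol (g j)) (g k • (w : OnePoint ℂ))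
        = c * sphereProduct e v (g k • (w : OnePoint ℂ)) := fun w => by
      rw [e2]; field_simp
    have h2 : c / (∏ j, a j ^ e j) * (F.ratio g k ^ e k * ((∏ j, a j ^ e j) * F.lead e v k))
        = c * F.lead e v k * F.ratio g k ^ e k := by field_simp
    rw [h2] at this
    exact this.congr' (Eventually.of_forall h1)
  have hcl : c * F.lead e v k ≠ 0 := mul_ne_zero hc (lead_ne_zero e hindv k)
  have hrat := ratio_ne_zero (F := F) hind k
  have hphase : phase (c * F.lead e v k * F.ratio g k ^ e k)
      = phase (c * F.lead e v k) * F.angle ν k ^ e k := by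
    rw [phase_mul hcl (zpow_ne_zero _ hrat), phase_zpow hrat, angle_eq hinj hg]
  rw [← hphase]
  constructor
  · intro H
    obtain ⟨r, hr, hl'⟩ := H.leadingCoeff (hg k)
    rw [hl2.unique hl', phase_ofReal hr]
  · intro H
    obtain ⟨r, hr, h⟩ := (phase_eq_one_iff (mul_ne_zero hcl (zpow_ne_zero _ hrat))).mp H
    exact ⟨g k, hg k, r, hr, h ▸ hl2⟩

end LabelFrame

end Invariants

/-! ### Continuity of the invariants -/

/-- The topology of the units also involves the inverse, which is continuous by the adjugate
formula. -/
theorem continuousAt_generalLinearGroup {Y : Type*} [TopologicalSpace Y] {f : Y → GL (Fin 2) ℂ}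
    {y : Y} (h : ContinuousAt (fun y => (f y).1) y) : ContinuousAt f y := by
  rw [Units.isInducing_embedProduct.continuousAt_iff]
  refine ContinuousAt.prodMk h (MulOpposite.continuous_op.continuousAt.comp ?_)
  have e : (fun y => ((f y)⁻¹).1) = fun y => (f y).1.det⁻¹ • (f y).1.adjugate := by
    ext1 y
    rw [Matrix.coe_units_inv, Matrix.inv_def, Ring.inverse_eq_inv']
  change ContinuousAt (fun y => ((f y)⁻¹).1) y
  rw [e]
  have h1 : ContinuousAt (fun y => (f y).1.det) y :=
    ContinuousAt.comp (g := fun M : Matrix (Fin 2) (Fin 2) ℂ => M.det)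
      (continuous_id.matrix_det).continuousAt h
  have h2 : ContinuousAt (fun y => (f y).1.adjugate) y :=
    ContinuousAt.comp (g := fun M : Matrix (Fin 2) (Fin 2) ℂ => M.adjugate)
      (continuous_id.matrix_adjugate).continuousAt h
  exact (h1.inv₀ (f y).det_ne_zero).smul h2

theorem continuous_apply_generalLinearGroup (i j : Fin 2) :
    Continuous fun g : GL (Fin 2) ℂ => g i j :=
  (continuous_id.matrix_elem i j).comp Units.continuous_val

theorem continuous_det_generalLinearGroup : Continuous fun g : GL (Fin 2) ℂ => g.1.det :=
  Continuous.matrix_det Units.continuous_val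

theorem continuous_secondCol : Continuous secondCol :=
  continuous_pi fun i => continuous_apply_generalLinearGroup i 1

theorem SphereDirection.continuous_point : Continuous SphereDirection.point := by
  refine Continuous.quotient_lift (f := fun g : GL (Fin 2) ℂ => g • ((0 : ℂ) : OnePoint ℂ)) ?_ _
  rw [continuous_iff_continuousAt]
  intro g
  have : (fun g : GL (Fin 2) ℂ => g • ((0 : ℂ) : OnePoint ℂ)) = projPoint ∘ secondCol :=
    funext smul_zero_eq
  rw [this]
  exact ContinuousAt.comp (continuousAt_projPoint (secondCol_ne_zero g))
    continuous_secondCol.continuousAt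

section

variable {ι : Type*}

theorem continuous_bracket (i j : ι) :
    Continuous fun v : ι → Fin 2 → ℂ => bracket (v i) (v j) := by
  unfold bracket; fun_prop

namespace LabelFrame

variable {F : LabelFrame ι}

theorem continuousAt_scale {v : ι → Fin 2 → ℂ} (hv : PairwiseIndependent v) (k : ι) :
    ContinuousAt (fun v => F.scale v k) v :=
  ((continuous_bracket _ _).continuousAt.mul (continuous_bracket _ _).continuousAt).div
    (continuous_bracket _ _).continuousAt (hv _ _ (F.fst_ne_snd k))

theorem continuousAt_lead [Fintype ι] [DecidableEq ι] (e : ι → ℤ) {v : ι → Fin 2 → ℂ}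
    (hv : PairwiseIndependent v) (k : ι) : ContinuousAt (fun v => F.lead e v k) v := by
  refine tendsto_finsetProd _ fun j _ => ?_
  split_ifs with h
  · exact (continuousAt_scale hv k).zpow₀ _ (Or.inl (scale_ne_zero hv k))
  · exact (continuous_bracket _ _).continuousAt.zpow₀ _ (Or.inl (hv k j (Ne.symm h)))

theorem continuous_secondCol_pi :
    Continuous fun (g : ι → GL (Fin 2) ℂ) j => secondCol (g j) :=
  continuous_pi fun j => continuous_secondCol.comp (continuous_apply j)

theorem continuousAt_phase_ratio {g : ι → GL (Fin 2) ℂ}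
    (hg : PairwiseIndependent fun j => secondCol (g j)) (k : ι) :
    ContinuousAt (fun g => phase (F.ratio g k)) g := by
  have h1 : ContinuousAt (fun g : ι → GL (Fin 2) ℂ => (g k).1.det) g :=
    (continuous_det_generalLinearGroup.comp (continuous_apply k)).continuousAt
  have h2 := ContinuousAt.comp (f := fun (g : ι → GL (Fin 2) ℂ) j => secondCol (g j))
    (g := fun v => F.scale v k) (x := g) (continuousAt_scale hg k)
    continuous_secondCol_pi.continuousAt
  have h3 := ContinuousAt.div h1 h2 (scale_ne_zero hg k)
  exact ContinuousAt.comp (g := phase) (f := fun g => F.ratio g k)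
    (continuousAt_phase (ratio_ne_zero hg k)) h3

theorem eventually_pairwiseIndependent_secondCol [Finite ι] {g : ι → GL (Fin 2) ℂ}
    (hg : PairwiseIndependent fun j => secondCol (g j)) :
    ∀ᶠ g' in 𝓝 g, PairwiseIndependent fun j => secondCol (g' j) := by
  simp only [PairwiseIndependent]
  rw [eventually_all]; intro i
  rw [eventually_all]; intro j
  by_cases hij : i = j
  · exact Eventually.of_forall fun _ h => absurd hij h
  · have := ((continuous_bracket i j).comp continuous_secondCol_pi).continuousAt.eventually_ne
      (hg i j hij)
    exact this.mono fun _ h _ => h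

theorem continuousAt_angle [Finite ι] {ν : ι → SphereDirection}
    (hinj : Function.Injective fun k => (ν k).point) (k : ι) :
    ContinuousAt (fun ν => F.angle ν k) ν := by
  choose g hg using fun j => SphereDirection.mk_surjective (ν j)
  -- A product of open quotient maps is again one, so continuity can be tested on tuples of
  -- matrices, where the angle is explicit.
  have hq : IsOpenQuotientMap (fun (g : ι → GL (Fin 2) ℂ) j => SphereDirection.mk (g j)) :=
    IsOpenQuotientMap.piMap fun _ => QuotientGroup.isOpenQuotientMap_mk
  have hind := pairwiseIndependent_secondCol hinj hg
  obtain rfl : (fun j => SphereDirection.mk (g j)) = ν := funext hg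
  refine (hq.continuousAt_comp_iff (g := fun ν => F.angle ν k)).mp ?_
  refine (continuousAt_phase_ratio (F := F) hind k).congr ?_
  filter_upwards [eventually_pairwiseIndependent_secondCol hind] with g' hg'
  refine (angle_eq (ν := fun j => SphereDirection.mk (g' j)) (fun i j hij => ?_)
    (fun j => rfl) k).symm
  by_contra hne
  simp only [SphereDirection.point_mk, smul_zero_eq] at hij
  exact hg' i j hne ((projPoint_eq_iff (secondCol_ne_zero _) (secondCol_ne_zero _)).mp hij)

end LabelFrame

/-- Homogeneous coordinates of a tuple of points can be chosen continuously near a given tuple. -/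
theorem exists_lift_continuousAt (z₀ : ι → OnePoint ℂ) :
    ∃ l : (ι → OnePoint ℂ) → ι → Fin 2 → ℂ, (∀ z k, l z k ≠ 0) ∧
      (∀ z k, projPoint (l z k) = z k) ∧ ContinuousAt l z₀ := by
  choose l h1 h2 h3 using fun k => exists_homCoord_continuousAt (z₀ k)
  exact ⟨fun z k => l k (z k), fun z k => h1 k _, fun z k => h2 k _,
    continuousAt_pi.mpr fun k => ContinuousAt.comp (h3 k) (continuous_apply k).continuousAt⟩

theorem exists_smul_mulVec {v v' : ι → Fin 2 → ℂ} (hv : ∀ k, v k ≠ 0) (hv' : ∀ k, v' k ≠ 0)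
    (A : GL (Fin 2) ℂ) (h : ∀ k, projPoint (v' k) = A • projPoint (v k)) :
    ∃ a : ι → ℂ, (∀ k, a k ≠ 0) ∧ ∀ k, v' k = a k • A.1.mulVec (v k) := by
  have key : ∀ k, ∃ a : ℂ, a ≠ 0 ∧ v' k = a • A.1.mulVec (v k) := fun k =>
    eq_smul_of_bracket_eq_zero (mulVec_ne_zero A (hv k)) (hv' k)
      ((projPoint_eq_iff (mulVec_ne_zero A (hv k)) (hv' k)).mp (by
        rw [h, smul_projPoint A (hv k)]))
  choose a ha h using key
  exact ⟨a, ha, h⟩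

theorem pairwiseIndependent_of_projPoint {v : ι → Fin 2 → ℂ} {z : ι → OnePoint ℂ}
    (hz : Function.Injective z) (hv : ∀ k, v k ≠ 0) (h : ∀ k, projPoint (v k) = z k) :
    PairwiseIndependent v :=
  pairwiseIndependent_of_injective hv (by rwa [funext h])

/-! ### Relative phases, normalized configurations and frame directions. -/

namespace LabelFrame

variable (F : LabelFrame ι)

/-- The phase of the leading coefficient at `k` relative to that at `o`. -/
noncomputable def relPhase [Fintype ι] [DecidableEq ι] (e : ι → ℤ) (o : ι) (z : ι → OnePoint ℂ)
    (k : ι) : Circle :=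
  phase (F.lead e (fun j => homCoord (z j)) k / F.lead e (fun j => homCoord (z j)) o)

/-- Homogeneous coordinates of the points in the frame at `o`. -/
noncomputable def normVec (o : ι) (v : ι → Fin 2 → ℂ) (j : ι) : Fin 2 → ℂ :=
  ![bracket (v (F.fst o)) (v (F.snd o)) * bracket (v j) (v o),
    bracket (v (F.snd o)) (v o) * bracket (v (F.fst o)) (v j)]

/-- The configuration normalized by the frame at `o`. -/
noncomputable def normalize (o : ι) (z : ι → OnePoint ℂ) (j : ι) : OnePoint ℂ :=
  projPoint (F.normVec o (fun j => homCoord (z j)) j)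

/-- The matrix of the frame at a label. -/
def frameMatrix (v : ι → Fin 2 → ℂ) (k : ι) : Matrix (Fin 2) (Fin 2) ℂ :=
  Matrix.of fun i j => if j = 0 then bracket (v (F.snd k)) (v k) * v (F.fst k) i
    else bracket (v (F.fst k)) (v (F.snd k)) * v k i

/-- The frame at a label, as an invertible matrix. -/
noncomputable def frameGL (v : ι → Fin 2 → ℂ) (k : ι) : GL (Fin 2) ℂ :=
  open Classical in if h : (F.frameMatrix v k).det ≠ 0 then
    Matrix.GeneralLinearGroup.mkOfDetNeZero _ h else 1

/-- The direction of the frame at a label. -/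
noncomputable def frameDirection (z : ι → OnePoint ℂ) (k : ι) : SphereDirection :=
  SphereDirection.mk (F.frameGL (fun j => homCoord (z j)) k)

variable {F} {v v' : ι → Fin 2 → ℂ} {z : ι → OnePoint ℂ}

theorem relPhase_eq_of_smul [Fintype ι] [DecidableEq ι] {e : ι → ℤ} (he : ∑ k, e k = 0) (o : ι)
    (hz : Function.Injective z) (hv : ∀ k, v k ≠ 0) (A : GL (Fin 2) ℂ)
    (h : ∀ k, projPoint (v k) = A • z k) (k : ι) :
    F.relPhase e o z k = phase (F.lead e v k / F.lead e v o) := by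
  obtain ⟨a, ha, hva⟩ := exists_smul_mulVec (fun k => homCoord_ne_zero (z k)) hv A
    (by simpa only [projPoint_homCoord] using h)
  have hind := pairwiseIndependent_of_projPoint hz (fun k => homCoord_ne_zero (z k))
    fun k => projPoint_homCoord _
  have hP : ∏ j, a j ^ e j ≠ 0 := Finset.prod_ne_zero_iff.mpr fun j _ => zpow_ne_zero _ (ha j)
  rw [relPhase, lead_transform he hind ha hva, lead_transform he hind ha hva,
    mul_div_mul_left _ _ hP]

theorem relPhase_eq [Fintype ι] [DecidableEq ι] {e : ι → ℤ} (he : ∑ k, e k = 0) (o : ι)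
    (hz : Function.Injective z) (hv : ∀ k, v k ≠ 0) (h : ∀ k, projPoint (v k) = z k) (k : ι) :
    F.relPhase e o z k = phase (F.lead e v k / F.lead e v o) :=
  relPhase_eq_of_smul he o hz hv 1 (by simpa using h) k

theorem relPhase_smul [Fintype ι] [DecidableEq ι] {e : ι → ℤ} (he : ∑ k, e k = 0) (o : ι)
    (hz : Function.Injective z) (A : GL (Fin 2) ℂ) (k : ι) :
    F.relPhase e o (fun j => A • z j) k = F.relPhase e o z k :=
  (relPhase_eq_of_smul he o hz (fun k => homCoord_ne_zero (A • z k)) A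
    (fun _ => projPoint_homCoord _) k).symm

/-- `homCoord` itself is discontinuous at infinity. Since any homogeneous coordinates give the same
value, they may be replaced near a given configuration by a continuous choice; the other continuity
proofs below use this too. -/
theorem continuous_relPhase [Fintype ι] [DecidableEq ι] {e : ι → ℤ} (he : ∑ k, e k = 0) (o k : ι) :
    Continuous fun z : {z : ι → OnePoint ℂ // Function.Injective z} => F.relPhase e o z.1 k := by
  rw [continuous_iff_continuousAt]
  intro z₀
  obtain ⟨l, h1, h2, h3⟩ := exists_lift_continuousAt z₀.1
  have hind := pairwiseIndependent_of_projPoint z₀.2 (h1 z₀.1) (h2 z₀.1)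
  have e1 : (fun z : {z : ι → OnePoint ℂ // Function.Injective z} => F.relPhase e o z.1 k)
      = fun z => phase (F.lead e (l z.1) k / F.lead e (l z.1) o) :=
    funext fun z => relPhase_eq he o z.2 (h1 z.1) (h2 z.1) k
  rw [e1]
  have hl : ContinuousAt (fun z : {z : ι → OnePoint ℂ // Function.Injective z} => l z.1) z₀ :=
    ContinuousAt.comp (g := l) h3 continuous_subtype_val.continuousAt
  refine ContinuousAt.comp (g := phase)
    (f := fun z : {z : ι → OnePoint ℂ // Function.Injective z} =>
      F.lead e (l z.1) k / F.lead e (l z.1) o) (continuousAt_phase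
    (div_ne_zero (lead_ne_zero e hind k) (lead_ne_zero e hind o))) (ContinuousAt.div ?_ ?_
    (lead_ne_zero e hind o))
  · exact ContinuousAt.comp (g := fun v => F.lead e v k) (continuousAt_lead e hind k) hl
  · exact ContinuousAt.comp (g := fun v => F.lead e v o) (continuousAt_lead e hind o) hl

theorem normVec_ne_zero (hv : PairwiseIndependent v) (o j : ι) : F.normVec o v j ≠ 0 := by
  intro h
  have h0 : bracket (v (F.fst o)) (v (F.snd o)) * bracket (v j) (v o) = 0 := congrFun h 0
  have h1 : bracket (v (F.snd o)) (v o) * bracket (v (F.fst o)) (v j) = 0 := congrFun h 1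
  have h2 := (mul_eq_zero.mp h0).resolve_left (hv _ _ (F.fst_ne_snd o))
  have h3 := (mul_eq_zero.mp h1).resolve_left (hv _ _ (F.snd_ne o))
  have hj : j = o := by by_contra hj; exact hv _ _ hj h2
  rw [hj] at h3
  exact hv _ _ (F.fst_ne o) h3

theorem normalize_eq_of_smul (o : ι) (hv : ∀ k, v k ≠ 0) (A : GL (Fin 2) ℂ)
    (h : ∀ k, projPoint (v k) = A • z k) (k : ι) :
    F.normalize o z k = projPoint (F.normVec o v k) := by
  obtain ⟨a, ha, hva⟩ := exists_smul_mulVec (fun k => homCoord_ne_zero (z k)) hv A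
    (by simpa only [projPoint_homCoord] using h)
  -- Both components have the same weight in every vector, so the point they define is invariant.
  have e1 : F.normVec o v k = (a (F.fst o) * a (F.snd o) * a o * a k * A.1.det * A.1.det) •
      F.normVec o (fun j => homCoord (z j)) k := by
    ext i
    fin_cases i
    · simp only [normVec, bracket_transform hva]
      simp
      ring
    · simp only [normVec, bracket_transform hva]
      simp
      ring
  have hA : A.1.det ≠ 0 := A.det_ne_zero
  rw [e1, projPoint_smul, normalize]
  simp [ha, A.det_ne_zero]

theorem normalize_eq (o : ι) (hv : ∀ k, v k ≠ 0) (h : ∀ k, projPoint (v k) = z k) (k : ι) :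
    F.normalize o z k = projPoint (F.normVec o v k) :=
  normalize_eq_of_smul o hv 1 (by simpa using h) k

theorem normalize_smul (o : ι) (A : GL (Fin 2) ℂ) (k : ι) :
    F.normalize o (fun j => A • z j) k = F.normalize o z k :=
  (normalize_eq_of_smul o (fun k => homCoord_ne_zero (A • z k)) A
    (fun _ => projPoint_homCoord _) k).symm

theorem exists_normalize_eq_smul (o : ι) (hz : Function.Injective z) :
    ∃ A : GL (Fin 2) ℂ, ∀ k, F.normalize o z k = A • z k := by
  set v := fun j => homCoord (z j) with hv
  have hind : PairwiseIndependent v := pairwiseIndependent_of_projPoint hz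
    (fun k => homCoord_ne_zero (z k)) fun k => projPoint_homCoord _
  have h1 := hind _ _ (F.fst_ne_snd o)
  have h2 := hind _ _ (F.snd_ne o)
  have h3 := hind _ _ (F.fst_ne o)
  -- The automorphism taking the points of `o`, `snd o`, `fst o` to `0`, `1`, `∞`: its rows are the
  -- linear forms vanishing at `v o` and `v (fst o)`, scaled so that they agree at `v (snd o)`.
  let M : Matrix (Fin 2) (Fin 2) ℂ :=
    !![bracket (v (F.fst o)) (v (F.snd o)) * v o 1, -(bracket (v (F.fst o)) (v (F.snd o)) * v o 0);
      -(bracket (v (F.snd o)) (v o) * v (F.fst o) 1), bracket (v (F.snd o)) (v o) * v (F.fst o) 0]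
  have hM : M.det ≠ 0 := by
    have : M.det = bracket (v (F.fst o)) (v (F.snd o)) * bracket (v (F.snd o)) (v o) *
        bracket (v (F.fst o)) (v o) := by
      rw [Matrix.det_fin_two_of, bracket, bracket, bracket]; ring
    rw [this]
    exact mul_ne_zero (mul_ne_zero h1 h2) h3
  refine ⟨Matrix.GeneralLinearGroup.mkOfDetNeZero M hM, fun k => ?_⟩
  have e1 : F.normVec o v k = M.mulVec (v k) := by
    ext i
    fin_cases i
    · simp [normVec, M, Matrix.mulVec, dotProduct, Fin.sum_univ_two, bracket]; ring
    · simp [normVec, M, Matrix.mulVec, dotProduct, Fin.sum_univ_two, bracket]; ring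
  have e2 := smul_projPoint (Matrix.GeneralLinearGroup.mkOfDetNeZero M hM)
    (homCoord_ne_zero (z k))
  rw [projPoint_homCoord] at e2
  rw [e2, normalize]
  exact congrArg projPoint e1

theorem continuous_normalize [Finite ι] (o : ι) :
    Continuous fun z : {z : ι → OnePoint ℂ // Function.Injective z} => F.normalize o z.1 := by
  rw [continuous_iff_continuousAt]
  intro z₀
  obtain ⟨l, h1, h2, h3⟩ := exists_lift_continuousAt z₀.1
  have hind := pairwiseIndependent_of_projPoint z₀.2 (h1 z₀.1) (h2 z₀.1)
  have hl : ContinuousAt (fun z : {z : ι → OnePoint ℂ // Function.Injective z} => l z.1) z₀ :=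
    ContinuousAt.comp (g := l) h3 continuous_subtype_val.continuousAt
  rw [continuousAt_pi]
  intro k
  have e1 : (fun z : {z : ι → OnePoint ℂ // Function.Injective z} => F.normalize o z.1 k)
      = fun z => projPoint (F.normVec o (l z.1) k) :=
    funext fun z => normalize_eq o (h1 z.1) (h2 z.1) k
  rw [e1]
  have hn : Continuous fun v => F.normVec o v k := by
    refine continuous_pi fun i => ?_
    fin_cases i
    · exact (continuous_bracket _ _).mul (continuous_bracket _ _)
    · exact (continuous_bracket _ _).mul (continuous_bracket _ _)
  exact ContinuousAt.comp (g := projPoint) (continuousAt_projPoint (normVec_ne_zero hind o k))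
    (ContinuousAt.comp (g := fun v => F.normVec o v k) hn.continuousAt hl)

theorem det_frameMatrix (v : ι → Fin 2 → ℂ) (k : ι) : (F.frameMatrix v k).det =
    bracket (v (F.snd k)) (v k) * bracket (v (F.fst k)) (v (F.snd k)) *
      bracket (v (F.fst k)) (v k) := by
  rw [Matrix.det_fin_two]
  simp [frameMatrix, bracket]
  ring

theorem det_frameMatrix_ne_zero (hv : PairwiseIndependent v) (k : ι) :
    (F.frameMatrix v k).det ≠ 0 := by
  rw [det_frameMatrix]
  exact mul_ne_zero (mul_ne_zero (hv _ _ (F.snd_ne k)) (hv _ _ (F.fst_ne_snd k)))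
    (hv _ _ (F.fst_ne k))

theorem frameGL_coe (hv : PairwiseIndependent v) (k : ι) :
    (F.frameGL v k).1 = F.frameMatrix v k := by
  rw [frameGL, dif_pos (det_frameMatrix_ne_zero hv k)]
  rfl

theorem secondCol_frameGL (hv : PairwiseIndependent v) (k : ι) :
    secondCol (F.frameGL v k) = bracket (v (F.fst k)) (v (F.snd k)) • v k := by
  ext i
  change (F.frameGL v k).1 i 1 = _
  rw [frameGL_coe hv]
  simp [frameMatrix]

theorem frameDirection_eq (hz : Function.Injective z) (hv : ∀ k, v k ≠ 0)
    (h : ∀ k, projPoint (v k) = z k) (k : ι) :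
    F.frameDirection z k = SphereDirection.mk (F.frameGL v k) := by
  obtain ⟨a, ha, hva⟩ := exists_smul_mulVec (fun k => homCoord_ne_zero (z k)) hv 1
    (by simpa only [projPoint_homCoord, one_smul] using h)
  have hindz := pairwiseIndependent_of_projPoint hz (fun k => homCoord_ne_zero (z k))
    fun k => projPoint_homCoord _
  have hind := pairwiseIndependent_of_projPoint hz hv h
  set w := fun j => homCoord (z j) with hw
  obtain ⟨c, hc⟩ : ∃ c, c = a k * a (F.fst k) * a (F.snd k) := ⟨_, rfl⟩
  have hc0 : c ≠ 0 := hc ▸ mul_ne_zero (mul_ne_zero (ha _) (ha _)) (ha _)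
  -- Both columns contain the labels `k`, `fst k`, `snd k` once each, so rescaling vectors changes
  -- the matrix by a scalar only.
  have hM : F.frameMatrix v k = c • F.frameMatrix w k := by
    ext i j
    simp only [frameMatrix, Matrix.of_apply, Matrix.smul_apply, bracket_transform hva]
    have hva' : ∀ k i, v k i = a k * w k i := fun k i => by rw [hva]; simp [w]
    split_ifs
    · rw [hva']; simp [hc, w]; ring
    · rw [hva']; simp [hc, w]; ring
  rw [frameDirection, SphereDirection.mk_eq_mk_iff]
  have hd : (F.frameGL w k)⁻¹ * F.frameGL v k
      = Matrix.GeneralLinearGroup.mkOfDetNeZero (c • (1 : Matrix (Fin 2) (Fin 2) ℂ))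
        (by simp [hc0]) := by
    rw [inv_mul_eq_iff_eq_mul]
    apply Units.ext
    rw [Units.val_mul, frameGL_coe hind, frameGL_coe hindz, hM]
    simp [Matrix.GeneralLinearGroup.mkOfDetNeZero]
  rw [hd]
  refine ⟨?_, 1, one_pos, ?_⟩ <;> simp [Matrix.GeneralLinearGroup.mkOfDetNeZero]

theorem point_frameDirection (hz : Function.Injective z) (k : ι) :
    (F.frameDirection z k).point = z k := by
  have hind := pairwiseIndependent_of_projPoint hz (fun k => homCoord_ne_zero (z k))
    fun k => projPoint_homCoord _
  rw [frameDirection, SphereDirection.point_mk, smul_zero_eq, secondCol_frameGL hind,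
    projPoint_smul (hind _ _ (F.fst_ne_snd k)), projPoint_homCoord]

/-- The frame direction is the zero of the angle: here `ratio` is exactly `1`. Directions with
prescribed angles are obtained by rotating it. -/
theorem angle_frameDirection (hz : Function.Injective z) (k : ι) :
    F.angle (F.frameDirection z) k = 1 := by
  have hind := pairwiseIndependent_of_projPoint hz (fun k => homCoord_ne_zero (z k))
    fun k => projPoint_homCoord _
  have hp : Function.Injective fun k => (F.frameDirection z k).point := by
    simpa only [point_frameDirection hz] using hz
  rw [angle_eq (g := fun k => F.frameGL (fun j => homCoord (z j)) k) hp (fun _ => rfl), ratio]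
  have h1 := hind _ _ (F.fst_ne_snd k)
  have h2 := hind _ _ (F.snd_ne k)
  have h3 := hind _ _ (F.fst_ne k)
  have hs := scale_transform (F := F) hind (A := 1) (a := fun k =>
    bracket (homCoord (z (F.fst k))) (homCoord (z (F.snd k))))
    (fun k => hind _ _ (F.fst_ne_snd k))
    (v' := fun j => secondCol (F.frameGL (fun j => homCoord (z j)) j))
    (fun j => by rw [secondCol_frameGL hind]; simp) k
  rw [hs, frameGL_coe hind, det_frameMatrix, scale]
  simp only [Units.val_one, Matrix.det_one, mul_one]
  rw [show bracket (homCoord (z (F.snd k))) (homCoord (z k)) *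
    bracket (homCoord (z (F.fst k))) (homCoord (z (F.snd k))) *
    bracket (homCoord (z (F.fst k))) (homCoord (z k)) /
    (bracket (homCoord (z (F.fst k))) (homCoord (z (F.snd k))) *
    bracket (homCoord (z (F.fst k))) (homCoord (z (F.snd k))) *
    (bracket (homCoord (z (F.snd k))) (homCoord (z k)) *
    bracket (homCoord (z (F.fst k))) (homCoord (z k)) /
    bracket (homCoord (z (F.fst k))) (homCoord (z (F.snd k))))) = 1 by field_simp, phase_one]

theorem continuous_rotationMatrix : Continuous SphereDirection.rotationMatrix := by
  rw [continuous_iff_continuousAt]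
  intro ζ
  apply continuousAt_generalLinearGroup
  apply Continuous.continuousAt
  refine continuous_matrix fun i j => ?_
  fin_cases i <;> fin_cases j <;>
    simp [SphereDirection.rotationMatrix, Matrix.GeneralLinearGroup.mkOfDetNeZero] <;> fun_prop

theorem continuous_frameDirection_rotate [Finite ι] (k : ι) :
    Continuous fun p : {z : ι → OnePoint ℂ // Function.Injective z} × Circle =>
      (F.frameDirection p.1.1 k).rotate p.2 := by
  rw [continuous_iff_continuousAt]
  rintro ⟨z₀, ζ₀⟩
  obtain ⟨l, h1, h2, h3⟩ := exists_lift_continuousAt z₀.1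
  have hind := fun z : {z : ι → OnePoint ℂ // Function.Injective z} =>
    pairwiseIndependent_of_projPoint z.2 (h1 z.1) (h2 z.1)
  have hl : ContinuousAt (fun z : {z : ι → OnePoint ℂ // Function.Injective z} => l z.1) z₀ :=
    ContinuousAt.comp (g := l) h3 continuous_subtype_val.continuousAt
  have e1 : (fun p : {z : ι → OnePoint ℂ // Function.Injective z} × Circle =>
      (F.frameDirection p.1.1 k).rotate p.2) = fun p =>
      SphereDirection.mk (F.frameGL (l p.1.1) k * SphereDirection.rotationMatrix p.2) := by
    ext1 p
    rw [frameDirection_eq p.1.2 (h1 p.1.1) (h2 p.1.1), SphereDirection.rotate_mk]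
  rw [e1]
  have hfr : ContinuousAt (fun z : {z : ι → OnePoint ℂ // Function.Injective z} =>
      F.frameGL (l z.1) k) z₀ := by
    apply continuousAt_generalLinearGroup
    have : (fun z : {z : ι → OnePoint ℂ // Function.Injective z} => (F.frameGL (l z.1) k).1)
        = fun z => F.frameMatrix (l z.1) k := funext fun z => frameGL_coe (hind z) k
    rw [this]
    refine ContinuousAt.comp (g := fun v => F.frameMatrix v k) (Continuous.continuousAt ?_) hl
    refine continuous_matrix fun i j => ?_
    simp only [frameMatrix, Matrix.of_apply]
    have hvc : ∀ k, Continuous fun v : ι → Fin 2 → ℂ => v k i := fun k =>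
      (continuous_apply i).comp (continuous_apply k)
    split_ifs
    · exact (continuous_bracket _ _).mul (hvc _)
    · exact (continuous_bracket _ _).mul (hvc _)
  refine ContinuousAt.comp (g := SphereDirection.mk)
    QuotientGroup.isOpenQuotientMap_mk.continuous.continuousAt (ContinuousAt.mul ?_ ?_)
  · exact ContinuousAt.comp (g := fun z : {z : ι → OnePoint ℂ // Function.Injective z} =>
      F.frameGL (l z.1) k) (x := (z₀, ζ₀)) hfr continuous_fst.continuousAt
  · exact (continuous_rotationMatrix.comp continuous_snd).continuousAt

end LabelFrame

end

/-! ### Roots of circle-valued functions -/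

section

variable {ι B : Type*}

/-- A root of a unit complex number. -/
noncomputable def circleRoot (e : ℤ) (ξ : Circle) : Circle := Circle.exp ((ξ : ℂ).arg / e)

theorem circleRoot_zpow {e : ℤ} (he : e ≠ 0) (ξ : Circle) : circleRoot e ξ ^ e = ξ := by
  have he' : (e : ℝ) ≠ 0 := by exact_mod_cast he
  rw [circleRoot, ← Circle.exp_intCast_mul, mul_div_cancel₀ _ he', Circle.exp_arg]

/-- The principal root may jump at `-1`, so it is used continuously only near a base value and
globally only as a choice of sets. -/
theorem continuousAt_circleRoot (e : ℤ) {ξ : Circle} (hξ : (ξ : ℂ) ∈ Complex.slitPlane) :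
    ContinuousAt (circleRoot e) ξ := by
  have h1 : ContinuousAt (fun ξ : Circle => (ξ : ℂ).arg) ξ :=
    ContinuousAt.comp (g := Complex.arg) (Complex.continuousAt_arg hξ)
      continuous_subtype_val.continuousAt
  exact ContinuousAt.comp (g := Circle.exp) Circle.exp.continuous.continuousAt (h1.div_const _)

theorem finite_circle_zpow_eq_one {e : ℤ} (he : e ≠ 0) : {ζ : Circle | ζ ^ e = 1}.Finite := by
  have h : {ζ : Circle | ζ ^ e = 1} ⊆
      (fun ζ : Circle => (ζ : ℂ)) ⁻¹' (Polynomial.nthRootsFinset e.natAbs (1 : ℂ)) := by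
    intro ζ hζ
    have h1 : ζ ^ e.natAbs = 1 := by
      rcases Int.natAbs_eq e with h | h <;> rw [mem_ofPred_eq, h] at hζ
      · exact_mod_cast hζ
      · rw [zpow_neg, inv_eq_one] at hζ; exact_mod_cast hζ
    rw [mem_preimage, Finset.mem_coe, Polynomial.mem_nthRootsFinset (Int.natAbs_pos.mpr he),
      ← Circle.coe_pow, h1, Circle.coe_one]
  exact ((Finset.finite_toSet _).preimage Circle.coe_injective.injOn).subset h

/-- The space of tuples of roots, of the given orders, of circle-valued functions on `B`. -/
abbrev RootCover (e : ι → ℤ) (ψ : B → ι → Circle) : Type _ :=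
  {y : B × (ι → Circle) // ∀ k, y.2 k ^ e k = ψ y.1 k}

/-- The tuples of roots of unity of the given orders. -/
abbrev RootGroup (e : ι → ℤ) : Type _ := {ξ : ι → Circle // ∀ k, ξ k ^ e k = 1}

theorem finite_rootGroup [Finite ι] {e : ι → ℤ} (he : ∀ k, e k ≠ 0) : Finite (RootGroup e) := by
  have h := Set.Finite.pi' fun k => finite_circle_zpow_eq_one (he k)
  exact h.to_subtype

/-- Over a neighbourhood of `b₀` there is a continuous tuple of roots `ρ`, and division by it
trivializes the space, with the roots of unity as fibre. -/
theorem isCoveringMap_rootCover [TopologicalSpace B] [Finite ι] {e : ι → ℤ} (he : ∀ k, e k ≠ 0)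
    {ψ : B → ι → Circle} (hψ : ∀ k, Continuous fun b => ψ b k) :
    IsCoveringMap fun y : RootCover e ψ => y.1.1 := by
  intro b₀
  have := finite_rootGroup he
  -- Extracting the root of `ψ b / ψ b₀`, which is near `1`, moves the branch cut away from `b₀`.
  let ρ : B → ι → Circle := fun b k =>
    circleRoot (e k) (ψ b k / ψ b₀ k) * circleRoot (e k) (ψ b₀ k)
  have hρ : ∀ b k, ρ b k ^ e k = ψ b k := fun b k => by
    simp only [ρ]
    rw [mul_zpow, circleRoot_zpow (he k), circleRoot_zpow (he k), div_mul_cancel]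
  let U : Set B := {b | ∀ k, ((ψ b k / ψ b₀ k : Circle) : ℂ) ∈ Complex.slitPlane}
  have hU : IsOpen U := by
    have : U = ⋂ k, {b | ((ψ b k / ψ b₀ k : Circle) : ℂ) ∈ Complex.slitPlane} := by
      ext b; simp [U]
    rw [this]
    exact isOpen_iInter_of_finite fun k => Complex.isOpen_slitPlane.preimage
      (continuous_subtype_val.comp ((hψ k).div_const _))
  have hρc : Continuous fun b : U => ρ b := by
    refine continuous_pi fun k => Continuous.mul ?_ continuous_const
    rw [continuous_iff_continuousAt]
    intro b
    exact ContinuousAt.comp (g := circleRoot (e k)) (f := fun b : U => ψ b k / ψ b₀ k)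
      (continuousAt_circleRoot (e k) (b.2 k))
      (((hψ k).comp continuous_subtype_val).div_const _).continuousAt
  have hp : Continuous fun y : RootCover e ψ => y.1.1 := continuous_fst.comp continuous_subtype_val
  -- The fibre is discrete because it is a finite Hausdorff space.
  refine IsEvenlyCovered.to_isEvenlyCovered_preimage (I := RootGroup e)
    ⟨inferInstance, U, fun k => by simp, hU, hU.preimage hp, ?_, ?_⟩
  · exact {
      toFun := fun y => (⟨y.1.1.1, y.2⟩, ⟨fun k => y.1.1.2 k / ρ y.1.1.1 k, fun k => by
        rw [div_zpow, y.1.2 k, hρ, div_self']⟩)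
      invFun := fun q => ⟨⟨(q.1.1, fun k => q.2.1 k * ρ q.1.1 k), fun k => by
        rw [mul_zpow, q.2.2 k, hρ, one_mul]⟩, q.1.2⟩
      left_inv := fun y => by
        apply Subtype.ext; apply Subtype.ext
        simp
      right_inv := fun q => by
        refine Prod.ext rfl (Subtype.ext ?_)
        simp
      continuous_toFun := by
        have h1 : Continuous fun y : (fun y : RootCover e ψ => y.1.1) ⁻¹' U =>
            (⟨y.1.1.1, y.2⟩ : U) := (hp.comp continuous_subtype_val).subtype_mk _
        refine h1.prodMk (Continuous.subtype_mk (continuous_pi fun k => Continuous.div' ?_ ?_) _)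
        · exact (continuous_apply k).comp (continuous_snd.comp
            (continuous_subtype_val.comp continuous_subtype_val))
        · exact (continuous_apply k).comp (hρc.comp h1)
      continuous_invFun := by
        refine Continuous.subtype_mk (Continuous.subtype_mk (Continuous.prodMk
          (continuous_subtype_val.comp continuous_fst)
          (continuous_pi fun k => Continuous.mul ?_ ?_)) _) _
        · exact (continuous_apply k).comp (continuous_subtype_val.comp continuous_snd)
        · exact (continuous_apply k).comp (hρc.comp continuous_fst) }
  · exact fun y => rfl

/-- The character identifying the integers modulo `m` with the roots of unity. -/
theorem bijective_toCircle {m : ℕ} [NeZero m] :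
    Function.Bijective fun j : ZMod m => (⟨ZMod.toCircle j, by
      rw [← AddChar.map_nsmul_eq_pow]; simp⟩ : {ζ : Circle // ζ ^ m = 1}) := by
  constructor
  · intro j j' h
    exact ZMod.injective_toCircle (congrArg Subtype.val h)
  · rintro ⟨ζ, hζ⟩
    rw [← Circle.exp_arg ζ, ← Circle.exp_natCast_mul, Circle.exp_eq_one] at hζ
    obtain ⟨n, hn⟩ := hζ
    refine ⟨(n : ZMod m), Subtype.ext ?_⟩
    have hm : (m : ℝ) ≠ 0 := by exact_mod_cast NeZero.ne m
    apply Circle.coe_injective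
    change ((ZMod.toCircle (n : ZMod m) : Circle) : ℂ) = ζ
    rw [ZMod.toCircle_intCast, ← Circle.exp_arg ζ, Circle.coe_exp]
    congr 1
    have h2 : (ζ : ℂ).arg = n * (2 * Real.pi) / m := by field_simp; linarith
    rw [h2]; push_cast; ring

theorem toCircle_intCast_eq_exp {m : ℕ} [NeZero m] (j : ℤ) :
    ZMod.toCircle (j : ZMod m) = Circle.exp (2 * Real.pi * j / m) := by
  apply Circle.coe_injective
  rw [ZMod.toCircle_intCast, Circle.coe_exp]
  congr 1
  push_cast; ring

/-- Tuples of roots in terms of the residue classes of their arguments. -/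
theorem exists_rootCover_equiv {e : ι → ℤ} {m : ι → ℕ} (hm : ∀ k, 0 < m k)
    (hem : ∀ k (ζ : Circle), ζ ^ e k = 1 ↔ ζ ^ m k = 1) (he : ∀ k, e k ≠ 0)
    (ψ : B → ι → Circle) :
    ∃ Θ : RootCover e ψ ≃ B × (∀ k, ZMod (m k)), (∀ y, (Θ y).1 = y.1.1) ∧
      ∀ (y y' : RootCover e ψ) (j : ι → ℤ), y'.1.1 = y.1.1 →
        (∀ k, y'.1.2 k = y.1.2 k * Circle.exp (2 * Real.pi * j k / m k)) →
        Θ y' = (y.1.1, (Θ y).2 + fun k => (j k : ZMod (m k))) := by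
  have hne : ∀ k, NeZero (m k) := fun k => ⟨(hm k).ne'⟩
  let ε : ∀ k, ZMod (m k) ≃ {ζ : Circle // ζ ^ m k = 1} := fun k =>
    Equiv.ofBijective _ bijective_toCircle
  -- A reference root at each point, without any continuity in `b`; the result is a bijection of
  -- sets only.
  let ρ : B → ι → Circle := fun b k => circleRoot (e k) (ψ b k)
  have hρ : ∀ b k, ρ b k ^ e k = ψ b k := fun b k => circleRoot_zpow (he k) _
  let Θ : RootCover e ψ ≃ B × (∀ k, ZMod (m k)) :=
    { toFun := fun y => (y.1.1, fun k => (ε k).symm ⟨y.1.2 k / ρ y.1.1 k, by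
        rw [← hem, div_zpow, y.2 k, hρ, div_self']⟩)
      invFun := fun q => ⟨(q.1, fun k => (ε k (q.2 k)).1 * ρ q.1 k), fun k => by
        rw [mul_zpow, (hem k _).mpr (ε k (q.2 k)).2, hρ, one_mul]⟩
      left_inv := fun y => by
        apply Subtype.ext
        simp
      right_inv := fun q => by
        refine Prod.ext rfl (funext fun k => ?_)
        simp }
  refine ⟨Θ, fun _ => rfl, fun y y' j h1 h2 => Prod.ext h1 (funext fun k => ?_)⟩
  change (ε k).symm _ = (ε k).symm _ + (j k : ZMod (m k))
  rw [Equiv.symm_apply_eq]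
  apply Subtype.ext
  have h3 : ∀ x : ZMod (m k), (ε k x).1 = ZMod.toCircle x := fun _ => rfl
  rw [h3, AddChar.map_add_eq_mul, ← h3, Equiv.apply_symm_apply, toCircle_intCast_eq_exp]
  change y'.1.2 k / ρ y'.1.1 k = _
  rw [h1, h2, mul_div_right_comm]

end

/-! ### Normalized meromorphic functions -/

section

variable {ι : Type}

namespace LabelFrame

variable {F : LabelFrame ι}

theorem normalize_injective (o : ι) (z : PuncturedSphere ι) :
    Function.Injective (F.normalize o z.1) := by
  obtain ⟨A, hA⟩ := exists_normalize_eq_smul (F := F) o z.2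
  have : F.normalize o z.1 = fun k => A • z.1 k := funext hA
  rw [this]
  exact (MulAction.injective A).comp z.2

/-- The normalized representative of a configuration. -/
noncomputable def moduliSection (F : LabelFrame ι) (o : ι) : SphereModuli ι → PuncturedSphere ι :=
  Quotient.lift (fun z => ⟨F.normalize o z.1, normalize_injective o z⟩) (by
    rintro z z' ⟨A, hA⟩
    have : z'.1 = fun j => A • z.1 j := funext hA
    apply Subtype.ext
    change F.normalize o z.1 = F.normalize o z'.1
    ext1 k
    rw [this, normalize_smul])

theorem continuous_moduliSection [Finite ι] (o : ι) : Continuous (F.moduliSection o) :=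
  Continuous.quotient_lift ((continuous_normalize o).subtype_mk _) _

theorem mk_moduliSection (o : ι) (x : SphereModuli ι) : ⟦F.moduliSection o x⟧ = x := by
  induction x using Quotient.inductionOn with
  | h z =>
    obtain ⟨A, hA⟩ := exists_normalize_eq_smul (F := F) o z.2
    exact Quotient.sound (Setoid.symm ⟨A, hA⟩)

end LabelFrame

variable [Fintype ι] [DecidableEq ι]

namespace LabelFrame

/-- The product of brackets with zeros and poles of the given orders, normalized at `o`. -/
noncomputable def model (F : LabelFrame ι) (e : ι → ℤ) (o : ι) (z : ι → OnePoint ℂ)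
    (p : OnePoint ℂ) : ℂ :=
  sphereProduct e (fun j => homCoord (z j)) p / F.lead e (fun j => homCoord (z j)) o

variable {F : LabelFrame ι} {e : ι → ℤ}

/-- Product and `lead` at `o` acquire the same factor when the homogeneous coordinates of the
punctures change, so the quotient may be computed in any of them. -/
theorem model_projPoint (he : ∑ k, e k = 0) (o : ι) {z : ι → OnePoint ℂ}
    (hz : Function.Injective z) {v : ι → Fin 2 → ℂ} (hv : ∀ k, v k ≠ 0)
    (h : ∀ k, projPoint (v k) = z k) {x : Fin 2 → ℂ} (hx : x ≠ 0) :
    F.model e o z (projPoint x) = bracketProduct e v x / F.lead e v o := by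
  obtain ⟨a, ha, hva⟩ := exists_smul_mulVec (fun k => homCoord_ne_zero (z k)) hv 1
    (by simpa only [projPoint_homCoord, one_smul] using h)
  have hind := pairwiseIndependent_of_projPoint hz (fun k => homCoord_ne_zero (z k))
    fun k => projPoint_homCoord _
  have hP : ∏ j, a j ^ e j ≠ 0 := Finset.prod_ne_zero_iff.mpr fun j _ => zpow_ne_zero _ (ha j)
  have hb : bracketProduct e v x
      = (∏ j, a j ^ e j) * bracketProduct e (fun j => homCoord (z j)) x := by
    simp only [bracketProduct, hva, bracket_smul_right, mul_zpow, Finset.prod_mul_distrib,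
      Units.val_one, Matrix.one_mulVec]
  rw [model, sphereProduct_projPoint he _ hx, lead_transform he hind ha hva, hb,
    mul_div_mul_left _ _ hP]

theorem continuousAt_model (he : ∑ k, e k = 0) (o : ι) (z₀ : PuncturedSphere ι) {p₀ : OnePoint ℂ}
    (hp : p₀ ∉ range z₀.1) :
    ContinuousAt (fun q : PuncturedSphere ι × OnePoint ℂ => F.model e o q.1.1 q.2) (z₀, p₀) := by
  obtain ⟨l, h1, h2, h3⟩ := exists_lift_continuousAt z₀.1
  obtain ⟨x, x1, x2, x3⟩ := exists_homCoord_continuousAt p₀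
  have hind := pairwiseIndependent_of_projPoint z₀.2 (h1 z₀.1) (h2 z₀.1)
  have hl : ContinuousAt (fun q : PuncturedSphere ι × OnePoint ℂ => l q.1.1) (z₀, p₀) :=
    ContinuousAt.comp (g := l) h3 (continuous_subtype_val.comp continuous_fst).continuousAt
  have hx : ContinuousAt (fun q : PuncturedSphere ι × OnePoint ℂ => x q.2) (z₀, p₀) :=
    ContinuousAt.comp (g := x) x3 continuous_snd.continuousAt
  have e1 : (fun q : PuncturedSphere ι × OnePoint ℂ => F.model e o q.1.1 q.2)
      = fun q => bracketProduct e (l q.1.1) (x q.2) / F.lead e (l q.1.1) o := by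
    ext1 q
    rw [← model_projPoint he o q.1.2 (h1 q.1.1) (h2 q.1.1) (x1 q.2), x2]
  rw [e1]
  refine ContinuousAt.div ?_ (ContinuousAt.comp (g := fun v => F.lead e v o)
    (continuousAt_lead e hind o) hl) (lead_ne_zero e hind o)
  refine tendsto_finsetProd _ fun k _ => ?_
  have hne : bracket (x p₀) (l z₀.1 k) ≠ 0 :=
    bracket_ne_zero_of_projPoint_ne (x1 _) (h1 _ _) (by
      rw [x2, h2]; exact fun h => hp ⟨k, h.symm⟩)
  have hb : ContinuousAt (fun q : PuncturedSphere ι × OnePoint ℂ =>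
      bracket (x q.2) (l q.1.1 k)) (z₀, p₀) := by
    have hx' : ∀ i, ContinuousAt (fun q : PuncturedSphere ι × OnePoint ℂ => x q.2 i) (z₀, p₀) :=
      fun i => continuousAt_pi.mp hx i
    have hl' : ∀ i, ContinuousAt (fun q : PuncturedSphere ι × OnePoint ℂ => l q.1.1 k i) (z₀, p₀) :=
      fun i => continuousAt_pi.mp (continuousAt_pi.mp hl k) i
    exact ((hx' 0).mul (hl' 1)).sub ((hx' 1).mul (hl' 0))
  exact hb.zpow₀ (e k) (Or.inl hne)

theorem model_ne_zero (o : ι) (z : PuncturedSphere ι) {p : OnePoint ℂ} (hp : p ∉ range z.1) :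
    F.model e o z.1 p ≠ 0 := by
  have hind := pairwiseIndependent_of_projPoint z.2 (fun k => homCoord_ne_zero (z.1 k))
    fun k => projPoint_homCoord _
  refine div_ne_zero (Finset.prod_ne_zero_iff.mpr fun k _ => zpow_ne_zero _ ?_)
    (lead_ne_zero e hind o)
  refine bracket_ne_zero_of_projPoint_ne (homCoord_ne_zero _) (homCoord_ne_zero _) ?_
  rw [projPoint_homCoord, projPoint_homCoord]
  exact fun h => hp ⟨k, h.symm⟩

/-- The relative phases as functions on the moduli space. -/
noncomputable def moduliPhase (F : LabelFrame ι) (he : ∑ k, e k = 0) (o : ι) (x : SphereModuli ι)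
    (k : ι) : Circle :=
  Quotient.lift (fun z : PuncturedSphere ι => F.relPhase e o z.1 k) (by
    rintro z z' ⟨A, hA⟩
    have : z'.1 = fun j => A • z.1 j := funext hA
    change F.relPhase e o z.1 k = F.relPhase e o z'.1 k
    rw [this, relPhase_smul he o z.2]) x

theorem continuous_moduliPhase (he : ∑ k, e k = 0) (o k : ι) :
    Continuous fun x => F.moduliPhase he o x k :=
  Continuous.quotient_lift (continuous_relPhase he o k) _

theorem relPhase_moduliSection (he : ∑ k, e k = 0) (o : ι) (x : SphereModuli ι) (k : ι) :
    F.relPhase e o (F.moduliSection o x).1 k = F.moduliPhase he o x k := by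
  conv_rhs => rw [← mk_moduliSection (F := F) o x]
  rfl

end LabelFrame

end

/-! ### Automorphisms and constant factors acting on meromorphic functions. -/

theorem IsMeromorphicWithDivisor.comp_smul {np nm : ℕ} {mp : Fin np → ℕ} {mm : Fin nm → ℕ}
    {z z' : Fin np ⊕ Fin nm → OnePoint ℂ} {h : OnePoint ℂ → ℂ} {A : GL (Fin 2) ℂ}
    (hz : ∀ k, z' k = A • z k) (H : IsMeromorphicWithDivisor mp mm z' h) :
    IsMeromorphicWithDivisor mp mm z (fun p => h (A • p)) := by
  classical
  intro g
  have h1 : divisorAt mp mm z' ((A * g) • ((0 : ℂ) : OnePoint ℂ))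
      = divisorAt mp mm z (g • ((0 : ℂ) : OnePoint ℂ)) := by
    have key : ∀ k, z' k = (A * g) • ((0 : ℂ) : OnePoint ℂ) ↔ z k = g • ((0 : ℂ) : OnePoint ℂ) :=
      fun k => by rw [hz, mul_smul, smul_left_cancel_iff]
    simp only [divisorAt_eq_sum]
    exact Finset.sum_congr rfl fun k _ => if_congr (key k) rfl rfl
  have h2 := H (A * g)
  rw [h1] at h2
  simpa only [mul_smul] using h2

theorem IsMeromorphicWithDivisor.const_mul {np nm : ℕ} {mp : Fin np → ℕ} {mm : Fin nm → ℕ}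
    {z : Fin np ⊕ Fin nm → OnePoint ℂ} {h : OnePoint ℂ → ℂ}
    (H : IsMeromorphicWithDivisor mp mm z h) {c : ℂ} (hc : c ≠ 0) :
    IsMeromorphicWithDivisor mp mm z (fun p => c * h p) := fun g =>
  ⟨(meromorphicNFAt_mul_iff_right (g := fun _ => c) analyticAt_const hc).mpr (H g).1,
    (meromorphicOrderAt_mul_of_ne_zero (g := fun _ => c) analyticAt_const hc).trans (H g).2⟩

theorem IsPositiveAt.comp_smul {h : OnePoint ℂ → ℂ} {e : ℤ} {ν : SphereDirection}
    {A : GL (Fin 2) ℂ} (H : IsPositiveAt h e (A • ν)) : IsPositiveAt (fun p => h (A • p)) e ν := by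
  obtain ⟨g, hg⟩ := SphereDirection.mk_surjective ν
  obtain ⟨r, hr, hl⟩ := H.leadingCoeff (g := A * g) (by rw [← hg]; rfl)
  refine ⟨g, hg, r, hr, ?_⟩
  simpa only [mul_smul] using hl

theorem IsPositiveAt.exists_pos_eq {h : OnePoint ℂ → ℂ} {e : ℤ} {ν : SphereDirection} {a : ℂ}
    (H : IsPositiveAt h e ν) (H' : IsPositiveAt (fun p => a * h p) e ν) :
    ∃ r : ℝ, 0 < r ∧ a = r := by
  obtain ⟨g, hg, r, hr, hl⟩ := H
  obtain ⟨s, hs, hl'⟩ := H'.leadingCoeff hg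
  have h1 := hl'.unique (hl.const_mul a)
  refine ⟨s / r, div_pos hs hr, ?_⟩
  have hr' : (r : ℂ) ≠ 0 := by exact_mod_cast hr.ne'
  push_cast
  rw [h1, mul_div_cancel_right₀ _ hr']

/-! ### The moduli space as a space of roots -/

section

variable {E : Type*} [NormedAddCommGroup E] [NormedSpace ℝ E]
  {V : Type*} [TopologicalSpace V] [ChartedSpace E V] [IsManifold 𝓘(ℝ, E) ∞ V]
  {X : CylindricalStructure E V} {γ : SimpleClosedOrbit X}
  {np nm : ℕ} {mp : Fin np → ℕ} {mm : Fin nm → ℕ}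

namespace OrbitCurve

theorem continuous_marker : Continuous (marker : OrbitCurve γ mp mm → _) :=
  continuous_iff_le_induced.mpr inf_le_left

theorem continuous_domain : Continuous (domain : OrbitCurve γ mp mm → _) :=
  Continuous.subtype_mk (continuous_pi fun k => SphereDirection.continuous_point.comp
    ((continuous_apply k).comp continuous_marker)) _

/-- The phase of the meromorphic function of an orbit curve, relative to the frame at `o`. -/
noncomputable def phaseAt (F : LabelFrame (Fin np ⊕ Fin nm)) (o : Fin np ⊕ Fin nm)
    (C : OrbitCurve γ mp mm) : Circle :=
  -- Positivity at the marker says that this is the phase of the leading coefficient at `o` in the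
  -- frame coordinate. Expressed by the angle it needs no choice of a function and is visibly
  -- continuous.
  (F.angle C.marker o ^ punctureOrder mp mm o)⁻¹

variable {F : LabelFrame (Fin np ⊕ Fin nm)}

theorem continuous_angle (k : Fin np ⊕ Fin nm) :
    Continuous fun C : OrbitCurve γ mp mm => F.angle C.marker k := by
  rw [continuous_iff_continuousAt]
  intro C
  exact ContinuousAt.comp (g := fun ν => F.angle ν k)
    (LabelFrame.continuousAt_angle C.puncture_injective k) continuous_marker.continuousAt

/-- The function of an orbit curve in terms of a product of brackets. -/
theorem exists_eq_mul_sphereProduct [T2Space V] [FiniteDimensional ℝ E] (hmp : ∀ k, 0 < mp k)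
    (hmm : ∀ k, 0 < mm k) (hsum : ∑ k, mp k = ∑ k, mm k) (C : OrbitCurve γ mp mm)
    {h : OnePoint ℂ → ℂ} (H : IsMeromorphicWithDivisor mp mm C.domain.1 h)
    (hu : ∀ p, p ∉ range C.domain.1 → C.u p = γ.trivialCylinder (h p)) :
    ∃ c : ℂ, c ≠ 0 ∧
      (∀ p, h p = c * sphereProduct (punctureOrder mp mm) (fun k => homCoord (C.domain.1 k)) p) ∧
      ∀ k, phase (c * F.lead (punctureOrder mp mm) (fun k => homCoord (C.domain.1 k)) k) *
        F.angle C.marker k ^ punctureOrder mp mm k = 1 := by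
  obtain ⟨h', H', hu', hpos⟩ := C.exists_meromorphic hmp hmm
  obtain rfl := H.eq_of_trivialCylinder_eq hmp hmm γ C.domain.2 H' fun p hp => by
    rw [← hu p hp, ← hu' p hp]
  have hS := isMeromorphicWithDivisor_sphereProduct hmp hmm hsum
    (v := fun k => homCoord (C.domain.1 k)) (fun k => homCoord_ne_zero _)
    (by simpa only [projPoint_homCoord] using C.domain.2)
  simp only [projPoint_homCoord] at hS
  obtain ⟨c, hc, hc'⟩ := hS.exists_eq_mul hmp hmm C.domain.2 H
  refine ⟨c, hc, hc', fun k => ?_⟩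
  refine (LabelFrame.isPositiveAt_iff (sum_punctureOrder hsum) (fun k => homCoord_ne_zero _)
    C.puncture_injective (fun k => projPoint_homCoord _) hc k).mp ?_
  have := hpos k
  rwa [show h = _ from funext hc'] at this

/-- Positivity at `k` expresses the power of the angle by the leading coefficient at `k`, which is
the one at `o` times the ratio of the two values of `lead`. This is the equation defining the space
of roots. -/
theorem angle_zpow_eq [T2Space V] [FiniteDimensional ℝ E] (hmp : ∀ k, 0 < mp k)
    (hmm : ∀ k, 0 < mm k) (hsum : ∑ k, mp k = ∑ k, mm k) (o k : Fin np ⊕ Fin nm)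
    (C : OrbitCurve γ mp mm) : F.angle C.marker k ^ punctureOrder mp mm k
      = (C.phaseAt F o * F.moduliPhase (sum_punctureOrder hsum) o ⟦C.domain⟧ k)⁻¹ := by
  obtain ⟨h, H, hu, -⟩ := C.exists_meromorphic hmp hmm
  obtain ⟨c, hc, -, h1⟩ := C.exists_eq_mul_sphereProduct (F := F) hmp hmm hsum H hu
  have hind := pairwiseIndependent_of_projPoint C.domain.2
    (fun k => homCoord_ne_zero (C.domain.1 k)) fun k => projPoint_homCoord _
  have h2 := eq_inv_of_mul_eq_one_right (h1 k)
  have h3 := eq_inv_of_mul_eq_one_left (h1 o)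
  have h4 : F.moduliPhase (sum_punctureOrder hsum) o ⟦C.domain⟧ k
      = phase (F.lead (punctureOrder mp mm) (fun k => homCoord (C.domain.1 k)) k /
        F.lead (punctureOrder mp mm) (fun k => homCoord (C.domain.1 k)) o) := rfl
  have ho := LabelFrame.lead_ne_zero (F := F) (punctureOrder mp mm) hind o
  have hk := LabelFrame.lead_ne_zero (F := F) (punctureOrder mp mm) hind k
  rw [h2, phaseAt, ← h3, h4, ← phase_mul (mul_ne_zero hc ho) (div_ne_zero hk ho)]
  congr 2
  field_simp

/-- Multiplying the meromorphic function multiplies the phase. -/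
theorem phaseAt_mul [T2Space V] [FiniteDimensional ℝ E] (hmp : ∀ k, 0 < mp k)
    (hmm : ∀ k, 0 < mm k) (hsum : ∑ k, mp k = ∑ k, mm k) (o : Fin np ⊕ Fin nm)
    {C C' : OrbitCurve γ mp mm} {h : OnePoint ℂ → ℂ} {a : ℂ} (ha : a ≠ 0)
    (hd : C'.domain = C.domain) (H : IsMeromorphicWithDivisor mp mm C.domain.1 h)
    (hu : ∀ p, p ∉ range C.domain.1 → C.u p = γ.trivialCylinder (h p))
    (hu' : ∀ p, p ∉ range C.domain.1 → C'.u p = γ.trivialCylinder (a * h p)) :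
    C'.phaseAt F o = phase a * C.phaseAt F o := by
  obtain ⟨h', H', hu'', -⟩ := C'.exists_meromorphic hmp hmm
  obtain ⟨c, hc, hc', h1⟩ := C.exists_eq_mul_sphereProduct (F := F) hmp hmm hsum H hu
  obtain ⟨d, hd0, hd', h1'⟩ := C'.exists_eq_mul_sphereProduct (F := F) hmp hmm hsum H' hu''
  rw [hd] at hd' h1' H' hu''
  have hind := pairwiseIndependent_of_projPoint C.domain.2
    (fun k => homCoord_ne_zero (C.domain.1 k)) fun k => projPoint_homCoord _
  -- The two constants are compared at one point that is not a puncture.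
  obtain ⟨p, hp⟩ : ∃ p, p ∉ range C.domain.1 := by
    by_contra hall
    push Not at hall
    exact infinite_univ.not_finite ((finite_range C.domain.1).subset fun p _ => hall p)
  have hdc : d = a * c := by
    have h2 := γ.trivialCylinder_injOn (H'.ne_zero hp) (mul_ne_zero ha (H.ne_zero hp))
      ((hu'' p hp).symm.trans (hu' p hp))
    rw [hd', hc', ← mul_assoc] at h2
    refine mul_right_cancel₀ (fun h0 => H.ne_zero hp ?_) h2
    rw [hc', h0, mul_zero]
  have ho := LabelFrame.lead_ne_zero (F := F) (punctureOrder mp mm) hind o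
  rw [phaseAt, phaseAt, ← eq_inv_of_mul_eq_one_left (h1 o), ← eq_inv_of_mul_eq_one_left (h1' o),
    hdc, mul_assoc, phase_mul ha (mul_ne_zero hc ho)]

/-- An automorphism matches the punctures and, by the angles, the markers. The two functions then
differ by a constant, which is positive since both are positive at the common marker `o`; a positive
constant is a translation of the target. -/
theorem equiv_of_angle_eq [T2Space V] [FiniteDimensional ℝ E] (hmp : ∀ k, 0 < mp k)
    (hmm : ∀ k, 0 < mm k) (o : Fin np ⊕ Fin nm) {C C' : OrbitCurve γ mp mm}
    (hd : (⟦C.domain⟧ : SphereModuli (Fin np ⊕ Fin nm)) = ⟦C'.domain⟧)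
    (ha : ∀ k, F.angle C.marker k = F.angle C'.marker k) : C ≈ C' := by
  obtain ⟨A, hA⟩ : ∃ A : GL (Fin 2) ℂ, ∀ k, C'.domain.1 k = A • C.domain.1 k := Quotient.exact hd
  have hmark : (fun k => A • C.marker k) = C'.marker := by
    refine LabelFrame.eq_of_angle_eq (F := F)
      (LabelFrame.injective_point_smul C.puncture_injective A) (fun k => ?_) fun k => ?_
    · rw [SphereDirection.point_smul]
      exact (hA k).symm
    · rw [LabelFrame.angle_smul C.puncture_injective, ha]
  obtain ⟨h, H, hu, hpos⟩ := C.exists_meromorphic hmp hmm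
  obtain ⟨h', H', hu', hpos'⟩ := C'.exists_meromorphic hmp hmm
  obtain ⟨a, -, hha⟩ := H.exists_eq_mul hmp hmm C.domain.2 (H'.comp_smul hA)
  have hpos2 : IsPositiveAt (fun p => a * h p) (punctureOrder mp mm o) (C.marker o) := by
    rw [← funext hha]
    refine IsPositiveAt.comp_smul ?_
    rw [show A • C.marker o = C'.marker o from congrFun hmark o]
    exact hpos' o
  obtain ⟨r, hr, rfl⟩ := (hpos o).exists_pos_eq hpos2
  refine ⟨A, γ.period * (Real.log r / (2 * Real.pi)), fun k => (congrFun hmark k).symm,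
    fun p hp => ?_⟩
  have hp' : A • p ∉ range C'.domain.1 := by
    rintro ⟨k, hk⟩
    rw [hA] at hk
    exact hp ⟨k, smul_left_cancel A hk⟩
  rw [hu' _ hp', hha, γ.trivialCylinder_mul_ofReal hr (H.ne_zero hp), hu p hp]

/-- The orbit curve with given punctures, phase and angles. -/
theorem exists_of_angle [T2Space V] (hmp : ∀ k, 0 < mp k) (hmm : ∀ k, 0 < mm k)
    (hsum : ∑ k, mp k = ∑ k, mm k) (o : Fin np ⊕ Fin nm)
    (z : PuncturedSphere (Fin np ⊕ Fin nm)) (θ : Circle) (ζ : Fin np ⊕ Fin nm → Circle)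
    (hζ : ∀ k, ζ k ^ punctureOrder mp mm k
      = (θ * F.relPhase (punctureOrder mp mm) o z.1 k)⁻¹) :
    ∃ C : OrbitCurve γ mp mm, C.marker = (fun k => (F.frameDirection z.1 k).rotate (ζ k)) ∧
      C.u = fun p => γ.trivialCylinder (θ * F.model (punctureOrder mp mm) o z.1 p) := by
  have he := sum_punctureOrder hsum
  have hv := fun k => homCoord_ne_zero (z.1 k)
  have hind := pairwiseIndependent_of_projPoint z.2 hv fun k => projPoint_homCoord _
  have ho := LabelFrame.lead_ne_zero (F := F) (punctureOrder mp mm) hind o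
  have hθ : (θ : ℂ) ≠ 0 := θ.coe_ne_zero
  have hpt : ∀ k, ((F.frameDirection z.1 k).rotate (ζ k)).point = z.1 k := fun k => by
    rw [SphereDirection.point_rotate, LabelFrame.point_frameDirection z.2]
  have hpt0 : (fun k => (F.frameDirection z.1 k).point) = z.1 :=
    funext fun k => LabelFrame.point_frameDirection z.2 k
  have hinj : Function.Injective fun k => ((F.frameDirection z.1 k).rotate (ζ k)).point := by
    simpa only [hpt] using z.2
  have hS := isMeromorphicWithDivisor_sphereProduct hmp hmm hsum (v := fun k => homCoord (z.1 k))
    hv (by simpa only [projPoint_homCoord] using z.2)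
  simp only [projPoint_homCoord] at hS
  -- With the constant `θ / lead o` the leading coefficient at `k` has phase `θ` times the relative
  -- phase, which the power of `ζ k`, the angle of the marker, must cancel.
  have e1 : (fun p => (θ : ℂ) * F.model (punctureOrder mp mm) o z.1 p) = fun p =>
      θ / F.lead (punctureOrder mp mm) (fun k => homCoord (z.1 k)) o *
        sphereProduct (punctureOrder mp mm) (fun k => homCoord (z.1 k)) p := by
    ext1 p
    rw [LabelFrame.model]
    ring
  have hpos : ∀ k, IsPositiveAt (fun p => θ * F.model (punctureOrder mp mm) o z.1 p)
      (punctureOrder mp mm k) ((F.frameDirection z.1 k).rotate (ζ k)) := by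
    intro k
    have hk := LabelFrame.lead_ne_zero (F := F) (punctureOrder mp mm) hind k
    rw [e1, LabelFrame.isPositiveAt_iff he hv hinj (fun k => by rw [hpt, projPoint_homCoord])
      (div_ne_zero hθ ho), LabelFrame.angle_rotate (by rw [hpt0]; exact z.2),
      LabelFrame.angle_frameDirection z.2, one_mul, hζ,
      div_mul_eq_mul_div, mul_div_assoc, phase_mul hθ (div_ne_zero hk ho), phase_coe]
    exact mul_inv_cancel _
  refine exists_of_meromorphic hmp hmm (h := fun p => θ * F.model (punctureOrder mp mm) o z.1 p)
    hinj ?_ hpos fun _ _ => rfl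
  simp only [hpt]
  rw [e1]
  exact hS.const_mul (div_ne_zero hθ ho)

/-- The space of roots describing the moduli space of orbit curves. -/
abbrev ModuliCover (F : LabelFrame (Fin np ⊕ Fin nm)) (hsum : ∑ k, mp k = ∑ k, mm k)
    (o : Fin np ⊕ Fin nm) : Type :=
  RootCover (punctureOrder mp mm) fun (b : Circle × SphereModuli (Fin np ⊕ Fin nm)) k =>
    (b.1 * F.moduliPhase (sum_punctureOrder hsum) o b.2 k)⁻¹

variable [T2Space V]

theorem exists_of_cover (hmp : ∀ k, 0 < mp k) (hmm : ∀ k, 0 < mm k)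
    (hsum : ∑ k, mp k = ∑ k, mm k) (o : Fin np ⊕ Fin nm) (γ : SimpleClosedOrbit X)
    (y : ModuliCover F hsum o) :
    ∃ C : OrbitCurve γ mp mm,
      C.marker = (fun k => (F.frameDirection (F.moduliSection o y.1.1.2).1 k).rotate (y.1.2 k)) ∧
      C.u = fun p => γ.trivialCylinder
        (y.1.1.1 * F.model (punctureOrder mp mm) o (F.moduliSection o y.1.1.2).1 p) :=
  exists_of_angle hmp hmm hsum o _ _ _ fun k => by
    rw [y.2 k, LabelFrame.relPhase_moduliSection (sum_punctureOrder hsum)]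

/-- The orbit curve with given invariants. -/
noncomputable def ofCover (hmp : ∀ k, 0 < mp k) (hmm : ∀ k, 0 < mm k)
    (hsum : ∑ k, mp k = ∑ k, mm k) (o : Fin np ⊕ Fin nm) (γ : SimpleClosedOrbit X)
    (y : ModuliCover F hsum o) : OrbitCurve γ mp mm :=
  (exists_of_cover hmp hmm hsum o γ y).choose

section

variable (hmp : ∀ k, 0 < mp k) (hmm : ∀ k, 0 < mm k) (hsum : ∑ k, mp k = ∑ k, mm k)
  (o : Fin np ⊕ Fin nm)

theorem marker_ofCover (y : ModuliCover F hsum o) : (ofCover hmp hmm hsum o γ y).marker =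
    fun k => (F.frameDirection (F.moduliSection o y.1.1.2).1 k).rotate (y.1.2 k) :=
  (exists_of_cover hmp hmm hsum o γ y).choose_spec.1

theorem u_ofCover (y : ModuliCover F hsum o) : (ofCover hmp hmm hsum o γ y).u =
    fun p => γ.trivialCylinder
      (y.1.1.1 * F.model (punctureOrder mp mm) o (F.moduliSection o y.1.1.2).1 p) :=
  (exists_of_cover hmp hmm hsum o γ y).choose_spec.2

theorem domain_ofCover (y : ModuliCover F hsum o) :
    (ofCover hmp hmm hsum o γ y).domain = F.moduliSection o y.1.1.2 := by
  refine Subtype.ext (funext fun k => ?_)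
  change ((ofCover hmp hmm hsum o γ y).marker k).point = _
  rw [marker_ofCover, SphereDirection.point_rotate,
    LabelFrame.point_frameDirection (F.moduliSection o y.1.1.2).2]

theorem angle_ofCover (y : ModuliCover F hsum o) (k : Fin np ⊕ Fin nm) :
    F.angle (ofCover hmp hmm hsum o γ y).marker k = y.1.2 k := by
  have h := (F.moduliSection o y.1.1.2).2
  have hpt : (fun k => (F.frameDirection (F.moduliSection o y.1.1.2).1 k).point)
      = (F.moduliSection o y.1.1.2).1 := funext fun k => LabelFrame.point_frameDirection h k
  rw [marker_ofCover, LabelFrame.angle_rotate (by rwa [hpt]), LabelFrame.angle_frameDirection h,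
    one_mul]

theorem continuous_ofCover :
    Continuous (ofCover hmp hmm hsum o γ : ModuliCover F hsum o → _) := by
  have hz : Continuous fun y : ModuliCover F hsum o => F.moduliSection o y.1.1.2 :=
    (LabelFrame.continuous_moduliSection o).comp
      (continuous_snd.comp (continuous_fst.comp continuous_subtype_val))
  have hθ₀ : Continuous fun y : ModuliCover F hsum o => (y.1.1.1 : ℂ) :=
    continuous_subtype_val.comp
      (continuous_fst.comp (continuous_fst.comp continuous_subtype_val))
  refine continuous_inf_rng.mpr ⟨continuous_induced_rng.mpr ?_, continuous_generateFrom_iff.mpr ?_⟩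
  · have h1 : ∀ k, Continuous fun y : ModuliCover F hsum o => y.1.2 k := fun k =>
      (continuous_apply k).comp (continuous_snd.comp continuous_subtype_val)
    have h2 : ∀ k, Continuous fun y : ModuliCover F hsum o =>
        (F.frameDirection (F.moduliSection o y.1.1.2).1 k).rotate (y.1.2 k) := fun k =>
      Continuous.comp (g := fun p : PuncturedSphere (Fin np ⊕ Fin nm) × Circle =>
        (F.frameDirection p.1.1 k).rotate p.2)
        (f := fun y : ModuliCover F hsum o => (F.moduliSection o y.1.1.2, y.1.2 k))
        (LabelFrame.continuous_frameDirection_rotate k) (hz.prodMk (h1 k))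
    refine (continuous_pi h2).congr fun y => ?_
    exact (marker_ofCover hmp hmm hsum o y).symm
  · rintro _ ⟨K, W, hK, hW, rfl⟩
    rw [isOpen_iff_mem_nhds]
    intro y₀ hy₀
    -- By compactness of `K` it suffices to treat the parameter and the point of the sphere jointly,
    -- near each point of `K`.
    refine hK.eventually_forall_of_forall_eventually (P := fun y w =>
      w ∉ range (ofCover hmp hmm hsum o γ y).domain.1 ∧ (ofCover hmp hmm hsum o γ y).u w ∈ W)
      fun w hw => ?_
    obtain ⟨h1, h2⟩ := hy₀ w hw
    simp only [domain_ofCover, u_ofCover] at h1 h2 ⊢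
    refine Eventually.and ?_ ?_
    · have hzk : ∀ k, Continuous fun q : ModuliCover F hsum o × OnePoint ℂ =>
          (F.moduliSection o q.1.1.1.2).1 k := fun k =>
        ((continuous_apply k).comp (continuous_subtype_val.comp hz)).comp continuous_fst
      have h3 : ∀ k, ∀ᶠ q : ModuliCover F hsum o × OnePoint ℂ in 𝓝 (y₀, w),
          (F.moduliSection o q.1.1.1.2).1 k ≠ q.2 := fun k =>
        (isOpen_ne_fun (hzk k) continuous_snd).mem_nhds fun h => h1 ⟨k, h⟩
      filter_upwards [eventually_all.mpr h3] with q hq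
      rintro ⟨k, hk⟩
      exact hq k hk
    · have hm : ContinuousAt (fun q : ModuliCover F hsum o × OnePoint ℂ =>
          F.model (punctureOrder mp mm) o (F.moduliSection o q.1.1.1.2).1 q.2) (y₀, w) :=
        ContinuousAt.comp (g := fun q : PuncturedSphere (Fin np ⊕ Fin nm) × OnePoint ℂ =>
            F.model (punctureOrder mp mm) o q.1.1 q.2)
          (f := fun q : ModuliCover F hsum o × OnePoint ℂ => (F.moduliSection o q.1.1.1.2, q.2))
          (LabelFrame.continuousAt_model (sum_punctureOrder hsum) o _ h1)
          ((hz.comp continuous_fst).prodMk continuous_snd).continuousAt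
      have hθ : Continuous fun q : ModuliCover F hsum o × OnePoint ℂ => (q.1.1.1.1 : ℂ) :=
        hθ₀.comp continuous_fst
      have hne : (y₀.1.1.1 : ℂ) *
          F.model (punctureOrder mp mm) o (F.moduliSection o y₀.1.1.2).1 w ≠ 0 :=
        mul_ne_zero (Circle.coe_ne_zero _) (LabelFrame.model_ne_zero o _ h1)
      exact (ContinuousAt.comp (g := γ.trivialCylinder)
        (f := fun q : ModuliCover F hsum o × OnePoint ℂ => (q.1.1.1.1 : ℂ) *
          F.model (punctureOrder mp mm) o (F.moduliSection o q.1.1.1.2).1 q.2)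
        (γ.continuousAt_trivialCylinder hne) (hθ.continuousAt.mul hm)).eventually_mem (hW.mem_nhds h2)

end

variable [FiniteDimensional ℝ E]

/-- The invariants of an orbit curve. -/
noncomputable def toCover (F : LabelFrame (Fin np ⊕ Fin nm)) (hmp : ∀ k, 0 < mp k)
    (hmm : ∀ k, 0 < mm k) (hsum : ∑ k, mp k = ∑ k, mm k) (o : Fin np ⊕ Fin nm)
    (C : OrbitCurve γ mp mm) : ModuliCover F hsum o :=
  ⟨((C.phaseAt F o, ⟦C.domain⟧), F.angle C.marker), fun k => C.angle_zpow_eq hmp hmm hsum o k⟩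

theorem toCover_eq_of_equiv (hmp : ∀ k, 0 < mp k) (hmm : ∀ k, 0 < mm k)
    (hsum : ∑ k, mp k = ∑ k, mm k) (o : Fin np ⊕ Fin nm) {C C' : OrbitCurve γ mp mm} (h : C ≈ C') :
    C.toCover F hmp hmm hsum o = C'.toCover F hmp hmm hsum o := by
  obtain ⟨A, c, hA, -⟩ := h
  have h1 : F.angle C'.marker = F.angle C.marker := by
    rw [show C'.marker = fun k => A • C.marker k from funext hA]
    exact funext fun k => LabelFrame.angle_smul C.puncture_injective A k
  have h2 : (⟦C.domain⟧ : SphereModuli (Fin np ⊕ Fin nm)) = ⟦C'.domain⟧ :=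
    Quotient.sound ⟨A, fun k => by
      change (C'.marker k).point = A • (C.marker k).point
      rw [hA, SphereDirection.point_smul]⟩
  simp only [toCover, phaseAt, h1, h2]

theorem continuous_toCover (hmp : ∀ k, 0 < mp k) (hmm : ∀ k, 0 < mm k)
    (hsum : ∑ k, mp k = ∑ k, mm k) (o : Fin np ⊕ Fin nm) :
    Continuous (toCover F hmp hmm hsum o : OrbitCurve γ mp mm → _) := by
  refine Continuous.subtype_mk (Continuous.prodMk (Continuous.prodMk ?_ ?_)
    (continuous_pi fun k => continuous_angle k)) _
  · exact ((continuous_angle o).zpow _).inv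
  · exact continuous_quotient_mk'.comp continuous_domain

section

variable (hmp : ∀ k, 0 < mp k) (hmm : ∀ k, 0 < mm k) (hsum : ∑ k, mp k = ∑ k, mm k)
  (o : Fin np ⊕ Fin nm)

theorem toCover_ofCover (y : ModuliCover F hsum o) :
    (ofCover hmp hmm hsum o γ y).toCover F hmp hmm hsum o = y := by
  have h1 : ((ofCover hmp hmm hsum o γ y).toCover F hmp hmm hsum o).1.2 = y.1.2 :=
    funext fun k => angle_ofCover hmp hmm hsum o y k
  have h2 : ((ofCover hmp hmm hsum o γ y).toCover F hmp hmm hsum o).1.1.2 = y.1.1.2 := by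
    change ⟦(ofCover hmp hmm hsum o γ y).domain⟧ = y.1.1.2
    rw [domain_ofCover, LabelFrame.mk_moduliSection]
  refine Subtype.ext (Prod.ext (Prod.ext ?_ h2) h1)
  -- The phase is recovered from the root equation at `o`, once angles and configuration are known
  -- to agree.
  have h3 := ((ofCover hmp hmm hsum o γ y).toCover F hmp hmm hsum o).2 o
  rw [h1, y.2 o] at h3
  beta_reduce at h3
  rw [h2] at h3
  exact (mul_right_cancel (inv_injective h3)).symm

/-- The moduli space of orbit curves is the space of roots. -/
noncomputable def moduliHomeomorph (F : LabelFrame (Fin np ⊕ Fin nm)) (γ : SimpleClosedOrbit X) :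
    OrbitModuli γ mp mm ≃ₜ ModuliCover F hsum o where
  toFun := Quotient.lift (toCover F hmp hmm hsum o)
    fun _ _ h => toCover_eq_of_equiv hmp hmm hsum o h
  invFun y := ⟦ofCover hmp hmm hsum o γ y⟧
  left_inv x := by
    induction x using Quotient.inductionOn with
    | h C =>
      have h := toCover_ofCover (γ := γ) hmp hmm hsum o (C.toCover F hmp hmm hsum o)
      refine Quotient.sound (equiv_of_angle_eq (F := F) hmp hmm o
        (congrArg (fun y => y.1.1.2) h) fun k => congrFun (congrArg (fun y => y.1.2) h) k)
  right_inv y := toCover_ofCover hmp hmm hsum o y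
  continuous_toFun := (continuous_toCover hmp hmm hsum o).quotient_lift _
  continuous_invFun := continuous_quotient_mk'.comp (continuous_ofCover hmp hmm hsum o)

end

end OrbitCurve

end

/-! ### Rotation of the markers and assembly of the theorem. -/

section

variable {E : Type*} [NormedAddCommGroup E] [NormedSpace ℝ E]
  {V : Type*} [TopologicalSpace V] [ChartedSpace E V] [IsManifold 𝓘(ℝ, E) ∞ V]
  {X : CylindricalStructure E V} {γ : SimpleClosedOrbit X}
  {np nm : ℕ} {mp : Fin np → ℕ} {mm : Fin nm → ℕ}

namespace OrbitCurve

theorem domain_eq_of_rotate {C C' : OrbitCurve γ mp mm} {ζ : Fin np ⊕ Fin nm → Circle}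
    (h : ∀ k, C'.marker k = (C.marker k).rotate (ζ k)) : C'.domain = C.domain := by
  refine Subtype.ext (funext fun k => ?_)
  change (C'.marker k).point = (C.marker k).point
  rw [h, SphereDirection.point_rotate]

theorem phaseAt_rotate (F : LabelFrame (Fin np ⊕ Fin nm)) (o : Fin np ⊕ Fin nm)
    {C C' : OrbitCurve γ mp mm} {ζ : Fin np ⊕ Fin nm → Circle}
    (h : ∀ k, C'.marker k = (C.marker k).rotate (ζ k)) (hζ : ζ o ^ Sum.elim mp mm o = 1) :
    C'.phaseAt F o = C.phaseAt F o := by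
  rw [phaseAt, phaseAt, show C'.marker = fun k => (C.marker k).rotate (ζ k) from funext h,
    LabelFrame.angle_rotate C.puncture_injective, mul_zpow,
    (zpow_punctureOrder_eq_one_iff mp mm o _).mpr hζ, mul_one]

end OrbitCurve

end

theorem circleExp_pow_eq_one {m : ℕ} (hm : 0 < m) (j : ℤ) :
    Circle.exp (2 * Real.pi * j / m) ^ m = 1 := by
  have hm' : (m : ℝ) ≠ 0 := by exact_mod_cast hm.ne'
  rw [← Circle.exp_natCast_mul, mul_div_cancel₀ _ hm', Circle.exp_two_pi_mul_int]

/-- Equality of cardinalities; as the `m k` need not be coprime, there may be no isomorphism of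
groups. -/
theorem nonempty_pi_zmod_equiv {n : ℕ} {m : Fin n → ℕ} (hm : ∀ k, 0 < m k) :
    Nonempty ((∀ k, ZMod (m k)) ≃ ZMod (∏ k, m k)) := by
  have : ∀ k, NeZero (m k) := fun k => ⟨(hm k).ne'⟩
  have : NeZero (∏ k, m k) := ⟨(Finset.prod_pos fun k _ => hm k).ne'⟩
  exact ⟨Fintype.equivOfCardEq (by simp [Fintype.card_pi, ZMod.card])⟩

/-- The moduli space of orbit curves is a product, and covers the product of the circle and the
moduli space of punctured spheres. -/
theorem proposition1p1
    {E : Type*} [NormedAddCommGroup E] [NormedSpace ℝ E] [FiniteDimensional ℝ E]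
    {V : Type*} [TopologicalSpace V] [T2Space V] [ChartedSpace E V] [IsManifold 𝓘(ℝ, E) ∞ V]
    (X : CylindricalStructure E V) (γ : SimpleClosedOrbit X)
    (np nm : ℕ) (mp : Fin np → ℕ) (mm : Fin nm → ℕ)
    (hmp : ∀ k, 0 < mp k) (hmm : ∀ k, 0 < mm k)
    (hsum : ∑ k, mp k = ∑ k, mm k) (hn : 3 ≤ np + nm) :
    -- The maps underlying orbit curves are the meromorphic functions with the given divisor.
    (∀ (z : PuncturedSphere (Fin np ⊕ Fin nm)) (u : OnePoint ℂ → ℝ × V),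
      (∃ C : OrbitCurve γ mp mm, C.domain = z ∧ C.u = u) ↔
        ∃! h : OnePoint ℂ → ℂ, IsMeromorphicWithDivisor mp mm z.1 h ∧
          ∀ w, w ∉ range z.1 → u w = γ.trivialCylinder (h w)) ∧
    -- The possible markers at a puncture of multiplicity `m` form one orbit of the rotations by
    -- `m`-th roots of unity, independently at all punctures.
    (∀ (C : OrbitCurve γ mp mm) (ν : Fin np ⊕ Fin nm → SphereDirection),
      (∃ C' : OrbitCurve γ mp mm, C'.domain = C.domain ∧ C'.u = C.u ∧ C'.marker = ν) ↔
        ∀ k, ∃ ζ : Circle, ζ ^ (Sum.elim mp mm k) = 1 ∧ ν k = (C.marker k).rotate ζ) ∧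
    -- The moduli space is the product.
    ∃ (Φ : OrbitModuli γ mp mm ≃
          Circle × SphereModuli (Fin np ⊕ Fin nm) × ZMod (∏ k, mp k) × ZMod (∏ k, mm k))
      (ep : (∀ k, ZMod (mp k)) ≃ ZMod (∏ k, mp k)) (em : (∀ k, ZMod (mm k)) ≃ ZMod (∏ k, mm k)),
      -- second component: the underlying punctured sphere
      (∀ C : OrbitCurve γ mp mm, (Φ ⟦C⟧).2.1 = ⟦C.domain⟧) ∧
      -- first component: the phase of the nonzero factor in the meromorphic function
      (∀ (C C' : OrbitCurve γ mp mm) (h : OnePoint ℂ → ℂ) (a : ℂ), a ≠ 0 →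
        C'.domain = C.domain → IsMeromorphicWithDivisor mp mm C.domain.1 h →
        (∀ w, w ∉ range C.domain.1 → C.u w = γ.trivialCylinder (h w)) →
        (∀ w, w ∉ range C.domain.1 → C'.u w = γ.trivialCylinder (a * h w)) →
        ((Φ ⟦C'⟧).1 : ℂ) = a / ‖a‖ * (Φ ⟦C⟧).1) ∧
      -- third and fourth component: the markers
      (∀ (C C' : OrbitCurve γ mp mm) (j : Fin np ⊕ Fin nm → ℤ), C'.u = C.u →
        (∀ k, C'.marker k =
          (C.marker k).rotate (Circle.exp (2 * Real.pi * j k / (Sum.elim mp mm k : ℕ)))) →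
        Φ ⟦C'⟧ = ((Φ ⟦C⟧).1, (Φ ⟦C⟧).2.1,
          ep (ep.symm (Φ ⟦C⟧).2.2.1 + fun k => (j (Sum.inl k) : ZMod (mp k))),
          em (em.symm (Φ ⟦C⟧).2.2.2 + fun k => (j (Sum.inr k) : ZMod (mm k))))) ∧
      -- forgetting the markers is a covering of `S¹ × M_{0,n}`
      IsCoveringMap (fun x => ((Φ x).1, (Φ x).2.1)) := by
  refine ⟨exists_orbitCurve_iff γ hmp hmm, exists_orbitCurve_marker_iff hmp hmm, ?_⟩
  obtain ⟨F⟩ := nonempty_labelFrame (ι := Fin np ⊕ Fin nm) (by simpa using hn)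
  have : Nonempty (Fin np ⊕ Fin nm) := by
    rw [← Fintype.card_pos_iff, Fintype.card_sum, Fintype.card_fin, Fintype.card_fin]; omega
  let o : Fin np ⊕ Fin nm := Classical.arbitrary _
  obtain ⟨ep⟩ := nonempty_pi_zmod_equiv hmp
  obtain ⟨em⟩ := nonempty_pi_zmod_equiv hmm
  have hm : ∀ k, 0 < Sum.elim mp mm k := by rintro (k | k); exacts [hmp k, hmm k]
  have he := punctureOrder_ne_zero hmp hmm
  obtain ⟨Θ, hΘ, hΘj⟩ := exists_rootCover_equiv hm (zpow_punctureOrder_eq_one_iff mp mm) he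
    fun (b : Circle × SphereModuli (Fin np ⊕ Fin nm)) k =>
      (b.1 * F.moduliPhase (sum_punctureOrder hsum) o b.2 k)⁻¹
  let Ψ := OrbitCurve.moduliHomeomorph hmp hmm hsum o F γ
  -- Regroups the residues into those of the positive and those of the negative punctures.
  let Ξ : (Circle × SphereModuli (Fin np ⊕ Fin nm)) × (∀ k, ZMod (Sum.elim mp mm k)) ≃
      Circle × SphereModuli (Fin np ⊕ Fin nm) × ZMod (∏ k, mp k) × ZMod (∏ k, mm k) :=
    { toFun := fun q => (q.1.1, q.1.2, ep fun k => q.2 (Sum.inl k), em fun k => q.2 (Sum.inr k))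
      invFun := fun q => ((q.1, q.2.1), fun k => match k with
        | Sum.inl k => ep.symm q.2.2.1 k
        | Sum.inr k => em.symm q.2.2.2 k)
      left_inv := fun q => by
        refine Prod.ext rfl (funext fun k => ?_)
        rcases k with k | k
        · exact congrFun (ep.symm_apply_apply fun k => q.2 (Sum.inl k)) k
        · exact congrFun (em.symm_apply_apply fun k => q.2 (Sum.inr k)) k
      right_inv := fun q => by simp }
  have hΞ : ∀ x, ((Ξ (Θ (Ψ x))).1, (Ξ (Θ (Ψ x))).2.1) = (Ψ x).1.1 := fun x => hΘ (Ψ x)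
  have h1 : ∀ C : OrbitCurve γ mp mm, (Ξ (Θ (Ψ ⟦C⟧))).1 = C.phaseAt F o := fun C =>
    congrArg Prod.fst (hΞ ⟦C⟧)
  refine ⟨(Ψ.toEquiv.trans Θ).trans Ξ, ep, em, fun C => congrArg Prod.snd (hΞ ⟦C⟧), ?_, ?_, ?_⟩
  · intro C C' h a ha hd H hu hu'
    change ((Ξ (Θ (Ψ ⟦C'⟧))).1 : ℂ) = a / ‖a‖ * (Ξ (Θ (Ψ ⟦C⟧))).1
    rw [h1, h1, OrbitCurve.phaseAt_mul hmp hmm hsum o ha hd H hu hu', Circle.coe_mul, coe_phase ha]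
  · intro C C' j _ hrot
    have hd := OrbitCurve.domain_eq_of_rotate hrot
    have hθ := OrbitCurve.phaseAt_rotate F o hrot (circleExp_pow_eq_one (hm o) _)
    have hΘ' := hΘj (Ψ ⟦C⟧) (Ψ ⟦C'⟧) j
      (Prod.ext hθ (congrArg (Quotient.mk _) hd)) fun k => by
        change F.angle C'.marker k = F.angle C.marker k * _
        rw [show C'.marker = _ from funext hrot, LabelFrame.angle_rotate C.puncture_injective]
    change Ξ (Θ (Ψ ⟦C'⟧)) = _
    rw [hΘ', ← hΘ]
    refine Prod.ext rfl (Prod.ext rfl (Prod.ext ?_ ?_))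
    · exact congrArg (fun x => ep (x + fun k => (j (Sum.inl k) : ZMod (mp k))))
        (ep.symm_apply_apply fun k => (Θ (Ψ ⟦C⟧)).2 (Sum.inl k)).symm
    · exact congrArg (fun x => em (x + fun k => (j (Sum.inr k) : ZMod (mm k))))
        (em.symm_apply_apply fun k => (Θ (Ψ ⟦C⟧)).2 (Sum.inr k)).symm
  -- The choices of roots affect only the last two components; the first two are the projection of
  -- the space of roots composed with the homeomorphism `Ψ`.
  · have hcov := (isCoveringMap_rootCover he
      (ψ := fun (b : Circle × SphereModuli (Fin np ⊕ Fin nm)) k =>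
        (b.1 * F.moduliPhase (sum_punctureOrder hsum) o b.2 k)⁻¹)
      fun k => (continuous_fst.mul
        ((LabelFrame.continuous_moduliPhase (sum_punctureOrder hsum) o k).comp continuous_snd)).inv).comp_homeomorph Ψ
    exact (funext hΞ) ▸ hcov
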